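/- **Setting.** Let $n\ge 1$ and let $\Omega\subset\mathbb R^n$ be a bounded domain with $C^2$ boundary; put $\mathbb d=\max_{x\in\partial\Omega}|x|$. Let $a,c\in C^2(\overline\Omega\times\mathbb R_{\ge0})$ and $b,m\in C^2(\overline\Omega\times\mathbb R_{\ge0};\mathbb R^n)$ be given, together with $h\in C^2(\overline\Omega\times\mathbb R_{\ge0}\times\mathbb R\times\mathbb R^n)$, $g\in C^3(\overline\Omega\times\mathbb R_{\ge0}\times\mathbb R)$ and $\psi\in C^2(\overline\Omega\times\mathbb R_{\ge0}\times\mathbb R)$. An admissible input consists of $f,d\in C^2(\overline\Omega\times\mathbb R_{\ge0})$ and $w^0\in C^2(\overline\Omega)$ with $\psi(x,0,w^0(x))=d(x,0)$ on $\partial\Omega$. Consider $$w_t-\operatorname{div}(a\nabla w)+b\cdot\nabla w+cw+h(x,t,w,\nabla w)+m\cdot\nabla\big(g(x,t,w)\big)=f\ \text{ in }\Omega\times(0,T),$$ $$\psi(x,t,w)=d\ \text{ on }\partial\Omega\times(0,T),\qquad w(\cdot,0)=w^0\ \text{ in }\Omega,$$ where solutions are classical: $w\in C^{2,1}(\Omega\times(0,T))\cap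 C(\overline\Omega\times[0,T])$. **Assumptions.** (1) There are constants $0<\underline a\le a\le\overline a$ on $\overline\Omega\times\mathbb R_{\ge0}$. On $\overline\Omega\times\mathbb R_{\ge0}\times\mathbb R\times\mathbb R^n$, $$|h|+|h_t|+|h_s|+(1+|\eta|)\sum_i|h_{\eta_i}|\le\mu_1(|s|)(1+|\eta|^2)$$ with $\mu_1\ge0$ continuous and increasing on $\mathbb R_{\ge0}$. On $\overline\Omega\times\mathbb R_{\ge0}\times\mathbb R$, $\sum_i|g_{x_i}|+|g_s|+|g_{ss}|\le\mu_2(|s|)$ with $\mu_2>0$ continuous and increasing on $\mathbb R_{\ge0}$ and $\int_0^\infty ds/\mu_2(s)=\infty$. On $\partial\Omega\times\mathbb R_{\ge0}\times\mathbb R$, $-\psi s\le\mu_3(x,t)(s^2+1)$ with $\mu_3$ continuous. (2) $-h(x,t,s,\eta)s\le\mu(x,t)s^2$ on $\Omega\times\mathbb R_+\times\mathbb R\times\mathbb R^n$ with $\mu\in C(\overline\Omega\times\mathbb R_{\ge0})$. There are $s_0>0$ and $g_0\in C(\overline\Omega\times\mathbb R_{\ge0})$ with $|g(x,t,s)|\le|g_0(x,t)||s|$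 on $\Omega\times\mathbb R_+\times[-s_0,s_0]$. There is a constant $\underline c\ge0$ with $\underline c\le c-\operatorname{div}b-\mu$ on $\Omega\times\mathbb R_+$. (3) There are $p\in C^2(\Omega)\cap C^1(\overline\Omega)$ and a constant $p_0\ge0$ with $\operatorname{div}(a\nabla p)+b\cdot\nabla p\le-p_0$ in $\Omega\times\mathbb R_+$, $p=0$ on $\partial\Omega$, and $g(x,t,s)\,s\,\operatorname{div}(pm)\le0$ on $\overline\Omega\times\mathbb R_{\ge0}\times\mathbb R$. Moreover $\psi(x,t,s)=\psi_1(x,t)\psi_2(s)$ on $\partial\Omega\times\mathbb R_{\ge0}\times\mathbb R$, with $\psi_1\ge\underline{\psi_1}$ for a constant $\underline{\psi_1}>0$ and $\psi_2:\mathbb R\to\mathbb R$ continuous and strictly increasing. (4) $\phi\in C(\mathbb R_{\ge0})\cap C^1(\mathbb R_+)$, $\phi(0)=0$, $\phi>0$ on $\mathbb R_+$, and $\delta_0\le s\phi'(s)/\phi(s)\le\delta_1$ for $s>0$, where $\delta_0,\delta_1>0$. Put $\Phi(s)=\int_0^s\phi$ and $\widetilde\Phi(s)=\int_0^s\phi^{-1}$.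 **Notation.** $\|u\|_{L^\Phi((0,T);X)}$ is the Luxemburg norm $\inf\{k>0:\int_0^T\Phi(\|u(\cdot,t)\|_X/k)\,dt\le1\}$. For $\lambda>0$ let $$C(\lambda)=2\max_{i\in\{0,1\}}\Big(\frac1\lambda\,\frac{\delta_1^2}{\delta_0(1+\delta_1)}\,\widetilde\Phi(1)\Big)^{\frac{\delta_i}{1+\delta_i}} .$$ The system is called *$L^\Phi$-ISS in weighted $L^1$-norm* (with weight $p$) if there are $\beta_0\in\mathcal{KL}$ and $\gamma_0,\gamma_1\in\mathcal K$ such that for all admissible inputs, all $T>0$ and all solutions, $$\|pw(\cdot,T)\|_{L^1(\Omega)}\le\beta_0(\|pw^0\|_{L^1(\Omega)},T)+\gamma_0(\|d\|_{L^\Phi((0,T);L^1(\partial\Omega))})+\gamma_1(\|f\|_{L^\Phi((0,T);L^1(\Omega))}).$$ **Theorem.** (i) If $\underline c>0$, then for every admissible input, every $T>0$ and every solution $w$, $$\|pw(\cdot,T)\|_{L^1(\Omega)}\le e^{-\underline cT}\|pw^0\|_{L^1(\Omega)}+C(\underline c)\Big\|a\,\psi_2^{-1}\Big(\frac d{\psi_1}\Big)|\nabla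 p|\Big\|_{L^\Phi((0,T);L^1(\partial\Omega))}+C(\underline c)\|pf\|_{L^\Phi((0,T);L^1(\Omega))}.$$ If moreover $|\psi_2^{-1}(s)|\le C|s|$ for all $s\in\mathbb R$ with some constant $C>0$, then the system is $L^\Phi$-ISS in weighted $L^1$-norm. (ii) Let $\underline c=0$ and $p_0>0$. Suppose there are $j\in\{1,\dots,n\}$ and $\underline b\in\mathbb R$ with $\underline b\le(b_j+a_{x_j})/a$ in $\Omega\times\mathbb R_+$, and that one of the following holds: (A) $-p\,m_j\,g(x,t,s)\,s\le0$ in $\Omega\times\mathbb R_+\times\mathbb R$; (B) $\operatorname{div}(pm)\ne0$ and $|p\,m_j/\operatorname{div}(pm)|\le\overline m$ in $\Omega\times\mathbb R_+$, for some constant $\overline m\ge0$. Let $l>\max\{0,-\underline b\}$ and $k>\max\big\{\frac{2le^{l\mathbb d}}{l+\underline b},\ \frac{2\overline a\,le^{l\mathbb d}}{p_0}\max_{\overline\Omega}|p_{x_j}|\big\}$, and in case (B) also $k>2le^{l\mathbb d}\,\overline m$. Put $$\widehat{\underline c}=\frac{\underline a\,l\,e^{-l\mathbb d}}{k+e^{l\mathbb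 d}}\Big(l+\underline b-\frac2k\,le^{l\mathbb d}\Big),\qquad C_{k,l}=\frac{k+e^{l\mathbb d}}{k+e^{-l\mathbb d}} .$$ Then $\widehat{\underline c}>0$, and for every admissible input, every $T>0$ and every solution $w$, $$\|pw(\cdot,T)\|_{L^1(\Omega)}\le C_{k,l}e^{-\widehat{\underline c}T}\|pw^0\|_{L^1(\Omega)}+C_{k,l}C(\widehat{\underline c})\Big\|a\,\psi_2^{-1}\Big(\frac d{\psi_1}\Big)|\nabla p|\Big\|_{L^\Phi((0,T);L^1(\partial\Omega))}+C_{k,l}C(\widehat{\underline c})\|pf\|_{L^\Phi((0,T);L^1(\Omega))}.$$ If moreover $|\psi_2^{-1}(s)|\le C|s|$ for all $s\in\mathbb R$ with some constant $C>0$, then the system is $L^\Phi$-ISS in weighted $L^1$-norm. -/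

import Mathlib

open Set Filter Topology MeasureTheory

noncomputable section

/-! ### Domains and differential operators -/

/-- Euclidean space `ℝⁿ`. -/
abbrev RSpace (n : ℕ) := EuclideanSpace ℝ (Fin n)

/-- A bounded domain (nonempty, open, connected) with `C²` boundary: near each boundary point the
domain is the sublevel set `{r < 0}` of a `C²` function `r` without critical points. -/
structure IsSmoothBoundedDomain {n : ℕ} (Ω : Set (RSpace n)) : Prop where
  isOpen : IsOpen Ω
  isConnected : IsConnected Ω
  isBounded : Bornology.IsBounded Ω
  boundary : ∀ x₀ ∈ frontier Ω, ∃ (U : Set (RSpace n)) (r : RSpace n → ℝ),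
    IsOpen U ∧ x₀ ∈ U ∧ ContDiffOn ℝ 2 r U ∧ (∀ x ∈ U, fderiv ℝ r x ≠ 0) ∧
      Ω ∩ U = {x | x ∈ U ∧ r x < 0}

/-- The partial derivative `∂u/∂x_i` at `x`, taken relative to the set `s`
(the usual one at interior points of `s`). -/
def partialWithin {n : ℕ} (i : Fin n) (u : RSpace n → ℝ) (s : Set (RSpace n)) (x : RSpace n) : ℝ :=
  fderivWithin ℝ u s x (EuclideanSpace.single i 1)

/-- The divergence `∑ ∂F_i/∂x_i` at `x`, taken relative to the set `s`
(the usual one at interior points of `s`). -/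
def divWithin {n : ℕ} (F : RSpace n → RSpace n) (s : Set (RSpace n)) (x : RSpace n) : ℝ :=
  ∑ i, partialWithin i (fun y => F y i) s x

/-- `𝕕`, the maximal distance between the origin and the points of `∂Ω`. -/
def maxBoundaryDist {n : ℕ} (Ω : Set (RSpace n)) : ℝ :=
  sSup ((fun x => ‖x‖) '' frontier Ω)

/-! ### The parabolic system with Dirichlet boundary condition -/

/-- The coefficients of
`w_t - div(a∇w) + b·∇w + c w + h(x,t,w,∇w) + m·∇(g(x,t,w)) = f`, `ψ(x,t,w) = d` on `∂Ω`. -/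
structure ParabolicSystem (n : ℕ) where
  a : RSpace n → ℝ → ℝ
  b : RSpace n → ℝ → RSpace n
  c : RSpace n → ℝ → ℝ
  m : RSpace n → ℝ → RSpace n
  h : RSpace n → ℝ → ℝ → RSpace n → ℝ
  g : RSpace n → ℝ → ℝ → ℝ
  ψ : RSpace n → ℝ → ℝ → ℝ

/-- In-domain disturbance `f`, boundary disturbance `d`, initial state `w⁰`. -/
structure ParabolicInput (n : ℕ) where
  f : RSpace n → ℝ → ℝ
  d : RSpace n → ℝ → ℝ
  w₀ : RSpace n → ℝ

/-- `a, b, c, m` are `C²` on `Ω̄ × [0,∞)`, `h` and `ψ` are `C²`, `g` is `C³` on their domains. -/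
structure ParabolicSystem.IsSmooth {n : ℕ} (S : ParabolicSystem n) (Ω : Set (RSpace n)) :
    Prop where
  a : ContDiffOn ℝ 2 (fun z : RSpace n × ℝ => S.a z.1 z.2) (closure Ω ×ˢ Ici 0)
  b : ContDiffOn ℝ 2 (fun z : RSpace n × ℝ => S.b z.1 z.2) (closure Ω ×ˢ Ici 0)
  c : ContDiffOn ℝ 2 (fun z : RSpace n × ℝ => S.c z.1 z.2) (closure Ω ×ˢ Ici 0)
  m : ContDiffOn ℝ 2 (fun z : RSpace n × ℝ => S.m z.1 z.2) (closure Ω ×ˢ Ici 0)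
  h : ContDiffOn ℝ 2 (fun z : RSpace n × ℝ × ℝ × RSpace n => S.h z.1 z.2.1 z.2.2.1 z.2.2.2)
    (closure Ω ×ˢ Ici 0 ×ˢ univ ×ˢ univ)
  g : ContDiffOn ℝ 3 (fun z : RSpace n × ℝ × ℝ => S.g z.1 z.2.1 z.2.2)
    (closure Ω ×ˢ Ici 0 ×ˢ univ)
  ψ : ContDiffOn ℝ 2 (fun z : RSpace n × ℝ × ℝ => S.ψ z.1 z.2.1 z.2.2)
    (closure Ω ×ˢ Ici 0 ×ˢ univ)

/-- `f, d ∈ C²(Ω̄ × [0,∞))`, `w⁰ ∈ C²(Ω̄)`, and the compatibility condition `ψ(x,0,w⁰) = d(x,0)`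
on `∂Ω`. -/
structure ParabolicInput.IsAdmissible {n : ℕ} (I : ParabolicInput n) (S : ParabolicSystem n)
    (Ω : Set (RSpace n)) : Prop where
  f : ContDiffOn ℝ 2 (fun z : RSpace n × ℝ => I.f z.1 z.2) (closure Ω ×ˢ Ici 0)
  d : ContDiffOn ℝ 2 (fun z : RSpace n × ℝ => I.d z.1 z.2) (closure Ω ×ˢ Ici 0)
  w₀ : ContDiffOn ℝ 2 I.w₀ (closure Ω)
  compat : ∀ x ∈ frontier Ω, S.ψ x 0 (I.w₀ x) = I.d x 0

/-- `w ∈ C^{2,1}(Ω × (0,T))`: `w`, `w_t` and the first and second `x`-derivatives of `w` exist and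
are continuous on `Ω × (0,T)`. -/
structure IsC21 {n : ℕ} (Ω : Set (RSpace n)) (T : ℝ) (w : RSpace n → ℝ → ℝ) : Prop where
  cont : ContinuousOn (fun z : RSpace n × ℝ => w z.1 z.2) (Ω ×ˢ Ioo 0 T)
  diff_t : ∀ x ∈ Ω, ∀ t ∈ Ioo 0 T, DifferentiableAt ℝ (fun τ => w x τ) t
  cont_t : ContinuousOn (fun z : RSpace n × ℝ => deriv (fun τ => w z.1 τ) z.2) (Ω ×ˢ Ioo 0 T)
  diff_x : ∀ t ∈ Ioo 0 T, ContDiffOn ℝ 2 (fun y => w y t) Ω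
  cont_x : ContinuousOn (fun z : RSpace n × ℝ => fderiv ℝ (fun y => w y z.2) z.1) (Ω ×ˢ Ioo 0 T)
  cont_xx : ContinuousOn
    (fun z : RSpace n × ℝ => fderiv ℝ (fun y => fderiv ℝ (fun y' => w y' z.2) y) z.1)
    (Ω ×ˢ Ioo 0 T)

/-- `w` is a classical solution of the Dirichlet problem on `Ω × (0,T)`, of class
`C^{2,1}(Q_T) ∩ C(Q̄_T)`. -/
structure IsDirichletSolution {n : ℕ} (S : ParabolicSystem n) (I : ParabolicInput n)
    (Ω : Set (RSpace n)) (T : ℝ) (w : RSpace n → ℝ → ℝ) : Prop where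
  regular : IsC21 Ω T w
  cont : ContinuousOn (fun z : RSpace n × ℝ => w z.1 z.2) (closure Ω ×ˢ Icc 0 T)
  pde : ∀ x ∈ Ω, ∀ t ∈ Ioo 0 T,
    (deriv (fun τ => w x τ) t
        - divWithin (fun y => S.a y t • gradient (fun y' => w y' t) y) Ω x
        + inner ℝ (S.b x t) (gradient (fun y => w y t) x)
        + S.c x t * w x t)
      + (S.h x t (w x t) (gradient (fun y => w y t) x)
        + inner ℝ (S.m x t) (gradient (fun y => S.g y t (w y t)) x))
      = I.f x t
  boundary : ∀ x ∈ frontier Ω, ∀ t ∈ Ioo 0 T, S.ψ x t (w x t) = I.d x t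
  initial : ∀ x ∈ Ω, w x 0 = I.w₀ x

/-! ### Structural assumptions -/

/-- Ellipticity and growth conditions on `a, h, g, ψ`. -/
structure GrowthAssumption {n : ℕ} (S : ParabolicSystem n) (Ω : Set (RSpace n)) (aLow aUp : ℝ) :
    Prop where
  aLow_pos : 0 < aLow
  a_bounds : ∀ x ∈ closure Ω, ∀ t, 0 ≤ t → aLow ≤ S.a x t ∧ S.a x t ≤ aUp
  h_growth : ∃ μ₁ : ℝ → ℝ, ContinuousOn μ₁ (Ici 0) ∧ MonotoneOn μ₁ (Ici 0) ∧
    (∀ r, 0 ≤ r → 0 ≤ μ₁ r) ∧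
    ∀ x ∈ closure Ω, ∀ t, 0 ≤ t → ∀ (s : ℝ) (η : RSpace n),
      |S.h x t s η| + |derivWithin (fun τ => S.h x τ s η) (Ici 0) t|
        + |deriv (fun σ => S.h x t σ η) s|
        + (1 + ‖η‖) * ∑ i, |partialWithin i (fun ζ => S.h x t s ζ) univ η|
      ≤ μ₁ |s| * (1 + ‖η‖ ^ 2)
  g_growth : ∃ μ₂ : ℝ → ℝ, ContinuousOn μ₂ (Ici 0) ∧ MonotoneOn μ₂ (Ici 0) ∧
    (∀ r, 0 ≤ r → 0 < μ₂ r) ∧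
    Tendsto (fun R : ℝ => ∫ s in (0 : ℝ)..R, 1 / μ₂ s) atTop atTop ∧
    ∀ x ∈ closure Ω, ∀ t, 0 ≤ t → ∀ s : ℝ,
      ∑ i, |partialWithin i (fun y => S.g y t s) (closure Ω) x|
        + |deriv (fun σ => S.g x t σ) s| + |deriv (deriv (fun σ => S.g x t σ)) s| ≤ μ₂ |s|
  ψ_growth : ∃ μ₃ : RSpace n → ℝ → ℝ,
    ContinuousOn (fun z : RSpace n × ℝ => μ₃ z.1 z.2) (frontier Ω ×ˢ Ici 0) ∧
    ∀ x ∈ frontier Ω, ∀ t, 0 ≤ t → ∀ s : ℝ, -S.ψ x t s * s ≤ μ₃ x t * (s ^ 2 + 1)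

/-- One-sided bound on `h`, linear bound on `g` near `s = 0`, and `cLow ≤ c - div b - μ`. -/
structure SignAssumption {n : ℕ} (S : ParabolicSystem n) (Ω : Set (RSpace n))
    (μ : RSpace n → ℝ → ℝ) (cLow : ℝ) : Prop where
  μ_cont : ContinuousOn (fun z : RSpace n × ℝ => μ z.1 z.2) (closure Ω ×ˢ Ici 0)
  h_sign : ∀ x ∈ Ω, ∀ t, 0 < t → ∀ (s : ℝ) (η : RSpace n), -S.h x t s η * s ≤ μ x t * s ^ 2
  g_linear : ∃ (s₀ : ℝ) (g₀ : RSpace n → ℝ → ℝ), 0 < s₀ ∧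
    ContinuousOn (fun z : RSpace n × ℝ => g₀ z.1 z.2) (closure Ω ×ˢ Ici 0) ∧
    ∀ x ∈ Ω, ∀ t, 0 < t → ∀ s ∈ Icc (-s₀) s₀, |S.g x t s| ≤ |g₀ x t| * |s|
  cLow_nonneg : 0 ≤ cLow
  cLow_le : ∀ x ∈ Ω, ∀ t, 0 < t → cLow ≤ S.c x t - divWithin (fun y => S.b y t) Ω x - μ x t

/-- Assumptions for the Dirichlet condition: the weight `p`, and `ψ = ψ₁(x,t) ψ₂(s)` on `∂Ω`. -/
structure DirichletAssumption {n : ℕ} (S : ParabolicSystem n) (Ω : Set (RSpace n))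
    (p : RSpace n → ℝ) (p₀ : ℝ) (ψ₁ : RSpace n → ℝ → ℝ) (ψ₂ : ℝ → ℝ) : Prop where
  p_C2 : ContDiffOn ℝ 2 p Ω
  p_C1 : ContDiffOn ℝ 1 p (closure Ω)
  p₀_nonneg : 0 ≤ p₀
  p_ineq : ∀ x ∈ Ω, ∀ t, 0 < t →
    divWithin (fun y => S.a y t • gradient p y) Ω x + inner ℝ (S.b x t) (gradient p x) ≤ -p₀
  p_boundary : ∀ x ∈ frontier Ω, p x = 0
  g_sign : ∀ x ∈ closure Ω, ∀ t, 0 ≤ t → ∀ s : ℝ,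
    S.g x t s * s * divWithin (fun y => p y • S.m y t) (closure Ω) x ≤ 0
  ψ_eq : ∀ x ∈ frontier Ω, ∀ t, 0 ≤ t → ∀ s : ℝ, S.ψ x t s = ψ₁ x t * ψ₂ s
  ψ₁_low : ∃ ψLow : ℝ, 0 < ψLow ∧ ∀ x ∈ frontier Ω, ∀ t, 0 ≤ t → ψLow ≤ ψ₁ x t
  ψ₂_mono : StrictMono ψ₂
  ψ₂_cont : Continuous ψ₂

/-! ### Orlicz norms -/

/-- `φ ∈ C([0,∞)) ∩ C¹((0,∞))`, `φ(0) = 0`, `φ > 0` on `(0,∞)`, and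
`δ₀ ≤ s φ'(s) / φ(s) ≤ δ₁` for `s > 0`. -/
structure IsTolksdorf (φ : ℝ → ℝ) (δ₀ δ₁ : ℝ) : Prop where
  cont : ContinuousOn φ (Ici 0)
  contDiff : ContDiffOn ℝ 1 φ (Ioi 0)
  zero : φ 0 = 0
  pos : ∀ s, 0 < s → 0 < φ s
  δ₀_pos : 0 < δ₀
  δ₁_pos : 0 < δ₁
  bounds : ∀ s, 0 < s → δ₀ ≤ s * deriv φ s / φ s ∧ s * deriv φ s / φ s ≤ δ₁

/-- `Φ(s) = ∫₀ˢ φ`. -/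
def youngFn (φ : ℝ → ℝ) (s : ℝ) : ℝ := ∫ τ in (0 : ℝ)..s, φ τ

/-- The complementary function `Φ̃(s) = ∫₀ˢ φ⁻¹`, where `φ⁻¹` is the inverse of `φ` on `[0,∞)`. -/
def complYoungFn (φ : ℝ → ℝ) (s : ℝ) : ℝ := ∫ τ in (0 : ℝ)..s, Function.invFunOn φ (Ici 0) τ

/-- The Luxemburg norm `‖u‖_{L^Φ(0,T)}`. -/
def luxemburgNorm (Φ : ℝ → ℝ) (T : ℝ) (u : ℝ → ℝ) : ℝ :=
  sInf {k : ℝ | 0 < k ∧ ∫⁻ t in Ioo 0 T, ENNReal.ofReal (Φ (|u t| / k)) ≤ 1}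

/-- `‖u‖_{L¹(Ω)}` (Lebesgue measure). -/
def normL1 {n : ℕ} (Ω : Set (RSpace n)) (u : RSpace n → ℝ) : ℝ := ∫ x in Ω, |u x|

/-- `‖u‖_{L¹(∂Ω)}`, with respect to the surface measure, i.e. the `(n-1)`-dimensional Hausdorff
measure normalized to agree with Lebesgue measure on `ℝ^{n-1}` (counting measure if `n = 1`). -/
def normL1Boundary {n : ℕ} (Ω : Set (RSpace n)) (u : RSpace n → ℝ) : ℝ :=
  ∫ x in frontier Ω, |u x| ∂(Measure.euclideanHausdorffMeasure (n - 1) : Measure (RSpace n))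

/-- `‖u‖_{L^Φ((0,T);L¹(Ω))}`. -/
def normOrliczL1 {n : ℕ} (Φ : ℝ → ℝ) (T : ℝ) (Ω : Set (RSpace n)) (u : RSpace n → ℝ → ℝ) : ℝ :=
  luxemburgNorm Φ T (fun t => normL1 Ω (fun x => u x t))

/-- `‖u‖_{L^Φ((0,T);L¹(∂Ω))}`. -/
def normOrliczL1Boundary {n : ℕ} (Φ : ℝ → ℝ) (T : ℝ) (Ω : Set (RSpace n))
    (u : RSpace n → ℝ → ℝ) : ℝ :=
  luxemburgNorm Φ T (fun t => normL1Boundary Ω (fun x => u x t))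

/-- `2 max_{i ∈ {0,1}} (c⁻¹ δ₁² / (δ₀ (1 + δ₁)) Φ̃(1)) ^ (δ_i / (1 + δ_i))`. -/
def orliczGain (φ : ℝ → ℝ) (δ₀ δ₁ c : ℝ) : ℝ :=
  2 * max
    ((1 / c * (δ₁ ^ 2 / (δ₀ * (1 + δ₁))) * complYoungFn φ 1) ^ (δ₀ / (1 + δ₀)))
    ((1 / c * (δ₁ ^ 2 / (δ₀ * (1 + δ₁))) * complYoungFn φ 1) ^ (δ₁ / (1 + δ₁)))

/-- The boundary term `a ψ₂⁻¹(d / ψ₁) |∇p|`. -/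
def boundaryTerm {n : ℕ} (S : ParabolicSystem n) (I : ParabolicInput n) (Ω : Set (RSpace n))
    (p : RSpace n → ℝ) (ψ₁ : RSpace n → ℝ → ℝ) (ψ₂ : ℝ → ℝ) (x : RSpace n) (t : ℝ) : ℝ :=
  S.a x t * Function.invFun ψ₂ (I.d x t / ψ₁ x t) * ‖gradientWithin p (closure Ω) x‖

/-- `C_{k,l} = (k + e^{l𝕕}) / (k + e^{-l𝕕})`. -/
def overshootConst (D k l : ℝ) : ℝ := (k + Real.exp (l * D)) / (k + Real.exp (-(l * D)))

/-- `ĉ = aLow l e^{-l𝕕} / (k + e^{l𝕕}) * (l + bLow - (2/k) l e^{l𝕕})`. -/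
def decayRate (D aLow bLow k l : ℝ) : ℝ :=
  aLow * l * Real.exp (-(l * D)) / (k + Real.exp (l * D))
    * (l + bLow - 2 / k * l * Real.exp (l * D))

/-! ### Input-to-state stability -/

/-- Class `𝒦`: continuous, strictly increasing on `[0,∞)`, vanishing at `0`. -/
structure IsClassK (γ : ℝ → ℝ) : Prop where
  cont : ContinuousOn γ (Ici 0)
  strictMono : StrictMonoOn γ (Ici 0)
  zero : γ 0 = 0

/-- Class `𝒦ℒ`: continuous on `[0,∞)²`, `β(·,t) ∈ 𝒦` for each `t ≥ 0`, and for each `r > 0` the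
function `β(r,·)` is strictly decreasing on `[0,∞)` with limit `0`. -/
structure IsClassKL (β : ℝ → ℝ → ℝ) : Prop where
  cont : ContinuousOn (fun z : ℝ × ℝ => β z.1 z.2) (Ici 0 ×ˢ Ici 0)
  classK : ∀ t, 0 ≤ t → IsClassK (fun r => β r t)
  strictAnti : ∀ r, 0 < r → StrictAntiOn (β r) (Ici 0)
  tendsto : ∀ r, 0 < r → Tendsto (β r) atTop (𝓝 0)

/-- The Dirichlet system is `L^Φ`-ISS in the `L¹`-norm with weight `p`, with respect to boundary
disturbances `d` from `L^Φ_loc(ℝ₊;L¹(∂Ω))` and in-domain disturbances `f` from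
`L^Φ_loc(ℝ₊;L¹(Ω))`: the comparison functions serve all admissible inputs and all times. -/
def IsOrliczISS {n : ℕ} (S : ParabolicSystem n) (Ω : Set (RSpace n)) (p : RSpace n → ℝ)
    (Φ : ℝ → ℝ) : Prop :=
  ∃ (β₀ : ℝ → ℝ → ℝ) (γ₀ γ₁ : ℝ → ℝ), IsClassKL β₀ ∧ IsClassK γ₀ ∧ IsClassK γ₁ ∧
    ∀ I : ParabolicInput n, I.IsAdmissible S Ω → ∀ T : ℝ, 0 < T → ∀ w : RSpace n → ℝ → ℝ,
      IsDirichletSolution S I Ω T w →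
      normL1 Ω (fun x => p x * w x T)
        ≤ β₀ (normL1 Ω (fun x => p x * I.w₀ x)) T
          + γ₀ (normOrliczL1Boundary Φ T Ω I.d) + γ₁ (normOrliczL1 Φ T Ω I.f)

/-- Alternative sign condition on the convection term: `-p m_j g(x,t,s) s ≤ 0` in
`Ω × ℝ₊ × ℝ`. -/
def ConvectionSign {n : ℕ} (S : ParabolicSystem n) (Ω : Set (RSpace n)) (p : RSpace n → ℝ)
    (j : Fin n) : Prop :=
  ∀ x ∈ Ω, ∀ t, 0 < t → ∀ s : ℝ, -(p x * S.m x t j * S.g x t s * s) ≤ 0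

/-- Alternative bound on the convection term: `div(p m) ≠ 0` and `|p m_j / div(p m)| ≤ mUp` in
`Ω × ℝ₊`. -/
def ConvectionBound {n : ℕ} (S : ParabolicSystem n) (Ω : Set (RSpace n)) (p : RSpace n → ℝ)
    (j : Fin n) (mUp : ℝ) : Prop :=
  ∀ x ∈ Ω, ∀ t, 0 < t → divWithin (fun y => p y • S.m y t) Ω x ≠ 0 ∧
    |p x * S.m x t j / divWithin (fun y => p y • S.m y t) Ω x| ≤ mUp

end

/-! Formally, test the equation with p·sgn(w). Here p ≥ 0 in Ω by the maximum principle
(`nonneg_of_elliptic_le`) and p = 0 on ∂Ω, so integrating by parts twice moves the elliptic operator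
onto p. Diffusion yields |w| div(a∇p), a term of favourable sign concentrated on {w = 0}, and the
boundary term ∫_∂Ω a|w||∇p|, because ∇p points inward there. Transport yields |w|(b·∇p + p div b).
Convection yields g sgn(w) div(pm) ≤ 0 and a term concentrated on {w = 0}, which disappears because
g vanishes linearly there. Hence d/dt ∫p|w| ≤ -c ∫p|w| + ∫p|f| + ∫_∂Ω a|w||∇p|, with w = ψ₂⁻¹(d/ψ₁)
on ∂Ω. Grönwall's argument leaves the data integrated against an exponential kernel, and Young's
inequality for Φ and Φ̃ with the power scaling of φ turns this into the gain C(c) times a Luxemburg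
norm (`IsTolksdorf.setIntegral_exp_mul_le`).

When the reaction gives no decay, p is replaced by P = p/(k + e^{l x_j}). For k and l as in the
theorem, div(a∇P) + b·∇P ≤ -ĉP while the convection sign survives
(`DirichletAssumption.isWeight_mul_expWeight`). P is comparable to p up to the ratio C_{k,l}. Both
cases are instances of `IsWeight`, where `lam₁` is the decay from the elliptic part and `lam₂` that
from the reaction.

The difficulty is regularity: ∇w need not extend to ∂Ω, so the divergence theorem is not available
up to the boundary. The sign is therefore replaced by `softSign τ`, and the weight by `cutoff ε ∘
u`, which is supported in a compact subset of Ω. The boundary term then appears as the integral of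
a|w| `cutoffDeriv2 ε u` |∇u|² over the layer ε ≤ u ≤ 2ε.
`IsBoundaryDefining.eventually_integral_layer_le` bounds such layers asymptotically by the surface
integral of a|w||∇u|. Only an upper bound is needed, so it suffices that orthogonal projections do
not increase Hausdorff measure. That argument requires ∇u ≠ 0 on ∂Ω, whereas a weight P may
degenerate, so u = P + δq with q a global defining function. The limits are taken in the order τ →
0, ε → 0, δ → 0. -/

/-! ### Young functions and the Luxemburg norm -/

namespace IsTolksdorf

variable {φ : ℝ → ℝ} {δ₀ δ₁ : ℝ}

lemma le (h : IsTolksdorf φ δ₀ δ₁) : δ₀ ≤ δ₁ :=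
  (h.bounds 1 one_pos).1.trans (h.bounds 1 one_pos).2

lemma hasDerivAt (h : IsTolksdorf φ δ₀ δ₁) {s : ℝ} (hs : 0 < s) :
    HasDerivAt φ (deriv φ s) s :=
  ((h.contDiff.differentiableOn one_ne_zero).differentiableAt (Ioi_mem_nhds hs)).hasDerivAt

lemma le_mul_deriv (h : IsTolksdorf φ δ₀ δ₁) {s : ℝ} (hs : 0 < s) :
    δ₀ * φ s ≤ s * deriv φ s :=
  (le_div_iff₀ (h.pos s hs)).1 (h.bounds s hs).1

lemma mul_deriv_le (h : IsTolksdorf φ δ₀ δ₁) {s : ℝ} (hs : 0 < s) :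
    s * deriv φ s ≤ δ₁ * φ s :=
  (div_le_iff₀ (h.pos s hs)).1 (h.bounds s hs).2

lemma deriv_pos (h : IsTolksdorf φ δ₀ δ₁) {s : ℝ} (hs : 0 < s) : 0 < deriv φ s := by
  have h1 := h.le_mul_deriv hs
  have h2 := mul_pos h.δ₀_pos (h.pos s hs)
  exact pos_of_mul_pos_right (h2.trans_le h1) hs.le

lemma strictMonoOn (h : IsTolksdorf φ δ₀ δ₁) : StrictMonoOn φ (Ici 0) :=
  strictMonoOn_of_deriv_pos (convex_Ici 0) h.cont fun s hs => by
    rw [interior_Ici] at hs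
    exact h.deriv_pos hs

lemma nonneg (h : IsTolksdorf φ δ₀ δ₁) {s : ℝ} (hs : 0 ≤ s) : 0 ≤ φ s := by
  rw [← h.zero]
  exact h.strictMonoOn.monotoneOn self_mem_Ici hs hs

lemma hasDerivAt_mul_rpow (h : IsTolksdorf φ δ₀ δ₁) (d : ℝ) {s : ℝ} (hs : 0 < s) :
    HasDerivAt (fun s => φ s * s ^ (-d)) (s ^ (-d - 1) * (s * deriv φ s - d * φ s)) s := by
  refine ((h.hasDerivAt hs).mul (Real.hasDerivAt_rpow_const (p := -d)
    (Or.inl hs.ne'))).congr_deriv ?_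
  have : s ^ (-d) = s ^ (-d - 1) * s := by
    rw [← Real.rpow_add_one hs.ne']; ring_nf
  rw [this]; ring

/-- The quotient φ(s)/s^δ₀ is nondecreasing, since its derivative has the sign of sφ' - δ₀φ. -/
lemma mul_rpow_le (h : IsTolksdorf φ δ₀ δ₁) {s r : ℝ} (hs : 0 < s) (hr : 1 ≤ r) :
    r ^ δ₀ * φ s ≤ φ (r * s) := by
  have hmono : MonotoneOn (fun s => φ s * s ^ (-δ₀)) (Ioi 0) := by
    refine monotoneOn_of_deriv_nonneg (convex_Ioi 0)
      (fun s hs => (h.hasDerivAt_mul_rpow δ₀ hs).continuousAt.continuousWithinAt)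
      (fun s hs => ?_) (fun s hs => ?_)
    · rw [interior_Ioi] at hs
      exact (h.hasDerivAt_mul_rpow δ₀ hs).differentiableAt.differentiableWithinAt
    · rw [interior_Ioi] at hs
      rw [(h.hasDerivAt_mul_rpow δ₀ hs).deriv]
      exact mul_nonneg (Real.rpow_nonneg (le_of_lt hs) _) (sub_nonneg.2 (h.le_mul_deriv hs))
  have hr0 : 0 < r := one_pos.trans_le hr
  have := hmono (show s ∈ Ioi 0 from hs) (show r * s ∈ Ioi 0 from mul_pos hr0 hs)
    (le_mul_of_one_le_left hs.le hr)
  simp only at this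
  rw [Real.mul_rpow hr0.le hs.le, ← mul_assoc,
    mul_le_mul_iff_of_pos_right (Real.rpow_pos_of_pos hs _), Real.rpow_neg hr0.le,
    ← div_eq_mul_inv, le_div_iff₀ (Real.rpow_pos_of_pos hr0 _)] at this
  linarith

/-- Dually, φ(s)/s^δ₁ is nonincreasing, since its derivative has the sign of sφ' - δ₁φ. -/
lemma rpow_mul_le (h : IsTolksdorf φ δ₀ δ₁) {s r : ℝ} (hs : 0 < s) (hr : 0 < r) (hr1 : r ≤ 1) :
    r ^ δ₁ * φ s ≤ φ (r * s) := by
  have hmono : AntitoneOn (fun s => φ s * s ^ (-δ₁)) (Ioi 0) := by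
    refine antitoneOn_of_deriv_nonpos (convex_Ioi 0)
      (fun s hs => (h.hasDerivAt_mul_rpow δ₁ hs).continuousAt.continuousWithinAt)
      (fun s hs => ?_) (fun s hs => ?_)
    · rw [interior_Ioi] at hs
      exact (h.hasDerivAt_mul_rpow δ₁ hs).differentiableAt.differentiableWithinAt
    · rw [interior_Ioi] at hs
      rw [(h.hasDerivAt_mul_rpow δ₁ hs).deriv]
      exact mul_nonpos_of_nonneg_of_nonpos (Real.rpow_nonneg (le_of_lt hs) _)
        (sub_nonpos.2 (h.mul_deriv_le hs))
  have := hmono (show r * s ∈ Ioi 0 from mul_pos hr hs) (show s ∈ Ioi 0 from hs)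
    (mul_le_of_le_one_left hs.le hr1)
  simp only at this
  rw [Real.mul_rpow hr.le hs.le, ← mul_assoc,
    mul_le_mul_iff_of_pos_right (Real.rpow_pos_of_pos hs _), Real.rpow_neg hr.le,
    ← div_eq_mul_inv, le_div_iff₀ (Real.rpow_pos_of_pos hr _)] at this
  linarith

lemma surjOn (h : IsTolksdorf φ δ₀ δ₁) : SurjOn φ (Ici 0) (Ici 0) := by
  intro t ht
  have hlim : Tendsto (fun r : ℝ => r ^ δ₀ * φ 1) atTop atTop :=
    (tendsto_rpow_atTop h.δ₀_pos).atTop_mul_const (h.pos 1 one_pos)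
  obtain ⟨r, hr1, hr⟩ := ((eventually_ge_atTop (1 : ℝ)).and (hlim.eventually_ge_atTop t)).exists
  have hφr : t ≤ φ r := by simpa using hr.trans (h.mul_rpow_le one_pos hr1)
  have hr0 : (0 : ℝ) ≤ r := zero_le_one.trans hr1
  obtain ⟨s, hs, hst⟩ := intermediate_value_Icc hr0 (h.cont.mono Icc_subset_Ici_self)
    (show t ∈ Icc (φ 0) (φ r) from ⟨by rw [h.zero]; exact ht, hφr⟩)
  exact ⟨s, hs.1, hst⟩

/-- The inverse of `φ` on `[0,∞)`. -/
noncomputable abbrev inv (_ : IsTolksdorf φ δ₀ δ₁) : ℝ → ℝ := Function.invFunOn φ (Ici 0)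

lemma inv_nonneg (h : IsTolksdorf φ δ₀ δ₁) {t : ℝ} (ht : 0 ≤ t) : 0 ≤ h.inv t :=
  Function.invFunOn_mem (h.surjOn ht)

lemma apply_inv (h : IsTolksdorf φ δ₀ δ₁) {t : ℝ} (ht : 0 ≤ t) : φ (h.inv t) = t :=
  Function.invFunOn_eq (h.surjOn ht)

lemma inv_apply (h : IsTolksdorf φ δ₀ δ₁) {s : ℝ} (hs : 0 ≤ s) : h.inv (φ s) = s :=
  h.strictMonoOn.injOn (h.inv_nonneg (h.nonneg hs)) hs (h.apply_inv (h.nonneg hs))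

lemma inv_le (h : IsTolksdorf φ δ₀ δ₁) {s t : ℝ} (hs : 0 ≤ s) (ht : 0 ≤ t) (hts : t ≤ φ s) :
    h.inv t ≤ s := by
  rw [← h.strictMonoOn.le_iff_le (h.inv_nonneg ht) hs, h.apply_inv ht]
  exact hts

lemma le_inv (h : IsTolksdorf φ δ₀ δ₁) {s t : ℝ} (hs : 0 ≤ s) (ht : 0 ≤ t) (hts : φ s ≤ t) :
    s ≤ h.inv t := by
  rw [← h.strictMonoOn.le_iff_le hs (h.inv_nonneg ht), h.apply_inv ht]
  exact hts

lemma monotoneOn_inv (h : IsTolksdorf φ δ₀ δ₁) : MonotoneOn h.inv (Ici 0) := fun s hs t ht hst =>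
  h.inv_le (h.inv_nonneg ht) hs (by rw [h.apply_inv ht]; exact hst)

lemma inv_pos (h : IsTolksdorf φ δ₀ δ₁) {t : ℝ} (ht : 0 < t) : 0 < h.inv t := by
  refine (h.inv_nonneg ht.le).lt_of_ne fun h0 => ?_
  have := h.apply_inv ht.le
  rw [← h0, h.zero] at this
  exact ht.ne this

lemma continuous_inv (h : IsTolksdorf φ δ₀ δ₁) : Continuous fun t => h.inv (max t 0) := by
  have hm : Monotone fun t => h.inv (max t 0) := fun s t hst =>
    h.monotoneOn_inv (le_max_right s 0) (le_max_right t 0) (max_le_max_right 0 hst)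
  have h0 : h.inv 0 = 0 := by simpa [h.zero] using h.inv_apply le_rfl
  -- Adding `min t 0` makes the monotone function surjective onto ℝ, and a monotone surjection is
  -- continuous.
  have hcont : Continuous fun t => h.inv (max t 0) + min t 0 := by
    refine Monotone.continuous_of_surjective (fun s t hst =>
      add_le_add (hm hst) (min_le_min_right 0 hst)) fun s => ?_
    rcases le_total 0 s with hs | hs
    · exact ⟨φ s, by simp [h.nonneg hs, h.inv_apply hs]⟩
    · exact ⟨s, by simp [hs, h0]⟩
  have hmin : Continuous fun t : ℝ => min t 0 := by fun_prop
  simpa using hcont.fun_sub hmin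

lemma continuous_max (h : IsTolksdorf φ δ₀ δ₁) : Continuous fun t => φ (max t 0) :=
  h.cont.comp_continuous (by fun_prop) fun t => le_max_right t 0

lemma youngFn_eq {s : ℝ} (hs : 0 ≤ s) : youngFn φ s = ∫ τ in (0 : ℝ)..s, φ (max τ 0) := by
  refine intervalIntegral.integral_congr fun τ hτ => ?_
  rw [uIcc_of_le hs] at hτ
  simp [hτ.1]

lemma complYoungFn_eq (h : IsTolksdorf φ δ₀ δ₁) {s : ℝ} (hs : 0 ≤ s) :
    complYoungFn φ s = ∫ τ in (0 : ℝ)..s, h.inv (max τ 0) := by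
  refine intervalIntegral.integral_congr fun τ hτ => ?_
  rw [uIcc_of_le hs] at hτ
  simp [hτ.1]

lemma youngFn_mono (h : IsTolksdorf φ δ₀ δ₁) {s t : ℝ} (hs : 0 ≤ s) (hst : s ≤ t) :
    youngFn φ s ≤ youngFn φ t := by
  rw [youngFn_eq hs, youngFn_eq (hs.trans hst),
    ← intervalIntegral.integral_add_adjacent_intervals
      (h.continuous_max.intervalIntegrable 0 s) (h.continuous_max.intervalIntegrable s t)]
  have := intervalIntegral.integral_nonneg_of_forall (μ := volume) hst
    fun τ => h.nonneg (le_max_right τ 0)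
  linarith

lemma youngFn_nonneg (h : IsTolksdorf φ δ₀ δ₁) {s : ℝ} (hs : 0 ≤ s) : 0 ≤ youngFn φ s := by
  have := h.youngFn_mono le_rfl hs
  simpa [youngFn] using this

lemma complYoungFn_one_pos (h : IsTolksdorf φ δ₀ δ₁) : 0 < complYoungFn φ 1 := by
  rw [h.complYoungFn_eq zero_le_one]
  refine intervalIntegral.intervalIntegral_pos_of_pos_on
    (h.continuous_inv.intervalIntegrable 0 1) (fun x hx => ?_) one_pos
  exact h.inv_pos (lt_max_of_lt_left hx.1)

/-- Convexity of Φ̃: its graph lies above the tangent at φ(s), whose slope is φ⁻¹(φ(s)) = s. -/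
lemma complYoungFn_sub_le (h : IsTolksdorf φ δ₀ δ₁) {s t : ℝ} (hs : 0 ≤ s) (ht : 0 ≤ t) :
    s * (t - φ s) ≤ complYoungFn φ t - complYoungFn φ (φ s) := by
  have hi := fun a b => h.continuous_inv.intervalIntegrable (μ := volume) a b
  rw [h.complYoungFn_eq ht, h.complYoungFn_eq (h.nonneg hs),
    intervalIntegral.integral_interval_sub_left (hi _ _) (hi _ _)]
  rcases le_total (φ s) t with hst | hst
  · calc s * (t - φ s) = ∫ _ in (φ s)..t, s := by simp [mul_comm]
      _ ≤ _ := intervalIntegral.integral_mono_on hst (by simp) (hi _ _) fun τ hτ => by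
        rw [max_eq_left ((h.nonneg hs).trans hτ.1)]
        exact h.le_inv hs ((h.nonneg hs).trans hτ.1) hτ.1
  · have : ∫ τ in t..(φ s), h.inv (max τ 0) ≤ ∫ _ in t..(φ s), s :=
      intervalIntegral.integral_mono_on hst (hi _ _) (by simp) fun τ hτ => by
        rw [max_eq_left (ht.trans hτ.1)]
        exact h.inv_le hs (ht.trans hτ.1) hτ.2
    rw [intervalIntegral.integral_symm]
    simp only [intervalIntegral.integral_const, smul_eq_mul] at this
    linarith

/-- Equality case of Young's inequality. The difference of the two sides vanishes at 0 and has
derivative φ + sφ' - (φ + sφ') = 0 on (0,∞). The mean value theorem is used because φ is only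
assumed continuous at 0. -/
lemma youngFn_add_complYoungFn (h : IsTolksdorf φ δ₀ δ₁) {s : ℝ} (hs : 0 ≤ s) :
    youngFn φ s + complYoungFn φ (φ s) = s * φ s := by
  rcases hs.eq_or_lt with rfl | hs
  · simp [youngFn, complYoungFn, h.zero]
  set P : ℝ → ℝ := fun s => ∫ τ in (0 : ℝ)..s, φ (max τ 0)
  set Q : ℝ → ℝ := fun s => ∫ τ in (0 : ℝ)..s, h.inv (max τ 0)
  have hP : ∀ s, HasDerivAt P (φ (max s 0)) s := fun s =>
    intervalIntegral.integral_hasDerivAt_right (h.continuous_max.intervalIntegrable _ _)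
      (h.continuous_max.stronglyMeasurableAtFilter _ _) h.continuous_max.continuousAt
  have hQ : ∀ s, HasDerivAt Q (h.inv (max s 0)) s := fun s =>
    intervalIntegral.integral_hasDerivAt_right (h.continuous_inv.intervalIntegrable _ _)
      (h.continuous_inv.stronglyMeasurableAtFilter _ _) h.continuous_inv.continuousAt
  have hPc : Continuous P := continuous_iff_continuousAt.2 fun s => (hP s).continuousAt
  have hQc : Continuous Q := continuous_iff_continuousAt.2 fun s => (hQ s).continuousAt
  have hc : ContinuousOn φ (Icc 0 s) := h.cont.mono Icc_subset_Ici_self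
  obtain ⟨c, hc, hD⟩ := exists_hasDerivAt_eq_slope (fun s => P s + Q (φ s) - s * φ s)
    (fun _ => 0) hs ((hPc.continuousOn.add (hQc.comp_continuousOn hc)).sub
      (continuousOn_id.mul hc)) fun x hx => by
    have hx := hx.1
    have := ((hP x).add ((hQ (φ x)).comp x (h.hasDerivAt hx))).sub
      ((hasDerivAt_id x).mul (h.hasDerivAt hx))
    refine this.congr_deriv ?_
    rw [max_eq_left hx.le, max_eq_left (h.nonneg hx.le), h.inv_apply hx.le]
    simp
  rw [youngFn_eq hs.le, h.complYoungFn_eq (h.nonneg hs.le)]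
  have h0 : P 0 + Q (φ 0) - 0 * φ 0 = 0 := by simp [P, Q, h.zero]
  rw [h0, sub_zero, sub_zero, eq_comm, div_eq_zero_iff] at hD
  have := hD.resolve_right hs.ne'
  change P s + Q (φ s) = s * φ s
  linarith

/-- Combine the tangent inequality for Φ̃ at φ(s) with the equality case at that point. -/
lemma young (h : IsTolksdorf φ δ₀ δ₁) {s t : ℝ} (hs : 0 ≤ s) (ht : 0 ≤ t) :
    s * t ≤ youngFn φ s + complYoungFn φ t := by
  have h1 := h.complYoungFn_sub_le hs ht
  have h2 := h.youngFn_add_complYoungFn hs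
  linarith

/-- A scaling bound for φ⁻¹ passes to its primitive by the substitution τ ↦ rτ, which contributes
the additional factor r. -/
lemma complYoungFn_mul_le (h : IsTolksdorf φ δ₀ δ₁) {r t K : ℝ} (hr : 0 ≤ r) (ht : 0 ≤ t)
    (hK : ∀ τ, 0 < τ → h.inv (r * τ) ≤ K * h.inv τ) :
    complYoungFn φ (r * t) ≤ r * K * complYoungFn φ t := by
  have h0 : h.inv 0 = 0 := by simpa [h.zero] using h.inv_apply le_rfl
  rw [h.complYoungFn_eq (mul_nonneg hr ht), h.complYoungFn_eq ht]
  have : ∫ τ in (0 : ℝ)..(r * t), h.inv (max τ 0) =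
      r * ∫ τ in (0 : ℝ)..t, h.inv (max (r * τ) 0) := by
    have := intervalIntegral.smul_integral_comp_mul_left (a := 0) (b := t)
      (fun τ => h.inv (max τ 0)) r
    simp only [mul_zero, smul_eq_mul] at this
    exact this.symm
  rw [this, mul_assoc]
  refine mul_le_mul_of_nonneg_left ?_ hr
  rw [← intervalIntegral.integral_const_mul]
  refine intervalIntegral.integral_mono_on ht
    ((h.continuous_inv.comp (by fun_prop : Continuous fun τ => r * τ)).intervalIntegrable _ _)
    ((h.continuous_inv.intervalIntegrable _ _).const_mul K) fun τ hτ => ?_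
  rw [max_eq_left hτ.1, max_eq_left (mul_nonneg hr hτ.1)]
  rcases hτ.1.eq_or_lt with rfl | h1
  · simp [h0]
  · exact hK τ h1

/-- For r ≤ 1 one has φ(r^(1/δ₁) s) ≥ r φ(s), hence φ⁻¹(rτ) ≤ r^(1/δ₁) φ⁻¹(τ). The exponent is 1 +
1/δ₁. -/
lemma complYoungFn_mul_le_of_le_one (h : IsTolksdorf φ δ₀ δ₁) {r t : ℝ} (hr : 0 < r) (hr1 : r ≤ 1)
    (ht : 0 ≤ t) : complYoungFn φ (r * t) ≤ r ^ ((1 + δ₁) / δ₁) * complYoungFn φ t := by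
  have he : r ^ ((1 + δ₁) / δ₁) = r * r ^ (1 / δ₁) := by
    rw [add_div, div_self h.δ₁_pos.ne', Real.rpow_add_one hr.ne', mul_comm]
  rw [he]
  refine h.complYoungFn_mul_le hr.le ht fun τ hτ => ?_
  refine h.inv_le (mul_nonneg (Real.rpow_nonneg hr.le _) (h.inv_nonneg hτ.le))
    (mul_nonneg hr.le hτ.le) ?_
  have := h.rpow_mul_le (h.inv_pos hτ) (Real.rpow_pos_of_pos hr (1 / δ₁))
    (Real.rpow_le_one hr.le hr1 (one_div_nonneg.2 h.δ₁_pos.le))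
  rwa [← Real.rpow_mul hr.le, one_div_mul_cancel h.δ₁_pos.ne', Real.rpow_one,
    h.apply_inv hτ.le] at this

/-- For r ≥ 1 the other power bound applies: φ(r^(1/δ₀) s) ≥ r φ(s), and the exponent becomes 1 +
1/δ₀. -/
lemma complYoungFn_mul_le_of_one_le (h : IsTolksdorf φ δ₀ δ₁) {r t : ℝ} (hr1 : 1 ≤ r)
    (ht : 0 ≤ t) : complYoungFn φ (r * t) ≤ r ^ ((1 + δ₀) / δ₀) * complYoungFn φ t := by
  have hr : 0 < r := one_pos.trans_le hr1
  have he : r ^ ((1 + δ₀) / δ₀) = r * r ^ (1 / δ₀) := by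
    rw [add_div, div_self h.δ₀_pos.ne', Real.rpow_add_one hr.ne', mul_comm]
  rw [he]
  refine h.complYoungFn_mul_le hr.le ht fun τ hτ => ?_
  refine h.inv_le (mul_nonneg (Real.rpow_nonneg hr.le _) (h.inv_nonneg hτ.le))
    (mul_nonneg hr.le hτ.le) ?_
  have := h.mul_rpow_le (h.inv_pos hτ)
    (Real.one_le_rpow hr1 (one_div_nonneg.2 h.δ₀_pos.le))
  rwa [← Real.rpow_mul hr.le, one_div_mul_cancel h.δ₀_pos.ne', Real.rpow_one,
    h.apply_inv hτ.le] at this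

end IsTolksdorf

/-! ### Luxemburg norms and a Hölder inequality against an exponential kernel -/

lemma setIntegral_exp_le {c T : ℝ} (hc : 0 < c) (hT : 0 < T) :
    ∫ t in Ioo 0 T, Real.exp (-(c * (T - t))) ≤ 1 / c := by
  have hd : ∀ t, HasDerivAt (fun t => Real.exp (-(c * (T - t))) / c)
      (Real.exp (-(c * (T - t)))) t := fun t => by
    have h1 : HasDerivAt (fun t => -(c * (T - t))) c t := by
      simpa using (((hasDerivAt_id t).const_sub T).const_mul c).fun_neg
    refine (h1.exp.div_const c).congr_deriv ?_
    field_simp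
  rw [← integral_Ioc_eq_integral_Ioo, ← intervalIntegral.integral_of_le hT.le,
    intervalIntegral.integral_eq_sub_of_hasDerivAt (fun t _ => hd t)
      ((by fun_prop : Continuous fun t => Real.exp (-(c * (T - t)))).intervalIntegrable _ _)]
  have := Real.exp_pos (-(c * (T - 0)))
  simp only [sub_self, mul_zero, neg_zero, Real.exp_zero]
  have h2 : 0 ≤ Real.exp (-(c * (T - 0))) / c := by positivity
  linarith

/-- The set of admissible constants in the Luxemburg norm. -/
def luxemburgSet (Φ : ℝ → ℝ) (T : ℝ) (u : ℝ → ℝ) : Set ℝ :=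
  {k : ℝ | 0 < k ∧ ∫⁻ t in Ioo 0 T, ENNReal.ofReal (Φ (|u t| / k)) ≤ 1}

lemma luxemburgSet_bddBelow (Φ : ℝ → ℝ) (T : ℝ) (u : ℝ → ℝ) : BddBelow (luxemburgSet Φ T u) :=
  ⟨0, fun _ hk => hk.1.le⟩

namespace IsTolksdorf

variable {φ : ℝ → ℝ} {δ₀ δ₁ : ℝ}

lemma luxemburgSet_nonempty (h : IsTolksdorf φ δ₀ δ₁) {T M : ℝ} {u : ℝ → ℝ}
    (hu : ∀ t ∈ Ioo 0 T, |u t| ≤ M) : (luxemburgSet (youngFn φ) T u).Nonempty := by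
  have hcont : Tendsto (fun s => ENNReal.ofReal (youngFn φ (max s 0)) * volume (Ioo 0 T)) (𝓝 0)
      (𝓝 (ENNReal.ofReal (youngFn φ (max 0 0)) * volume (Ioo 0 T))) := by
    refine ENNReal.Tendsto.mul_const (ENNReal.tendsto_ofReal ?_) (Or.inr (by simp))
    have hPc : Continuous fun s => ∫ τ in (0 : ℝ)..s, φ (max τ 0) :=
      intervalIntegral.continuous_primitive (fun a b => h.continuous_max.intervalIntegrable a b) 0
    have : Continuous fun s => youngFn φ (max s 0) := by
      simp_rw [youngFn_eq (le_max_right _ (0 : ℝ))]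
      exact hPc.comp (by fun_prop)
    exact this.tendsto 0
  have h0 : youngFn φ (max 0 0) = 0 := by simp [youngFn]
  rw [h0, ENNReal.ofReal_zero, zero_mul] at hcont
  have hlim : Tendsto (fun k : ℝ => max M 0 / k) atTop (𝓝 0) := tendsto_const_nhds.div_atTop tendsto_id
  obtain ⟨k, hk0, hk⟩ := ((eventually_gt_atTop 0).and
    ((hcont.comp hlim).eventually (ge_mem_nhds one_pos))).exists
  refine ⟨k, hk0, le_trans ?_ hk⟩
  simp only [Function.comp]
  rw [← setLIntegral_const]
  refine setLIntegral_mono measurable_const fun t ht => ENNReal.ofReal_le_ofReal ?_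
  refine h.youngFn_mono (by positivity) (le_max_of_le_left ?_)
  exact div_le_div_of_nonneg_right ((hu t ht).trans (le_max_left _ _)) hk0.le

lemma luxemburgNorm_le_mul (h : IsTolksdorf φ δ₀ δ₁) {T M K : ℝ} {u v : ℝ → ℝ} (hK : 0 < K)
    (hv : ∀ t ∈ Ioo 0 T, |v t| ≤ M) (huv : ∀ t ∈ Ioo 0 T, |u t| ≤ K * |v t|) :
    luxemburgNorm (youngFn φ) T u ≤ K * luxemburgNorm (youngFn φ) T v := by
  rw [← div_le_iff₀' hK]
  -- Boundedness of `v` is essential here: for an empty set of admissible constants `sInf` would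
  -- return 0 and the comparison could fail.
  refine le_csInf (h.luxemburgSet_nonempty hv) fun k hk => ?_
  rw [div_le_iff₀' hK]
  refine csInf_le (luxemburgSet_bddBelow _ _ _) ⟨mul_pos hK hk.1, le_trans ?_ hk.2⟩
  refine setLIntegral_mono' measurableSet_Ioo fun t ht => ENNReal.ofReal_le_ofReal ?_
  have hk0 := hk.1
  refine h.youngFn_mono (by positivity) ?_
  rw [div_le_div_iff₀ (by positivity) hk.1]
  calc |u t| * k ≤ K * |v t| * k := mul_le_mul_of_nonneg_right (huv t ht) hk.1.le
    _ = _ := by ring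

/-- This explains the maximum of two powers in `orliczGain`: the exponents d/(1+d) invert those in
the scaling of Φ̃, where d = δ₁ governs 1/k ≤ 1 and d = δ₀ governs 1/k ≥ 1. -/
lemma complYoungFn_one_div_le (h : IsTolksdorf φ δ₀ δ₁) {k X : ℝ} (hX : 0 < X)
    (h₀ : X ^ (δ₀ / (1 + δ₀)) ≤ k) (h₁ : X ^ (δ₁ / (1 + δ₁)) ≤ k) :
    complYoungFn φ (1 / k) ≤ complYoungFn φ 1 / X := by
  have hk : 0 < k := (Real.rpow_pos_of_pos hX _).trans_le h₀
  have key : ∀ d : ℝ, 0 < d → X ^ (d / (1 + d)) ≤ k → (1 / k) ^ ((1 + d) / d) ≤ 1 / X := by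
    intro d hd hdk
    rw [Real.div_rpow zero_le_one hk.le, Real.one_rpow]
    refine one_div_le_one_div_of_le hX ?_
    calc X = (X ^ (d / (1 + d))) ^ ((1 + d) / d) := by
          rw [← Real.rpow_mul hX.le, div_mul_div_cancel₀ (by positivity), div_self hd.ne',
            Real.rpow_one]
      _ ≤ _ := Real.rpow_le_rpow (by positivity) hdk (by positivity)
  have h1 := h.complYoungFn_one_pos.le
  rcases le_total 1 k with h1k | h1k
  · have := h.complYoungFn_mul_le_of_le_one (one_div_pos.2 hk) ((div_le_one hk).2 h1k) zero_le_one
    rw [mul_one] at this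
    refine this.trans ?_
    rw [show complYoungFn φ 1 / X = 1 / X * complYoungFn φ 1 by ring]
    exact mul_le_mul_of_nonneg_right (key δ₁ h.δ₁_pos h₁) h1
  · have := h.complYoungFn_mul_le_of_one_le ((one_le_div hk).2 h1k) zero_le_one
    rw [mul_one] at this
    refine this.trans ?_
    rw [show complYoungFn φ 1 / X = 1 / X * complYoungFn φ 1 by ring]
    exact mul_le_mul_of_nonneg_right (key δ₀ h.δ₀_pos h₀) h1

lemma continuousOn_youngFn_comp (h : IsTolksdorf φ δ₀ δ₁) {s : Set ℝ} {u : ℝ → ℝ}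
    (hu : ContinuousOn u s) (h0 : ∀ t ∈ s, 0 ≤ u t) : ContinuousOn (fun t => youngFn φ (u t)) s := by
  have hPc : Continuous fun s => ∫ τ in (0 : ℝ)..s, φ (max τ 0) :=
    intervalIntegral.continuous_primitive (fun a b => h.continuous_max.intervalIntegrable a b) 0
  exact (hPc.comp_continuousOn hu).congr fun t ht => youngFn_eq (h0 t ht)

lemma orliczGain_pos (h : IsTolksdorf φ δ₀ δ₁) {c : ℝ} (hc : 0 < c) :
    0 < orliczGain φ δ₀ δ₁ c := by
  have h0 := h.δ₀_pos
  have h1 := h.δ₁_pos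
  have h2 := h.complYoungFn_one_pos
  exact mul_pos two_pos (lt_max_of_lt_left (by positivity))

/-- The generalized Hölder inequality against an exponential kernel. -/
lemma setIntegral_exp_mul_le (h : IsTolksdorf φ δ₀ δ₁) {c T M : ℝ} {u : ℝ → ℝ} (hc : 0 < c)
    (hT : 0 < T) (hu : ContinuousOn u (Ioo 0 T)) (hu0 : ∀ t ∈ Ioo 0 T, 0 ≤ u t)
    (huM : ∀ t ∈ Ioo 0 T, u t ≤ M) :
    ∫ t in Ioo 0 T, Real.exp (-(c * (T - t))) * u t ≤
      orliczGain φ δ₀ δ₁ c * luxemburgNorm (youngFn φ) T u := by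
  have h0 := h.δ₀_pos
  have h1 := h.δ₁_pos
  have h2 := h.complYoungFn_one_pos
  have habs : ∀ t ∈ Ioo 0 T, |u t| ≤ M := fun t ht => by
    rw [abs_of_nonneg (hu0 t ht)]; exact huM t ht
  rw [← div_le_iff₀' (h.orliczGain_pos hc)]
  refine le_csInf (h.luxemburgSet_nonempty habs) fun k hk => ?_
  rw [div_le_iff₀' (h.orliczGain_pos hc)]
  obtain ⟨hk0, hk⟩ := hk
  set X : ℝ := 1 / c * (δ₁ ^ 2 / (δ₀ * (1 + δ₁))) * complYoungFn φ 1 with hX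
  have hX0 : 0 < X := by positivity
  set r : ℝ := max (X ^ (δ₀ / (1 + δ₀))) (X ^ (δ₁ / (1 + δ₁))) with hr
  have hgain : orliczGain φ δ₀ δ₁ c = 2 * r := rfl
  have hr0 : 0 < r := lt_max_of_lt_left (by positivity)
  have hcompl := h.complYoungFn_one_div_le hX0 (le_max_left _ _ : _ ≤ r) (le_max_right _ _)
  have hexp1 : ∀ t ∈ Ioo 0 T, Real.exp (-(c * (T - t))) ≤ 1 := fun t ht => by
    rw [Real.exp_le_one_iff]
    have := mul_pos hc (sub_pos.2 ht.2)
    linarith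
  have hPcont : ContinuousOn (fun t => youngFn φ (u t / k)) (Ioo 0 T) :=
    h.continuousOn_youngFn_comp (hu.div_const k) fun t ht => div_nonneg (hu0 t ht) hk0.le
  have hP0 : ∀ t ∈ Ioo 0 T, 0 ≤ youngFn φ (u t / k) := fun t ht =>
    h.youngFn_nonneg (div_nonneg (hu0 t ht) hk0.le)
  have hPm : AEStronglyMeasurable (fun t => youngFn φ (u t / k)) (volume.restrict (Ioo 0 T)) :=
    hPcont.aestronglyMeasurable measurableSet_Ioo
  have hk' : ∫⁻ t in Ioo 0 T, ENNReal.ofReal (youngFn φ (u t / k)) ≤ 1 := by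
    refine le_trans (le_of_eq (setLIntegral_congr_fun measurableSet_Ioo fun t ht => ?_)) hk
    simp only [abs_of_nonneg (hu0 t ht)]
  have hPi : IntegrableOn (fun t => youngFn φ (u t / k)) (Ioo 0 T) := by
    refine ⟨hPm, ?_⟩
    rw [hasFiniteIntegral_iff_ofReal
      ((ae_restrict_iff' measurableSet_Ioo).2 (Eventually.of_forall hP0))]
    exact hk'.trans_lt ENNReal.one_lt_top
  have hPle : ∫ t in Ioo 0 T, youngFn φ (u t / k) ≤ 1 := by
    rw [integral_eq_lintegral_of_nonneg_ae
      ((ae_restrict_iff' measurableSet_Ioo).2 (Eventually.of_forall hP0)) hPm]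
    exact ENNReal.toReal_le_of_le_ofReal zero_le_one (by simpa using hk')
  -- The kernel is at most 1, so it leaves Φ̃ with the power (1+δ₁)/δ₁, which raises the decay rate
  -- from c to d.
  set d : ℝ := c * ((1 + δ₁) / δ₁) with hd
  have hd0 : 0 < d := by positivity
  have hQle : ∀ t ∈ Ioo 0 T, complYoungFn φ (Real.exp (-(c * (T - t))) / r) ≤
      Real.exp (-(d * (T - t))) * (complYoungFn φ 1 / X) := fun t ht => by
    have := h.complYoungFn_mul_le_of_le_one (Real.exp_pos _) (hexp1 t ht)
      (one_div_nonneg.2 hr0.le)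
    rw [mul_one_div, ← Real.exp_mul] at this
    refine this.trans ?_
    have he : -(c * (T - t)) * ((1 + δ₁) / δ₁) = -(d * (T - t)) := by rw [hd]; ring
    rw [he]
    exact mul_le_mul_of_nonneg_left hcompl (Real.exp_pos _).le
  have hEi : ∀ c : ℝ, IntegrableOn (fun t => Real.exp (-(c * (T - t)))) (Ioo 0 T) := fun c =>
    ((by fun_prop : Continuous fun t => Real.exp (-(c * (T - t)))).integrableOn_Icc).mono_set
      Ioo_subset_Icc_self
  have hQint : ∫ t in Ioo 0 T, Real.exp (-(d * (T - t))) * (complYoungFn φ 1 / X) ≤ 1 := by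
    rw [integral_mul_const]
    have h3 := mul_le_mul_of_nonneg_right (setIntegral_exp_le hd0 hT)
      (div_nonneg h2.le hX0.le)
    refine h3.trans ?_
    -- The base `X` of the gain is chosen for this identity; it leaves δ₀/δ₁ ≤ 1.
    have : 1 / d * (complYoungFn φ 1 / X) = δ₀ / δ₁ := by
      rw [hd, hX]; field_simp
    rw [this]
    exact (div_le_one h1).2 h.le
  -- Young's inequality for u/k and kernel/r, multiplied by rk. Both resulting integrals are at most
  -- 1, which accounts for the factor 2 in the gain.
  have hmain : ∀ t ∈ Ioo 0 T, Real.exp (-(c * (T - t))) * u t ≤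
      r * k * (youngFn φ (u t / k) + Real.exp (-(d * (T - t))) * (complYoungFn φ 1 / X)) := by
    intro t ht
    have h3 := h.young (div_nonneg (hu0 t ht) hk0.le)
      (div_nonneg (Real.exp_pos (-(c * (T - t)))).le hr0.le)
    have h4 := h3.trans (add_le_add_right (hQle t ht) _)
    have h5 := mul_le_mul_of_nonneg_left h4 (mul_pos hr0 hk0).le
    refine le_trans (le_of_eq ?_) h5
    field_simp
  have hsum := hPi.add ((hEi d).mul_const (complYoungFn φ 1 / X))
  have h6 : ∫ t in Ioo 0 T, Real.exp (-(c * (T - t))) * u t ≤ ∫ t in Ioo 0 T,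
      r * k * (youngFn φ (u t / k) + Real.exp (-(d * (T - t))) * (complYoungFn φ 1 / X)) := by
    refine integral_mono_of_nonneg ((ae_restrict_iff' measurableSet_Ioo).2
      (Eventually.of_forall fun t ht => mul_nonneg (Real.exp_pos _).le (hu0 t ht)))
      (hsum.const_mul _) ((ae_restrict_iff' measurableSet_Ioo).2 (Eventually.of_forall hmain))
  refine h6.trans ?_
  rw [integral_const_mul, integral_add hPi ((hEi d).mul_const _), hgain]
  have := mul_le_mul_of_nonneg_left (add_le_add hPle hQint) (mul_pos hr0 hk0).le
  linarith

end IsTolksdorf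

/-! ### Cutoff functions and smooth approximations of the absolute value -/

/-- The derivative of `cutoff ε`, rising from `0` to `1` on `[ε, 2ε]`. -/
noncomputable def cutoffDeriv (ε s : ℝ) : ℝ := Real.smoothTransition (s / ε - 1)

/-- A convex approximation of `max s 0` vanishing for `s ≤ ε`. -/
noncomputable def cutoff (ε s : ℝ) : ℝ := ∫ σ in (0 : ℝ)..s, cutoffDeriv ε σ

/-- The second derivative of `cutoff ε`. -/
noncomputable def cutoffDeriv2 (ε s : ℝ) : ℝ := deriv Real.smoothTransition (s / ε - 1) / ε

section cutoff

variable {ε : ℝ}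

lemma contDiff_cutoffDeriv (ε : ℝ) {n : ℕ∞} : ContDiff ℝ n (cutoffDeriv ε) :=
  Real.smoothTransition.contDiff.comp (by fun_prop)

lemma continuous_cutoffDeriv (ε : ℝ) : Continuous (cutoffDeriv ε) :=
  (contDiff_cutoffDeriv ε (n := 0)).continuous

lemma hasDerivAt_cutoff (ε s : ℝ) : HasDerivAt (cutoff ε) (cutoffDeriv ε s) s :=
  intervalIntegral.integral_hasDerivAt_right ((continuous_cutoffDeriv ε).intervalIntegrable _ _)
    ((continuous_cutoffDeriv ε).stronglyMeasurableAtFilter _ _)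
    (continuous_cutoffDeriv ε).continuousAt

lemma hasDerivAt_cutoffDeriv (ε s : ℝ) : HasDerivAt (cutoffDeriv ε) (cutoffDeriv2 ε s) s := by
  have h1 : HasDerivAt Real.smoothTransition (deriv Real.smoothTransition (s / ε - 1))
      (s / ε - 1) :=
    ((Real.smoothTransition.contDiff (n := 1)).differentiable (by simp)).differentiableAt.hasDerivAt
  have h2 : HasDerivAt (fun s => s / ε - 1) (1 / ε) s :=
    ((hasDerivAt_id s).div_const ε).sub_const 1
  refine (h1.comp s h2).congr_deriv ?_
  rw [cutoffDeriv2]; ring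

lemma contDiff_cutoff (ε : ℝ) : ContDiff ℝ 2 (cutoff ε) := by
  have h : deriv (cutoff ε) = cutoffDeriv ε := funext fun s => (hasDerivAt_cutoff ε s).deriv
  rw [show (2 : WithTop ℕ∞) = 1 + 1 by norm_num, contDiff_succ_iff_deriv]
  refine ⟨fun s => (hasDerivAt_cutoff ε s).differentiableAt, by simp, ?_⟩
  rw [h]
  exact contDiff_cutoffDeriv ε

lemma continuous_cutoff (ε : ℝ) : Continuous (cutoff ε) := (contDiff_cutoff ε).continuous

lemma continuous_cutoffDeriv2 (ε : ℝ) : Continuous (cutoffDeriv2 ε) := by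
  have : Continuous (deriv Real.smoothTransition) :=
    (Real.smoothTransition.contDiff (n := 1)).continuous_deriv (by simp)
  unfold cutoffDeriv2
  fun_prop

lemma cutoffDeriv_nonneg (ε s : ℝ) : 0 ≤ cutoffDeriv ε s := Real.smoothTransition.nonneg _

lemma cutoffDeriv_le_one (ε s : ℝ) : cutoffDeriv ε s ≤ 1 := Real.smoothTransition.le_one _

lemma cutoffDeriv_mono (hε : 0 < ε) : Monotone (cutoffDeriv ε) := fun s t hst =>
  Real.smoothTransition.monotone (by gcongr)

lemma cutoffDeriv2_nonneg (hε : 0 < ε) (s : ℝ) : 0 ≤ cutoffDeriv2 ε s :=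
  div_nonneg (Real.smoothTransition.monotone.deriv_nonneg) hε.le

lemma cutoffDeriv_eq_zero (hε : 0 < ε) {s : ℝ} (hs : s ≤ ε) : cutoffDeriv ε s = 0 :=
  Real.smoothTransition.zero_of_nonpos (sub_nonpos.2 ((div_le_one hε).2 hs))

lemma cutoffDeriv_eq_one (hε : 0 < ε) {s : ℝ} (hs : 2 * ε ≤ s) : cutoffDeriv ε s = 1 :=
  Real.smoothTransition.one_of_one_le (by
    rw [le_sub_iff_add_le, le_div_iff₀ hε]; linarith)

lemma cutoff_eq_zero (hε : 0 < ε) {s : ℝ} (hs : s ≤ ε) : cutoff ε s = 0 := by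
  refine (intervalIntegral.integral_congr (g := fun _ => (0 : ℝ)) fun σ hσ => ?_).trans (by simp)
  exact cutoffDeriv_eq_zero hε (hσ.2.trans (max_le hε.le hs))

lemma cutoffDeriv2_eq_zero_of_lt (hε : 0 < ε) {s : ℝ} (hs : s < ε) : cutoffDeriv2 ε s = 0 := by
  rw [← (hasDerivAt_cutoffDeriv ε s).deriv]
  have : cutoffDeriv ε =ᶠ[𝓝 s] fun _ => 0 := by
    filter_upwards [Iio_mem_nhds hs] with t ht using cutoffDeriv_eq_zero hε (le_of_lt ht)
  rw [this.deriv_eq, deriv_const]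

lemma cutoffDeriv2_eq_zero_of_gt (hε : 0 < ε) {s : ℝ} (hs : 2 * ε < s) :
    cutoffDeriv2 ε s = 0 := by
  rw [← (hasDerivAt_cutoffDeriv ε s).deriv]
  have : cutoffDeriv ε =ᶠ[𝓝 s] fun _ => 1 := by
    filter_upwards [Ioi_mem_nhds hs] with t ht using cutoffDeriv_eq_one hε (le_of_lt ht)
  rw [this.deriv_eq, deriv_const]

lemma cutoff_nonneg {s : ℝ} (hs : 0 ≤ s) : 0 ≤ cutoff ε s :=
  intervalIntegral.integral_nonneg hs fun _ _ => cutoffDeriv_nonneg _ _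

/-- Convexity of `cutoff ε` together with its vanishing at 0. This lets the decay term survive the
truncation with the right sign. -/
lemma cutoff_le_mul (hε : 0 < ε) {s : ℝ} (hs : 0 ≤ s) : cutoff ε s ≤ s * cutoffDeriv ε s := by
  have := intervalIntegral.integral_mono_on hs
    ((continuous_cutoffDeriv ε).intervalIntegrable (μ := volume) 0 s)
    (intervalIntegrable_const (c := cutoffDeriv ε s)) fun σ hσ => cutoffDeriv_mono hε hσ.2
  simpa [cutoff] using this

lemma cutoff_le {s : ℝ} (hs : 0 ≤ s) : cutoff ε s ≤ s := by
  have := intervalIntegral.integral_mono_on hs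
    ((continuous_cutoffDeriv ε).intervalIntegrable (μ := volume) 0 s)
    (intervalIntegrable_const (c := (1 : ℝ))) fun σ _ => cutoffDeriv_le_one ε σ
  simpa [cutoff] using this

/-- The slope is 1 beyond 2ε, so truncation loses at most 2ε. -/
lemma le_cutoff_add (hε : 0 < ε) {s : ℝ} (hs : 0 ≤ s) : s ≤ cutoff ε s + 2 * ε := by
  rcases le_total s (2 * ε) with h | h
  · linarith [cutoff_nonneg (ε := ε) hs]
  · have h1 : cutoff ε s = cutoff ε (2 * ε) + ∫ σ in (2 * ε)..s, cutoffDeriv ε σ :=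
      (intervalIntegral.integral_add_adjacent_intervals
        ((continuous_cutoffDeriv ε).intervalIntegrable _ _)
        ((continuous_cutoffDeriv ε).intervalIntegrable _ _)).symm
    have h2 : ∫ σ in (2 * ε)..s, cutoffDeriv ε σ = ∫ _ in (2 * ε)..s, (1 : ℝ) :=
      intervalIntegral.integral_congr fun σ hσ => by
        rw [uIcc_of_le h] at hσ
        exact cutoffDeriv_eq_one hε hσ.1
    rw [intervalIntegral.integral_const, smul_eq_mul, mul_one] at h2
    linarith [cutoff_nonneg (ε := ε) (by positivity : 0 ≤ 2 * ε)]

lemma mul_cutoffDeriv_le (hε : 0 < ε) {s : ℝ} (hs : 0 ≤ s) :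
    s * cutoffDeriv ε s ≤ cutoff ε s + 2 * ε :=
  (mul_le_of_le_one_right hs (cutoffDeriv_le_one ε s)).trans (le_cutoff_add hε hs)

end cutoff

/-- A smooth approximation of `|s|`. -/
noncomputable def softAbs (τ s : ℝ) : ℝ := √(s ^ 2 + τ ^ 2) - τ

/-- The derivative of `softAbs τ`. -/
noncomputable def softSign (τ s : ℝ) : ℝ := s / √(s ^ 2 + τ ^ 2)

/-- The second derivative of `softAbs τ`. -/
noncomputable def softDirac (τ s : ℝ) : ℝ := τ ^ 2 / √(s ^ 2 + τ ^ 2) ^ 3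

section softAbs

variable {τ : ℝ}

lemma sqrt_sq_add_pos (hτ : 0 < τ) (s : ℝ) : 0 < √(s ^ 2 + τ ^ 2) :=
  Real.sqrt_pos.2 (by positivity)

lemma hasDerivAt_sqrt_sq_add (hτ : 0 < τ) (s : ℝ) :
    HasDerivAt (fun s => √(s ^ 2 + τ ^ 2)) (softSign τ s) s := by
  have h : HasDerivAt (fun s => s ^ 2 + τ ^ 2) (2 * s) s := by
    simpa using (hasDerivAt_pow 2 s).add_const (τ ^ 2)
  refine (h.sqrt (by positivity)).congr_deriv ?_
  rw [softSign, mul_div_mul_left _ _ two_ne_zero]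

lemma hasDerivAt_softAbs (hτ : 0 < τ) (s : ℝ) : HasDerivAt (softAbs τ) (softSign τ s) s :=
  (hasDerivAt_sqrt_sq_add hτ s).sub_const τ

lemma hasDerivAt_softSign (hτ : 0 < τ) (s : ℝ) : HasDerivAt (softSign τ) (softDirac τ s) s := by
  have h0 := sqrt_sq_add_pos hτ s
  refine ((hasDerivAt_id s).div (hasDerivAt_sqrt_sq_add hτ s) h0.ne').congr_deriv ?_
  have h2 : √(s ^ 2 + τ ^ 2) ^ 2 = s ^ 2 + τ ^ 2 := Real.sq_sqrt (by positivity)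
  simp only [id, softSign, softDirac]
  field_simp
  rw [h2]; ring

lemma contDiff_sqrt_sq_add (hτ : 0 < τ) {n : WithTop ℕ∞} :
    ContDiff ℝ n fun s => √(s ^ 2 + τ ^ 2) :=
  ContDiff.sqrt (by fun_prop) fun s => by positivity

lemma contDiff_softAbs (hτ : 0 < τ) {n : WithTop ℕ∞} : ContDiff ℝ n (softAbs τ) :=
  (contDiff_sqrt_sq_add hτ).sub contDiff_const

lemma contDiff_softSign (hτ : 0 < τ) {n : WithTop ℕ∞} : ContDiff ℝ n (softSign τ) :=
  contDiff_id.div (contDiff_sqrt_sq_add hτ) fun s => (sqrt_sq_add_pos hτ s).ne'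

lemma continuous_softDirac (hτ : 0 < τ) : Continuous (softDirac τ) :=
  continuous_const.div₀ ((contDiff_sqrt_sq_add hτ (n := 0)).continuous.pow 3)
    fun s => (pow_pos (sqrt_sq_add_pos hτ s) 3).ne'

lemma abs_le_sqrt_sq_add (s τ : ℝ) : |s| ≤ √(s ^ 2 + τ ^ 2) :=
  Real.abs_le_sqrt (by nlinarith [sq_nonneg τ])

lemma le_sqrt_sq_add (s τ : ℝ) : τ ≤ √(s ^ 2 + τ ^ 2) :=
  Real.le_sqrt_of_sq_le (by nlinarith [sq_nonneg s])

lemma softAbs_nonneg (τ s : ℝ) : 0 ≤ softAbs τ s := sub_nonneg.2 (le_sqrt_sq_add s τ)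

lemma softAbs_le (hτ : 0 < τ) (s : ℝ) : softAbs τ s ≤ |s| := by
  rw [softAbs, sub_le_iff_le_add, Real.sqrt_le_left (by positivity), ← sq_abs s]
  nlinarith [abs_nonneg s]

lemma abs_le_softAbs_add (τ s : ℝ) : |s| ≤ softAbs τ s + τ := by
  rw [softAbs]; linarith [abs_le_sqrt_sq_add s τ]

lemma abs_softSign_le (hτ : 0 < τ) (s : ℝ) : |softSign τ s| ≤ 1 := by
  rw [softSign, abs_div, abs_of_pos (sqrt_sq_add_pos hτ s), div_le_one (sqrt_sq_add_pos hτ s)]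
  exact abs_le_sqrt_sq_add s τ

/-- The defect in s·sgn(s) = |s| after regularisation; the formula shows that it lies between 0 and
τ. -/
lemma mul_softSign_sub (hτ : 0 < τ) (s : ℝ) :
    s * softSign τ s - softAbs τ s = τ * (1 - τ / √(s ^ 2 + τ ^ 2)) := by
  have h0 := sqrt_sq_add_pos hτ s
  have h2 : √(s ^ 2 + τ ^ 2) ^ 2 = s ^ 2 + τ ^ 2 := Real.sq_sqrt (by positivity)
  rw [softSign, softAbs]
  field_simp
  linear_combination -h2

lemma softAbs_le_mul_softSign (hτ : 0 < τ) (s : ℝ) : softAbs τ s ≤ s * softSign τ s := by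
  have h0 := sqrt_sq_add_pos hτ s
  have : τ / √(s ^ 2 + τ ^ 2) ≤ 1 := (div_le_one h0).2 (le_sqrt_sq_add s τ)
  have h1 := mul_nonneg hτ.le (sub_nonneg.2 this)
  linarith [mul_softSign_sub hτ s]

lemma mul_softSign_le (hτ : 0 < τ) (s : ℝ) : s * softSign τ s ≤ softAbs τ s + τ := by
  have h0 := sqrt_sq_add_pos hτ s
  have h1 : 0 ≤ τ * (τ / √(s ^ 2 + τ ^ 2)) := by positivity
  linarith [mul_softSign_sub hτ s]

lemma softDirac_nonneg (hτ : 0 < τ) (s : ℝ) : 0 ≤ softDirac τ s := by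
  have := sqrt_sq_add_pos hτ s
  unfold softDirac; positivity

lemma abs_mul_softDirac_le_one (hτ : 0 < τ) (s : ℝ) : |s| * softDirac τ s ≤ 1 := by
  have h0 := sqrt_sq_add_pos hτ s
  rw [softDirac, mul_div_assoc', div_le_one (by positivity)]
  calc |s| * τ ^ 2 ≤ √(s ^ 2 + τ ^ 2) * √(s ^ 2 + τ ^ 2) ^ 2 :=
        mul_le_mul (abs_le_sqrt_sq_add s τ) (pow_le_pow_left₀ hτ.le (le_sqrt_sq_add s τ) 2)
          (by positivity) h0.le
    _ = _ := by ring

lemma abs_mul_softDirac_le (hτ : 0 < τ) {s : ℝ} (hs : s ≠ 0) :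
    |s| * softDirac τ s ≤ τ ^ 2 / s ^ 2 := by
  have h0 := sqrt_sq_add_pos hτ s
  have hs' := abs_pos.2 hs
  rw [softDirac, mul_div_assoc', div_le_div_iff₀ (by positivity) (by positivity)]
  have : |s| ^ 3 ≤ √(s ^ 2 + τ ^ 2) ^ 3 :=
    pow_le_pow_left₀ hs'.le (abs_le_sqrt_sq_add s τ) 3
  calc |s| * τ ^ 2 * s ^ 2 = τ ^ 2 * |s| ^ 3 := by rw [← sq_abs s]; ring
    _ ≤ _ := mul_le_mul_of_nonneg_left this (by positivity)

/-- A weak form of sδ(s) = 0. Along with the uniform bound by 1, it removes the convection term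
concentrated on {w = 0} by dominated convergence. -/
lemma tendsto_abs_mul_softDirac {τ : ℕ → ℝ} (hτ : ∀ k, 0 < τ k) (hlim : Tendsto τ atTop (𝓝 0))
    (s : ℝ) : Tendsto (fun k => |s| * softDirac (τ k) s) atTop (𝓝 0) := by
  rcases eq_or_ne s 0 with rfl | hs
  · simp
  · refine squeeze_zero (fun k => mul_nonneg (abs_nonneg s) (softDirac_nonneg (hτ k) s))
      (fun k => abs_mul_softDirac_le (hτ k) hs) ?_
    simpa using (hlim.pow 2).div_const (s ^ 2)

end softAbs

/-! ### Geometry of smooth bounded domains -/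

/-- The difference quotients along an inward ray are nonnegative. Only a derivative relative to a
set containing Ω is needed, so this applies to weights defined merely on the closure. -/
lemma nonneg_of_hasFDerivWithinAt_of_inward {E : Type*} [NormedAddCommGroup E] [NormedSpace ℝ E]
    {Ω s : Set E} {u : E → ℝ} {L : E →L[ℝ] ℝ} {x v : E} (hL : HasFDerivWithinAt u L s x)
    (hs : Ω ⊆ s) (hu : ∀ y ∈ Ω, 0 ≤ u y) (hx : u x = 0)
    (hv : ∀ᶠ σ : ℝ in 𝓝[>] 0, x + σ • v ∈ Ω) : 0 ≤ L v := by
  set S : Set ℝ := {σ | 0 < σ ∧ x + σ • v ∈ Ω}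
  have hS : S ∈ 𝓝[>] (0 : ℝ) := inter_mem self_mem_nhdsWithin hv
  have hd : HasDerivWithinAt (fun σ : ℝ => x + σ • v) v S 0 := by
    simpa using (((hasDerivAt_id (0 : ℝ)).smul_const v).const_add x).hasDerivWithinAt
  have hL' : HasFDerivWithinAt u L s (x + (0 : ℝ) • v) := by simpa using hL
  have h1 : HasDerivWithinAt (fun σ : ℝ => u (x + σ • v)) (L v) S 0 :=
    hL'.comp_hasDerivWithinAt (0 : ℝ) hd fun σ hσ => hs hσ.2
  have h2 : HasDerivWithinAt (fun σ : ℝ => u (x + σ • v)) (L v) (Ioi 0) 0 :=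
    h1.mono_of_mem_nhdsWithin hS
  rw [hasDerivWithinAt_iff_tendsto_slope' (by simp)] at h2
  refine ge_of_tendsto h2 ?_
  filter_upwards [hS] with σ hσ
  rw [slope_def_field]
  simp only [zero_smul, add_zero, hx, sub_zero]
  exact div_nonneg (hu _ hσ.2) hσ.1.le

namespace IsSmoothBoundedDomain

variable {n : ℕ} {Ω : Set (RSpace n)}

lemma isCompact_closure (hΩ : IsSmoothBoundedDomain Ω) : IsCompact (closure Ω) :=
  hΩ.isBounded.isCompact_closure

lemma isCompact_frontier (hΩ : IsSmoothBoundedDomain Ω) : IsCompact (frontier Ω) :=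
  hΩ.isCompact_closure.of_isClosed_subset isClosed_frontier frontier_subset_closure

lemma closure_diff (hΩ : IsSmoothBoundedDomain Ω) {x : RSpace n} (hx : x ∈ closure Ω) :
    x ∈ Ω ∨ x ∈ frontier Ω := by
  by_cases h : x ∈ Ω
  · exact Or.inl h
  · exact Or.inr ⟨hx, by rwa [hΩ.isOpen.interior_eq]⟩

lemma notMem_of_frontier (hΩ : IsSmoothBoundedDomain Ω) {x : RSpace n} (hx : x ∈ frontier Ω) :
    x ∉ Ω := fun h => by
  have := hx.2
  rw [hΩ.isOpen.interior_eq] at this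
  exact this h

/-- That r vanishes on the boundary is deduced: r ≤ 0 there by approximation from Ω, and r < 0 would
place the point in Ω. -/
lemma exists_definingFunction (hΩ : IsSmoothBoundedDomain Ω) {x₀ : RSpace n}
    (hx₀ : x₀ ∈ frontier Ω) : ∃ (U : Set (RSpace n)) (r : RSpace n → ℝ),
    IsOpen U ∧ x₀ ∈ U ∧ ContDiffOn ℝ 2 r U ∧ (∀ x ∈ U, fderiv ℝ r x ≠ 0) ∧
      (∀ x ∈ U, x ∈ Ω ↔ r x < 0) ∧ ∀ x ∈ U, x ∈ frontier Ω → r x = 0 := by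
  obtain ⟨U, r, hU, hxU, hr, hdr, hΩU⟩ := hΩ.boundary x₀ hx₀
  have hiff : ∀ x ∈ U, x ∈ Ω ↔ r x < 0 := fun x hx => by
    have := Set.ext_iff.1 hΩU x
    simp only [mem_inter_iff, mem_ofPred_eq, hx, and_true, true_and] at this
    exact this
  refine ⟨U, r, hU, hxU, hr, hdr, hiff, fun x hxU hx => le_antisymm ?_ ?_⟩
  · have hc : ContinuousAt r x := (hr.continuousOn.continuousAt (hU.mem_nhds hxU))
    have hfreq : ∃ᶠ y in 𝓝 x, y ∈ Ω := mem_closure_iff_frequently.1 (frontier_subset_closure hx)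
    by_contra! hpos
    have hev := (hc.eventually (lt_mem_nhds hpos)).and (hU.mem_nhds hxU)
    obtain ⟨y, hyΩ, hy, hyU⟩ := (hfreq.and_eventually hev).exists
    exact absurd ((hiff y hyU).1 hyΩ) (not_lt.2 hy.le)
  · by_contra! hneg
    exact hΩ.notMem_of_frontier hx ((hiff x hxU).2 hneg)

lemma eventually_inward {x₀ : RSpace n} (hx₀ : x₀ ∈ frontier Ω)
    {U : Set (RSpace n)} {r : RSpace n → ℝ} (hU : IsOpen U) (hxU : x₀ ∈ U)
    (hr : ContDiffOn ℝ 2 r U) (hiff : ∀ x ∈ U, x ∈ Ω ↔ r x < 0)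
    (hzero : ∀ x ∈ U, x ∈ frontier Ω → r x = 0) {v : RSpace n} (hv : fderiv ℝ r x₀ v < 0) :
    ∀ᶠ σ : ℝ in 𝓝[>] 0, x₀ + σ • v ∈ Ω := by
  have hd : HasFDerivAt r (fderiv ℝ r x₀) (x₀ + (0 : ℝ) • v) := by
    simpa using ((hr.contDiffAt (hU.mem_nhds hxU)).differentiableAt (by simp)).hasFDerivAt
  have hline : HasDerivAt (fun σ : ℝ => x₀ + σ • v) v 0 := by
    simpa using ((hasDerivAt_id (0 : ℝ)).smul_const v).const_add x₀
  have hcomp : HasDerivAt (fun σ : ℝ => r (x₀ + σ • v)) (fderiv ℝ r x₀ v) 0 :=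
    hd.comp_hasDerivAt (0 : ℝ) hline
  have h2 := hcomp.hasDerivWithinAt (s := Ioi 0)
  rw [hasDerivWithinAt_iff_tendsto_slope' (by simp)] at h2
  have hUev : ∀ᶠ σ : ℝ in 𝓝[>] 0, x₀ + σ • v ∈ U := by
    refine (hline.continuousAt.eventually (hU.mem_nhds ?_)).filter_mono nhdsWithin_le_nhds
    simpa using hxU
  filter_upwards [h2.eventually (gt_mem_nhds hv), hUev, self_mem_nhdsWithin] with σ h3 h4 h5
  rw [hiff _ h4]
  rw [slope_def_field] at h3
  simp only [zero_smul, add_zero, hzero _ hxU hx₀, sub_zero] at h3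
  by_contra! h6
  exact absurd h3 (not_lt.2 (div_nonneg h6 (le_of_lt h5)))

/-- At a boundary point every direction along which r decreases is tangent to Ω. These directions
form a nonempty open half-space, whose span is everything. -/
lemma uniqueDiffOn_closure (hΩ : IsSmoothBoundedDomain Ω) : UniqueDiffOn ℝ (closure Ω) := by
  intro x hx
  rcases hΩ.closure_diff hx with h | h
  · exact uniqueDiffWithinAt_of_mem_nhds
      (mem_of_superset (hΩ.isOpen.mem_nhds h) subset_closure)
  obtain ⟨U, r, hU, hxU, hr, hdr, hiff, hzero⟩ := hΩ.exists_definingFunction h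
  refine ⟨?_, subset_closure hx⟩
  set C : Set (RSpace n) := {v | fderiv ℝ r x v < 0}
  have hC : C ⊆ tangentConeAt ℝ (closure Ω) x := fun v hv => by
    rw [tangentConeAt_closure]
    refine mem_tangentConeAt_of_add_smul_mem (l := 𝓝[>] (0 : ℝ)) (c := id) ?_
      (eventually_inward h hU hxU hr hiff hzero hv)
    exact tendsto_id.mono_left (nhdsWithin_mono _ fun σ hσ => ne_of_gt hσ)
  have hopen : IsOpen C := isOpen_lt (fderiv ℝ r x).continuous continuous_const
  have hne : C.Nonempty := by
    obtain ⟨w, hw⟩ : ∃ w, fderiv ℝ r x w ≠ 0 := by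
      by_contra! h0
      exact hdr x hxU (ContinuousLinearMap.ext h0)
    rcases lt_or_gt_of_ne hw with hw | hw
    · exact ⟨w, hw⟩
    · exact ⟨-w, by simpa [C] using hw⟩
  have htop : Submodule.span ℝ (tangentConeAt ℝ (closure Ω) x) = ⊤ := by
    refine Submodule.eq_top_of_nonempty_interior' _ (hne.mono ?_)
    exact (hopen.subset_interior_iff.2 (hC.trans Submodule.subset_span))
  rw [htop]
  exact dense_univ

/-- A `C²` function on `ℝⁿ` which is positive in `Ω`, vanishes on `∂Ω` and increases strictly in
some inward direction at every boundary point. -/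
lemma exists_global_definingFunction (hΩ : IsSmoothBoundedDomain Ω) :
    ∃ q : RSpace n → ℝ, ContDiff ℝ 2 q ∧ (∀ x ∈ Ω, 0 < q x) ∧ (∀ x ∈ frontier Ω, q x = 0) ∧
      ∀ x ∈ frontier Ω, ∃ v, (∀ᶠ σ : ℝ in 𝓝[>] 0, x + σ • v ∈ Ω) ∧ 0 < fderiv ℝ q x v := by
  have hloc : ∀ x₀ ∈ frontier Ω, ∃ (h : RSpace n → ℝ) (ρ : ℝ), 0 < ρ ∧ ContDiff ℝ 2 h ∧
      (∀ x ∈ Ω, 0 ≤ h x) ∧ (∀ x ∈ frontier Ω, h x = 0) ∧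
      ∀ x ∈ frontier Ω ∩ Metric.ball x₀ ρ,
        ∃ v, (∀ᶠ σ : ℝ in 𝓝[>] 0, x + σ • v ∈ Ω) ∧ 0 < fderiv ℝ h x v := by
    intro x₀ hx₀
    obtain ⟨U, r, hU, hxU, hr, hdr, hiff, hzero⟩ := hΩ.exists_definingFunction hx₀
    obtain ⟨ρ, hρ, hρU⟩ := Metric.isOpen_iff.1 hU x₀ hxU
    -- The bump localises r: the product -θr is C² on the whole space, and equals -r near the point.
    set θ : ContDiffBump x₀ := ⟨ρ / 4, ρ / 2, by positivity, by linarith⟩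
    have hout : ∀ x ∉ U, θ =ᶠ[𝓝 x] 0 := fun x hx => by
      have : x ∈ (Metric.closedBall x₀ (ρ / 2))ᶜ := fun hx' =>
        hx (hρU (Metric.closedBall_subset_ball (by linarith) hx'))
      filter_upwards [Metric.isClosed_closedBall.isOpen_compl.mem_nhds this] with y hy
      exact θ.zero_of_le_dist (le_of_lt (not_le.1 hy))
    have hθ0 : ∀ x ∉ U, θ x = 0 := fun x hx => (hout x hx).eq_of_nhds
    refine ⟨fun x => -(θ x * r x), ρ / 4, by positivity, ?_, fun x hx => ?_, fun x hx => ?_,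
      fun x hx => ?_⟩
    · refine contDiff_iff_contDiffAt.2 fun x => ?_
      by_cases hxU' : x ∈ U
      · exact (θ.contDiff.contDiffAt.mul (hr.contDiffAt (hU.mem_nhds hxU'))).neg
      · have : (fun x => -(θ x * r x)) =ᶠ[𝓝 x] fun _ => 0 := by
          filter_upwards [hout x hxU'] with y hy
          simp [hy]
        exact contDiffAt_const.congr_of_eventuallyEq this
    · by_cases hxU' : x ∈ U
      · rw [neg_nonneg]
        exact mul_nonpos_of_nonneg_of_nonpos θ.nonneg ((hiff x hxU').1 hx).le
      · simp [hθ0 x hxU']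
    · by_cases hxU' : x ∈ U
      · simp [hzero x hxU' hx]
      · simp [hθ0 x hxU']
    · have hxU' : x ∈ U := hρU (Metric.ball_subset_ball (by linarith) hx.2)
      have heq : (fun x => -(θ x * r x)) =ᶠ[𝓝 x] fun x => -r x := by
        filter_upwards [Metric.isOpen_ball.mem_nhds hx.2] with y hy
        rw [θ.one_of_mem_closedBall (Metric.ball_subset_closedBall hy), one_mul]
      rw [heq.fderiv_eq, fderiv_fun_neg]
      obtain ⟨w, hw⟩ : ∃ w, fderiv ℝ r x w ≠ 0 := by
        by_contra! h0
        exact hdr x hxU' (ContinuousLinearMap.ext h0)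
      obtain ⟨v, hv⟩ : ∃ v, fderiv ℝ r x v < 0 := by
        rcases lt_or_gt_of_ne hw with hw | hw
        · exact ⟨w, hw⟩
        · exact ⟨-w, by simpa using hw⟩
      exact ⟨v, eventually_inward hx.1 hU hxU' hr hiff hzero hv, by simpa using hv⟩
  choose! h ρ hρ hh hpos hzero hdir using hloc
  -- The finitely many local functions may all vanish deep inside Ω; `f` supplies strict positivity
  -- there without spoiling the boundary behaviour.
  obtain ⟨f, hfsupp, hf, hfr⟩ := hΩ.isOpen.exists_contDiff_support_eq (n := 2)
  obtain ⟨t, htf, ht⟩ := hΩ.isCompact_frontier.elim_nhds_subcover (fun x => Metric.ball x (ρ x))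
    fun x hx => Metric.ball_mem_nhds x (hρ x hx)
  have hf0 : ∀ x, 0 ≤ f x := fun x => (hfr (mem_range_self x)).1
  have hfz : ∀ x ∈ frontier Ω, f x = 0 := fun x hx => by
    by_contra h0
    have : x ∈ Function.support f := h0
    rw [hfsupp] at this
    exact hΩ.notMem_of_frontier hx this
  refine ⟨fun x => f x + ∑ i ∈ t, h i x, ?_, fun x hx => ?_, fun x hx => ?_, fun x hx => ?_⟩
  · exact ContDiff.add (by exact_mod_cast hf) (ContDiff.sum fun i hi => hh i (htf i hi))
  · have h1 : 0 < f x := (hf0 x).lt_of_ne' (by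
      have : x ∈ Function.support f := by rw [hfsupp]; exact hx
      exact this)
    exact add_pos_of_pos_of_nonneg h1 (Finset.sum_nonneg fun i hi => hpos i (htf i hi) x hx)
  · simp only [hfz x hx, zero_add]
    exact Finset.sum_eq_zero fun i hi => hzero i (htf i hi) x hx
  · obtain ⟨i, hi, hxi⟩ : ∃ i ∈ t, x ∈ Metric.ball i (ρ i) := by simpa using ht hx
    obtain ⟨v, hv, hvpos⟩ := hdir i (htf i hi) x ⟨hx, hxi⟩
    refine ⟨v, hv, ?_⟩
    have hdh : ∀ j ∈ t, DifferentiableAt ℝ (h j) x := fun j hj =>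
      ((hh j (htf j hj)).differentiable (by simp)).differentiableAt
    have hdf : DifferentiableAt ℝ f x := (hf.differentiable (by simp)).differentiableAt
    rw [fderiv_fun_add hdf (DifferentiableAt.fun_sum hdh), fderiv_fun_sum hdh]
    simp only [add_apply, sum_apply]
    -- All summands have nonnegative derivative in an inward direction, and the one whose ball
    -- contains the point has a positive one; hence nothing cancels.
    refine add_pos_of_nonneg_of_pos ?_ (Finset.sum_pos' (fun j hj => ?_) ⟨i, hi, hvpos⟩)
    · exact nonneg_of_hasFDerivWithinAt_of_inward hdf.hasFDerivAt.hasFDerivWithinAt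
        (subset_univ Ω) (fun y _ => hf0 y) (hfz x hx) hv
    · exact nonneg_of_hasFDerivWithinAt_of_inward (hdh j hj).hasFDerivAt.hasFDerivWithinAt
        (subset_univ Ω) (hpos j (htf j hj)) (hzero j (htf j hj) x hx) hv

/-- Near a boundary point the boundary is a Lipschitz graph over the tangent space, the domain lies
on the side of the inner unit normal `e`, and functions vanishing on `∂Ω` and nonnegative in `Ω`
have their differential in direction `e`. -/
lemma exists_normal (hΩ : IsSmoothBoundedDomain Ω) {x₀ : RSpace n} (hx₀ : x₀ ∈ frontier Ω) :
    ∃ (e : RSpace n) (ρ : ℝ), ‖e‖ = 1 ∧ 0 < ρ ∧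
      (∀ x ∈ frontier Ω ∩ Metric.ball x₀ ρ, ∀ y ∈ frontier Ω ∩ Metric.ball x₀ ρ,
        |inner ℝ e (x - y)| ≤ 1 / 2 * ‖x - y‖) ∧
      (∀ x ∈ frontier Ω ∩ Metric.ball x₀ ρ, ∀ s : ℝ, x + s • e ∈ Metric.ball x₀ ρ →
        (x + s • e ∈ Ω ↔ 0 < s)) ∧
      ∀ (u : RSpace n → ℝ) (L : RSpace n →L[ℝ] ℝ), HasFDerivWithinAt u L (closure Ω) x₀ →
        (∀ x ∈ Ω, 0 ≤ u x) → u x₀ = 0 → ∀ v, L v = ‖L‖ * inner ℝ e v := by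
  obtain ⟨U, r, hU, hxU, hr, hdr, hiff, hzero⟩ := hΩ.exists_definingFunction hx₀
  set R := fderiv ℝ r x₀ with hR
  set w := (InnerProductSpace.toDual ℝ (RSpace n)).symm R with hw
  have hRw : ∀ v, R v = inner ℝ w v := fun v => by
    rw [hw, InnerProductSpace.toDual_symm_apply]
  have hw0 : 0 < ‖w‖ := by
    rw [hw, LinearIsometryEquiv.norm_map]
    exact norm_pos_iff.2 (hdr x₀ hxU)
  -- The inner unit normal, opposite to the gradient `w` of r at the point.
  set e : RSpace n := -(‖w‖⁻¹ • w) with he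
  have he1 : ‖e‖ = 1 := by
    rw [he, norm_neg, norm_smul, norm_inv, norm_norm, inv_mul_cancel₀ hw0.ne']
  have hRe : ∀ v, R v = -(‖w‖ * inner ℝ e v) := fun v => by
    rw [hRw, he, inner_neg_left, real_inner_smul_left]
    field_simp
  have hstrict : HasStrictFDerivAt r R x₀ :=
    (hr.contDiffAt (hU.mem_nhds hxU)).hasStrictFDerivAt (by simp)
  -- Strict differentiability linearises r up to half of its slope. This yields the Lipschitz
  -- constant 1/2 of the boundary graph, and decides on which side of the graph a normal line runs.
  obtain ⟨s, hs, happ⟩ := hstrict.approximates_deriv_on_nhds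
    (c := Real.toNNReal (‖w‖ / 2)) (Or.inr (Real.toNNReal_pos.2 (half_pos hw0)))
  obtain ⟨ρ, hρ, hρs⟩ := Metric.mem_nhds_iff.1 (inter_mem hs (hU.mem_nhds hxU))
  have happ' : ∀ x ∈ Metric.ball x₀ ρ, ∀ y ∈ Metric.ball x₀ ρ,
      |r x - r y - R (x - y)| ≤ ‖w‖ / 2 * ‖x - y‖ := fun x hx y hy => by
    have := happ x (hρs hx).1 y (hρs hy).1
    rwa [Real.coe_toNNReal _ (half_pos hw0).le] at this
  refine ⟨e, ρ, he1, hρ, fun x hx y hy => ?_, fun x hx s hxs => ?_,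
    fun u L hL hu hux v => ?_⟩
  · have h1 := happ' x hx.2 y hy.2
    rw [hzero x (hρs hx.2).2 hx.1, hzero y (hρs hy.2).2 hy.1, hRe, sub_zero, zero_sub, neg_neg,
      abs_mul, abs_of_pos hw0] at h1
    have h2 : ‖w‖ * |inner ℝ e (x - y)| ≤ ‖w‖ * (1 / 2 * ‖x - y‖) := by linarith
    exact le_of_mul_le_mul_left h2 hw0
  · have h1 := happ' _ hxs x hx.2
    rw [hzero x (hρs hx.2).2 hx.1, hRe, add_sub_cancel_left, real_inner_smul_right,
      real_inner_self_eq_norm_sq, he1, norm_smul, he1, Real.norm_eq_abs] at h1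
    rw [hiff _ (hρs hxs).2]
    constructor
    · intro h2
      by_contra! hs0
      rw [abs_of_nonpos hs0] at h1
      have h3 := (abs_le.1 h1).1
      nlinarith
    · intro hs0
      rw [abs_of_pos hs0] at h1
      have h3 := (abs_le.1 h1).2
      nlinarith
  · have hpos : ∀ v, R v < 0 → 0 ≤ L v := fun v hv =>
      nonneg_of_hasFDerivWithinAt_of_inward hL subset_closure hu hux
        (eventually_inward hx₀ hU hxU hr hiff hzero hv)
    have hRee : R e = -‖w‖ := by rw [hRe, real_inner_self_eq_norm_sq, he1]; ring
    have hLe : 0 ≤ L e := hpos e (by rw [hRee]; linarith)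
    -- Tangential vectors are limits of inward ones: add a small multiple of e. Applying the result
    -- to ±v kills `L` on the tangent space, so `L` is a multiple of the inner product with e.
    have hker : ∀ v, R v = 0 → 0 ≤ L v := fun v hv => by
      refine le_of_forall_pos_le_add fun ε hε => ?_
      have h1 := hpos (v + (ε / (L e + 1)) • e) (by
        rw [map_add, map_smul, hv, hRee, zero_add, smul_eq_mul]
        have : 0 < ε / (L e + 1) := by positivity
        nlinarith)
      rw [map_add, map_smul, smul_eq_mul] at h1
      have h2 : ε / (L e + 1) * L e ≤ ε := by
        rw [div_mul_eq_mul_div, div_le_iff₀ (by positivity)]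
        nlinarith
      linarith
    have hker0 : ∀ v, R v = 0 → L v = 0 := fun v hv => by
      have h1 := hker v hv
      have h2 := hker (-v) (by simp [hv])
      rw [map_neg] at h2
      linarith
    have hform : ∀ v, L v = L e * inner ℝ e v := fun v => by
      have h1 := hker0 (v - (inner ℝ e v : ℝ) • e) (by
        rw [map_sub, map_smul, hRee, hRe, smul_eq_mul]; ring)
      rw [map_sub, map_smul, smul_eq_mul] at h1
      linarith
    have hnorm : ‖L‖ = L e := by
      refine le_antisymm (L.opNorm_le_bound hLe fun v => ?_) ?_
      · rw [hform, Real.norm_eq_abs, abs_mul, abs_of_nonneg hLe]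
        refine mul_le_mul_of_nonneg_left ?_ hLe
        have := abs_real_inner_le_norm e v
        rwa [he1, one_mul] at this
      · have := (le_abs_self _).trans (L.le_opNorm e)
        rwa [he1, mul_one] at this
    rw [hnorm]
    exact hform v


end IsSmoothBoundedDomain

/-! ### Surface measure -/

lemma LipschitzOnWith.euclideanHausdorffMeasure_image_le {X Y : Type*} [EMetricSpace X]
    [MeasurableSpace X] [BorelSpace X] [EMetricSpace Y] [MeasurableSpace Y] [BorelSpace Y]
    {f : X → Y} {s : Set X} {K : NNReal} (hf : LipschitzOnWith K f s) (d : ℕ) :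
    (Measure.euclideanHausdorffMeasure d : Measure Y) (f '' s) ≤
      (K : ENNReal) ^ d * (Measure.euclideanHausdorffMeasure d : Measure X) s := by
  simp only [Measure.euclideanHausdorffMeasure_def, Measure.smul_apply]
  have := hf.hausdorffMeasure_image_le (Nat.cast_nonneg' d)
  rw [ENNReal.rpow_natCast] at this
  rw [mul_smul_comm]
  gcongr

section normal

variable {n : ℕ}

/-- The orthogonal projection onto the hyperplane normal to `e`. -/
noncomputable abbrev hyperplaneProj (e : RSpace n) : RSpace n →L[ℝ] (ℝ ∙ e)ᗮ :=
  (ℝ ∙ e)ᗮ.orthogonalProjectionOnto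

/-- The Euclidean normalisation of the Hausdorff measure makes the constant here exactly 1, and with
it the constant in front of the boundary term. -/
lemma hyperplane_volume_eq (hn : 0 < n) {e : RSpace n} (he : ‖e‖ = 1) :
    (Measure.euclideanHausdorffMeasure (n - 1) : Measure (ℝ ∙ e)ᗮ) = volume := by
  have he0 : e ≠ 0 := fun h => by simp [h] at he
  have : Fact (Module.finrank ℝ (RSpace n) = (n - 1) + 1) :=
    ⟨by rw [finrank_euclideanSpace_fin]; omega⟩
  rw [← InnerProductSpace.euclideanHausdorffMeasure_eq_volume,
    Submodule.finrank_orthogonal_span_singleton (n := n - 1) he0]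

lemma norm_sq_eq_hyperplaneProj {e : RSpace n} (he : ‖e‖ = 1) (x : RSpace n) :
    ‖x‖ ^ 2 = inner ℝ e x ^ 2 + ‖hyperplaneProj e x‖ ^ 2 := by
  have h := Submodule.norm_sq_eq_add_norm_sq_projection x (ℝ ∙ e)
  have h1 : ‖(ℝ ∙ e).orthogonalProjectionOnto x‖ = |inner ℝ e x| := by
    rw [← Submodule.norm_coe, ← Submodule.starProjection_apply,
      Submodule.starProjection_unit_singleton ℝ he, norm_smul, he, mul_one, Real.norm_eq_abs]
  rw [h, h1, sq_abs]

lemma hyperplaneProj_add_smul (e x : RSpace n) (s : ℝ) :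
    hyperplaneProj e (x + s • e) = hyperplaneProj e x := by
  rw [map_add, map_smul, Submodule.orthogonalProjectionOnto_orthogonalComplement_singleton_eq_zero,
    smul_zero, add_zero]

end normal

namespace IsSmoothBoundedDomain

variable {n : ℕ} {Ω : Set (RSpace n)}

/-- Locally the boundary is the image of a bounded part of the tangent hyperplane under a Lipschitz
map, namely the inverse of the projection; compactness then gives finiteness. -/
lemma euclideanHausdorffMeasure_frontier_lt_top (hΩ : IsSmoothBoundedDomain Ω) (hn : 0 < n) :
    (Measure.euclideanHausdorffMeasure (n - 1) : Measure (RSpace n)) (frontier Ω) < ⊤ := by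
  refine hΩ.isCompact_frontier.measure_lt_top_of_nhdsWithin fun x₀ hx₀ => ?_
  obtain ⟨e, ρ, he, hρ, hlip, -, -⟩ := hΩ.exists_normal hx₀
  refine ⟨frontier Ω ∩ Metric.ball x₀ ρ,
    inter_mem_nhdsWithin _ (Metric.ball_mem_nhds x₀ hρ), ?_⟩
  set A := frontier Ω ∩ Metric.ball x₀ ρ
  set P := hyperplaneProj e
  -- By Pythagoras and the slope bound, ‖x-y‖² ≤ ¼‖x-y‖² + ‖Px-Py‖², so the inverse projection is
  -- 2-Lipschitz.
  have hanti : ∀ x ∈ A, ∀ y ∈ A, ‖x - y‖ ≤ 2 * ‖P x - P y‖ := fun x hx y hy => by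
    have h1 := hlip x hx y hy
    have h2 := norm_sq_eq_hyperplaneProj he (x - y)
    have h3 : inner ℝ e (x - y) ^ 2 ≤ (1 / 2 * ‖x - y‖) ^ 2 := by
      rw [← sq_abs]; gcongr
    rw [← map_sub]
    refine abs_le_of_sq_le_sq' ?_ (by positivity) |>.2
    nlinarith
  have hinj : InjOn P A := fun x hx y hy hxy => by
    have := hanti x hx y hy
    rw [hxy, sub_self, norm_zero, mul_zero, norm_le_zero_iff, sub_eq_zero] at this
    exact this
  have hlipinv : LipschitzOnWith 2 (Function.invFunOn P A) (P '' A) := by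
    refine LipschitzOnWith.of_dist_le_mul ?_
    rintro _ ⟨x, hx, rfl⟩ _ ⟨y, hy, rfl⟩
    rw [hinj.leftInvOn_invFunOn hx, hinj.leftInvOn_invFunOn hy, dist_eq_norm, dist_eq_norm]
    exact hanti x hx y hy
  have himage : Function.invFunOn P A '' (P '' A) = A := hinj.leftInvOn_invFunOn.image_image
  have hle := hlipinv.euclideanHausdorffMeasure_image_le (n - 1)
  rw [himage, hyperplane_volume_eq hn he] at hle
  refine hle.trans_lt (ENNReal.mul_lt_top (by simp) ?_)
  have hb : Bornology.IsBounded A := Metric.isBounded_ball.subset inter_subset_right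
  exact (P.lipschitz.isBounded_image hb).measure_lt_top

end IsSmoothBoundedDomain

/-! ### Boundary layers -/

section projection

variable {n : ℕ}

/-- The projection is 1-Lipschitz, so Lebesgue measure on the hyperplane is dominated by the image
of the surface measure. This replaces the area formula, since only an upper bound is required. -/
lemma lintegral_le_of_hyperplaneProj (hn : 0 < n) {e : RSpace n} (he : ‖e‖ = 1)
    {K : Set (RSpace n)} (hK : MeasurableSet K) {h : (ℝ ∙ e)ᗮ → ENNReal}
    {G : RSpace n → ENNReal} (h0 : ∀ y, y ∉ hyperplaneProj e '' K → h y = 0)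
    (hle : ∀ x ∈ K, h (hyperplaneProj e x) ≤ G x) :
    ∫⁻ y, h y ≤
      ∫⁻ x in K, G x ∂(Measure.euclideanHausdorffMeasure (n - 1) : Measure (RSpace n)) := by
  set σ : Measure (RSpace n) := Measure.euclideanHausdorffMeasure (n - 1)
  set P := hyperplaneProj e with hP
  have hPm : Measurable P := P.continuous.measurable
  have hmeas : volume.restrict (P '' K) ≤ (σ.restrict K).map P := by
    refine Measure.le_iff.2 fun A hA => ?_
    rw [Measure.restrict_apply hA, Measure.map_apply hPm hA, Measure.restrict_apply (hPm hA)]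
    have hsub : A ∩ P '' K = P '' (P ⁻¹' A ∩ K) := by
      rw [image_preimage_inter]
    have hlip : LipschitzOnWith 1 P (P ⁻¹' A ∩ K) :=
      ((ℝ ∙ e)ᗮ.lipschitzWith_orthogonalProjectionOnto).lipschitzOnWith
    have := hlip.euclideanHausdorffMeasure_image_le (n - 1)
    rw [hyperplane_volume_eq hn he] at this
    rw [hsub]
    simpa using this
  -- The one-sided inequalities for indicators and image measures require measurability of neither
  -- `P '' K` nor `h`.
  calc ∫⁻ y, h y = ∫⁻ y, (P '' K).indicator h y := by
        congr 1; ext y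
        by_cases hy : y ∈ P '' K
        · rw [indicator_of_mem hy]
        · rw [indicator_of_notMem hy, h0 y hy]
    _ ≤ ∫⁻ y in P '' K, h y := lintegral_indicator_le _ _
    _ ≤ ∫⁻ y, h y ∂((σ.restrict K).map P) := lintegral_mono' hmeas le_rfl
    _ ≤ ∫⁻ x in K, h (P x) ∂σ := lintegral_map_le _ _
    _ ≤ ∫⁻ x in K, G x ∂σ := setLIntegral_mono' hK hle

/-- Tonelli's theorem for the splitting of space into the line spanned by e and its orthogonal
complement. -/
lemma lintegral_eq_lintegral_lines {e : RSpace n} (he : ‖e‖ = 1) {F : RSpace n → ENNReal}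
    (hF : Measurable F) :
    ∫⁻ x, F x = ∫⁻ y : (ℝ ∙ e)ᗮ, ∫⁻ s : ℝ, F ((y : RSpace n) + s • e) := by
  have hmp := ((ℝ ∙ e).measurePreserving_measurableEquivProd (0 : RSpace n))
  rw [InnerProductSpace.euclideanHausdorffMeasure_eq_volume] at hmp
  have h1 := (hmp.symm _).lintegral_comp_emb (MeasurableEquiv.measurableEmbedding _) F
  rw [← h1, Measure.volume_eq_prod, lintegral_prod_symm]
  · refine lintegral_congr fun y => ?_
    have h2 := (LinearIsometryEquiv.toSpanUnitSingleton (𝕜 := ℝ) e he).measurePreserving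
    rw [← h2.lintegral_comp_emb
      (LinearIsometryEquiv.toSpanUnitSingleton e he).toHomeomorph.measurableEmbedding]
    refine lintegral_congr fun s => ?_
    congr 1
    rw [Submodule.measurableEquivProd_symm_apply]
    simp [add_comm]
  · exact (hF.comp (MeasurableEquiv.measurable _)).aemeasurable

/-- The first time at which the path is outside Ω is a boundary point. -/
lemma exists_mem_frontier_of_path {X : Type*} [TopologicalSpace X] {Ω : Set X} (hΩ : IsOpen Ω)
    {z : ℝ → X} (hz : Continuous z) {b s : ℝ} (hs : s ∈ Icc 0 b) (h0 : z 0 ∈ Ω) (hsΩ : z s ∉ Ω) :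
    ∃ s ∈ Icc 0 b, z s ∈ frontier Ω := by
  have hcomp : IsCompact (Icc 0 b ∩ z ⁻¹' Ωᶜ) :=
    isCompact_Icc.inter_right (hΩ.isClosed_compl.preimage hz)
  obtain ⟨t, ht, hmin⟩ := hcomp.exists_isLeast ⟨s, hs, hsΩ⟩
  refine ⟨t, ht.1, ?_, by rw [hΩ.interior_eq]; exact ht.2⟩
  have ht0 : 0 < t := ht.1.1.lt_of_ne fun h => ht.2 (h ▸ h0)
  refine mem_closure_of_tendsto (hz.continuousWithinAt (s := Iio t)).tendsto ?_
  filter_upwards [Ioo_mem_nhdsLT ht0] with r hr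
  by_contra hrΩ
  exact absurd (hmin ⟨⟨hr.1.le, hr.2.le.trans ht.1.2⟩, hrΩ⟩) (not_le.2 hr.2)

end projection

/-- A boundary defining weight: `C¹` on `Ω̄`, positive in `Ω`, vanishing on `∂Ω`, with
nonvanishing differential on `∂Ω`. -/
structure IsBoundaryDefining {n : ℕ} (Ω : Set (RSpace n)) (u : RSpace n → ℝ) : Prop where
  contDiffOn : ContDiffOn ℝ 1 u (closure Ω)
  pos : ∀ x ∈ Ω, 0 < u x
  zero : ∀ x ∈ frontier Ω, u x = 0
  fderiv_ne : ∀ x ∈ frontier Ω, fderivWithin ℝ u (closure Ω) x ≠ 0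

namespace IsBoundaryDefining

variable {n : ℕ} {Ω : Set (RSpace n)} {u : RSpace n → ℝ}

lemma continuousOn_fderivWithin (hΩ : IsSmoothBoundedDomain Ω) (hu : ContDiffOn ℝ 1 u (closure Ω)) :
    ContinuousOn (fderivWithin ℝ u (closure Ω)) (closure Ω) :=
  hu.continuousOn_fderivWithin hΩ.uniqueDiffOn_closure le_rfl

/-- Growth of a boundary defining function along inward segments. -/
lemma mul_le_sub (hΩ : IsSmoothBoundedDomain Ω) (hu : IsBoundaryDefining Ω u) {e x : RSpace n}
    {c s : ℝ} (hs : 0 ≤ s) (hcl : ∀ r ∈ Icc 0 s, x + r • e ∈ closure Ω)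
    (hin : ∀ r ∈ Ioo 0 s, x + r • e ∈ Ω)
    (hc : ∀ r ∈ Ioo 0 s, c ≤ fderivWithin ℝ u (closure Ω) (x + r • e) e) :
    c * s ≤ u (x + s • e) - u x := by
  have hd : ∀ r ∈ Ioo 0 s, HasDerivAt (fun r : ℝ => u (x + r • e))
      (fderivWithin ℝ u (closure Ω) (x + r • e) e) r := fun r hr => by
    have hnhds : closure Ω ∈ 𝓝 (x + r • e) :=
      mem_of_superset (hΩ.isOpen.mem_nhds (hin r hr)) subset_closure
    have h1 := ((hu.contDiffOn.differentiableOn one_ne_zero _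
      (hcl r (Ioo_subset_Icc_self hr))).hasFDerivWithinAt).hasFDerivAt hnhds
    have h2 : HasDerivAt (fun r : ℝ => x + r • e) e r := by
      simpa using ((hasDerivAt_id r).smul_const e).const_add x
    exact h1.comp_hasDerivAt r h2
  have hcont : ContinuousOn (fun r : ℝ => u (x + r • e)) (Icc 0 s) :=
    hu.contDiffOn.continuousOn.comp (by fun_prop) hcl
  have := (convex_Icc 0 s).mul_sub_le_image_sub_of_le_deriv hcont
    (fun r hr => by
      rw [interior_Icc] at hr
      exact (hd r hr).differentiableAt.differentiableWithinAt)
    (C := c) (fun r hr => by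
      rw [interior_Icc] at hr
      rw [(hd r hr).deriv]
      exact hc r hr) 0 (left_mem_Icc.2 hs) s (right_mem_Icc.2 hs) hs
  simpa using this

/-- The product of `cutoffDeriv2 ε u` with the derivative of u along the line is the derivative of
`cutoffDeriv ε u`, which takes values in [0,1]. A line therefore meets the layer with total mass at
most 1, whatever ε is. -/
lemma lintegral_line_le (hΩ : IsSmoothBoundedDomain Ω) (hu : IsBoundaryDefining Ω u)
    {e x : RSpace n} {ε b M : ℝ} (hε : 0 < ε) (hb : 0 ≤ b) (hM : 0 ≤ M)
    (hcl : ∀ r ∈ Icc 0 b, x + r • e ∈ closure Ω) (hin : ∀ r ∈ Ioo 0 b, x + r • e ∈ Ω)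
    (he : ∀ r ∈ Icc 0 b, 0 ≤ fderivWithin ℝ u (closure Ω) (x + r • e) e)
    {F : ℝ → ENNReal} (hF0 : ∀ r ∉ Icc 0 b, F r = 0)
    (hF : ∀ r ∈ Icc 0 b, F r ≤ ENNReal.ofReal (M * (cutoffDeriv2 ε (u (x + r • e)) *
      fderivWithin ℝ u (closure Ω) (x + r • e) e))) :
    ∫⁻ r, F r ≤ ENNReal.ofReal M := by
  set f' : ℝ → ℝ := fun r => cutoffDeriv2 ε (u (x + r • e)) *
      fderivWithin ℝ u (closure Ω) (x + r • e) e
  have hline : Continuous fun r : ℝ => x + r • e := by fun_prop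
  have hucont : ContinuousOn (fun r : ℝ => u (x + r • e)) (Icc 0 b) :=
    hu.contDiffOn.continuousOn.comp hline.continuousOn hcl
  have hf' : ContinuousOn f' (Icc 0 b) := by
    refine ((continuous_cutoffDeriv2 ε).comp_continuousOn hucont).mul ?_
    exact ((continuousOn_fderivWithin hΩ hu.contDiffOn).comp hline.continuousOn hcl).clm_apply
      continuousOn_const
  have hf'0 : ∀ r ∈ Icc 0 b, 0 ≤ f' r := fun r hr =>
    mul_nonneg (cutoffDeriv2_nonneg hε _) (he r hr)
  have hint : ∫ r in (0 : ℝ)..b, f' r =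
      cutoffDeriv ε (u (x + b • e)) - cutoffDeriv ε (u (x + (0 : ℝ) • e)) := by
    refine intervalIntegral.integral_eq_sub_of_hasDerivAt_of_le
      (f := fun r => cutoffDeriv ε (u (x + r • e))) hb
      ((continuous_cutoffDeriv ε).comp_continuousOn hucont) (fun r hr => ?_)
      (hf'.intervalIntegrable_of_Icc hb)
    have hnhds : closure Ω ∈ 𝓝 (x + r • e) :=
      mem_of_superset (hΩ.isOpen.mem_nhds (hin r hr)) subset_closure
    have h1 := ((hu.contDiffOn.differentiableOn one_ne_zero _
      (hcl r (Ioo_subset_Icc_self hr))).hasFDerivWithinAt).hasFDerivAt hnhds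
    have h2 : HasDerivAt (fun r : ℝ => x + r • e) e r := by
      simpa using ((hasDerivAt_id r).smul_const e).const_add x
    exact (hasDerivAt_cutoffDeriv ε _).comp r (h1.comp_hasDerivAt r h2)
  have hint1 : ∫ r in Icc 0 b, f' r ≤ 1 := by
    rw [integral_Icc_eq_integral_Ioc, ← intervalIntegral.integral_of_le hb, hint]
    have := cutoffDeriv_le_one ε (u (x + b • e))
    have := cutoffDeriv_nonneg ε (u (x + (0 : ℝ) • e))
    linarith
  have hi : IntegrableOn f' (Icc 0 b) := hf'.integrableOn_Icc
  calc ∫⁻ r, F r = ∫⁻ r in Icc 0 b, F r := by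
        rw [← lintegral_indicator measurableSet_Icc]
        congr 1; ext r
        by_cases hr : r ∈ Icc 0 b
        · rw [indicator_of_mem hr]
        · rw [indicator_of_notMem hr, hF0 r hr]
    _ ≤ ∫⁻ r in Icc 0 b, ENNReal.ofReal (M * f' r) := setLIntegral_mono' measurableSet_Icc hF
    _ = ENNReal.ofReal (∫ r in Icc 0 b, M * f' r) := by
        rw [ofReal_integral_eq_lintegral_ofReal (hi.const_mul M)]
        exact (ae_restrict_iff' measurableSet_Icc).2
          (Eventually.of_forall fun r hr => mul_nonneg hM (hf'0 r hr))
    _ ≤ ENNReal.ofReal M := by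
        refine ENNReal.ofReal_le_ofReal ?_
        rw [integral_const_mul]
        exact mul_le_of_le_one_right hM hint1

/-- Integrate along lines parallel to the normal e at x₀. Near x₀ the derivative of u along e equals
|∇u| up to the factor 1+κ, so each line crosses the layer with mass at most 1+κ, multiplied by the
value of G|∇u| close to its foot on the boundary. Projecting the feet onto the hyperplane does not
increase surface measure. -/
lemma lintegral_layer_le_local (hn : 0 < n) (hΩ : IsSmoothBoundedDomain Ω)
    (hu : IsBoundaryDefining Ω u) {x₀ : RSpace n} (hx₀ : x₀ ∈ frontier Ω) {κ : ℝ} (hκ : 0 < κ) :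
    ∃ ρ > 0, ∀ G : RSpace n → ℝ, Continuous G → (∀ x, 0 ≤ G x) →
      (∀ x ∉ Metric.ball x₀ ρ, G x = 0) → ∀ κ' > 0, ∀ᶠ ε in 𝓝[>] 0,
        ∫⁻ x in Ω, ENNReal.ofReal (G x * cutoffDeriv2 ε (u x) *
          ‖fderivWithin ℝ u (closure Ω) x‖ ^ 2) ≤
        ∫⁻ x in frontier Ω, ENNReal.ofReal ((1 + κ) * (G x *
          ‖fderivWithin ℝ u (closure Ω) x‖) + κ')
          ∂(Measure.euclideanHausdorffMeasure (n - 1) : Measure (RSpace n)) := by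
  set D := fderivWithin ℝ u (closure Ω) with hD
  have hDcont : ContinuousOn D (closure Ω) := continuousOn_fderivWithin hΩ hu.contDiffOn
  have hx₀c : x₀ ∈ closure Ω := frontier_subset_closure hx₀
  obtain ⟨e, ρ₁, he, hρ₁, -, hside, hdir⟩ := hΩ.exists_normal hx₀
  have hDx₀ : D x₀ e = ‖D x₀‖ := by
    have := hdir u (D x₀) (hu.contDiffOn.differentiableOn one_ne_zero _ hx₀c).hasFDerivWithinAt
      (fun x hx => (hu.pos x hx).le) (hu.zero _ hx₀) e
    rw [this, real_inner_self_eq_norm_sq, he]; ring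
  have hDpos : 0 < ‖D x₀‖ := norm_pos_iff.2 (hu.fderiv_ne x₀ hx₀)
  set c := ‖D x₀‖ / 2 with hc
  have hcpos : 0 < c := half_pos hDpos
  have hDe : ContinuousOn (fun x => D x e) (closure Ω) := hDcont.clm_apply continuousOn_const
  have hev1 : ∀ᶠ x in 𝓝[closure Ω] x₀, c < D x e :=
    (hDe x₀ hx₀c).eventually (lt_mem_nhds (by simp only [hDx₀, hc]; linarith))
  have hev2 : ∀ᶠ x in 𝓝[closure Ω] x₀, ‖D x‖ < (1 + κ) * D x e :=
    (hDcont.norm x₀ hx₀c).eventually_lt ((hDe.const_mul (1 + κ)) x₀ hx₀c)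
      (by simp only [hDx₀]; nlinarith)
  obtain ⟨ρ₂, hρ₂, hball⟩ := Metric.mem_nhdsWithin_iff.1 (hev1.and hev2)
  set R := min ρ₁ ρ₂ with hR
  have hR0 : 0 < R := lt_min hρ₁ hρ₂
  have hR1 : Metric.ball x₀ R ⊆ Metric.ball x₀ ρ₁ := Metric.ball_subset_ball (min_le_left _ _)
  have hDc : ∀ x ∈ closure Ω, x ∈ Metric.ball x₀ R → c < D x e ∧ ‖D x‖ < (1 + κ) * D x e :=
    fun x hx hxR => hball ⟨Metric.ball_subset_ball (min_le_right _ _) hxR, hx⟩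
  have hnorm_smul : ∀ s : ℝ, ‖s • e‖ = |s| := fun s => by
    rw [norm_smul, he, mul_one, Real.norm_eq_abs]
  -- G is supported in the half ball, so displacements shorter than R/2 from its support stay where
  -- the derivative bounds hold.
  refine ⟨R / 2, half_pos hR0, fun G hG hG0 hGsupp κ' hκ' => ?_⟩
  set H : RSpace n → ℝ := fun x => (1 + κ) * (G x * ‖D x‖) with hH
  have hHcont : ContinuousOn H (closure Ω) :=
    (hG.continuousOn.mul hDcont.norm).const_mul (1 + κ)
  have hH0 : ∀ x, 0 ≤ H x := fun x => mul_nonneg (by positivity) (mul_nonneg (hG0 x) (norm_nonneg _))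
  obtain ⟨η, hη, hHη⟩ := Metric.uniformContinuousOn_iff.1
    (hΩ.isCompact_closure.uniformContinuousOn_of_continuous hHcont) κ' hκ'
  filter_upwards [Ioo_mem_nhdsGT (by positivity : 0 < c * min (R / 2) η / 2)] with ε hε'
  obtain ⟨hε, hεlt⟩ := hε'
  -- The layer is at most this wide in direction e: u grows at rate at least c there, and exceeds 2ε
  -- after length b.
  set b := 2 * ε / c with hb
  have hb0 : 0 < b := by positivity
  have hbmin : b < min (R / 2) η := by
    rw [hb, div_lt_iff₀ hcpos]; linarith
  have hbR : b < R / 2 := hbmin.trans_le (min_le_left _ _)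
  have hbη : b < η := hbmin.trans_le (min_le_right _ _)
  have hcb : c * b = 2 * ε := by rw [hb]; field_simp
  set F : RSpace n → ENNReal := Ω.indicator fun x =>
    ENNReal.ofReal (G x * cutoffDeriv2 ε (u x) * ‖D x‖ ^ 2) with hF
  have hFm : Measurable F := by
    classical
    rw [hF, ← piecewise_eq_indicator]
    refine ContinuousOn.measurable_piecewise ?_ continuousOn_const hΩ.isOpen.measurableSet
    refine ENNReal.continuous_ofReal.comp_continuousOn ?_
    refine (hG.continuousOn.mul ((continuous_cutoffDeriv2 ε).comp_continuousOn
      (hu.contDiffOn.continuousOn.mono subset_closure))).mul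
      ((hDcont.mono subset_closure).norm.pow 2)
  have hFne : ∀ x, F x ≠ 0 → x ∈ Ω ∧ x ∈ Metric.ball x₀ (R / 2) ∧ u x ≤ 2 * ε := fun x hx => by
    have hxΩ : x ∈ Ω := mem_of_indicator_ne_zero hx
    rw [hF, indicator_of_mem hxΩ] at hx
    refine ⟨hxΩ, ?_, ?_⟩
    · by_contra h
      exact hx (by rw [hGsupp x h]; simp)
    · by_contra! h
      exact hx (by rw [cutoffDeriv2_eq_zero_of_gt hε h]; simp)
  rw [← lintegral_indicator hΩ.isOpen.measurableSet, lintegral_eq_lintegral_lines he hFm]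
  have hKm : MeasurableSet (frontier Ω ∩ Metric.ball x₀ R) :=
    isClosed_frontier.measurableSet.inter measurableSet_ball
  refine (lintegral_le_of_hyperplaneProj hn he hKm
    (G := fun x => ENNReal.ofReal (H x + κ')) (fun y hy => ?_) fun x hx => ?_).trans
    (lintegral_mono_set inter_subset_left)
  · have hzero : ∀ s : ℝ, F ((y : RSpace n) + s • e) = 0 := by
      intro s
      by_contra hne
      obtain ⟨hxΩ, hxball, hux⟩ := hFne _ hne
      set x := (y : RSpace n) + s • e with hx
      have hyx : ∀ r : ℝ, hyperplaneProj e (x + r • e) = y := fun r => by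
        rw [hyperplaneProj_add_smul, hx, hyperplaneProj_add_smul]
        exact Submodule.orthogonalProjectionOnto_mem_subspace_eq_self y
      have hN : ∀ r ∈ Icc 0 b, x + (-r) • e ∈ Metric.ball x₀ R := fun r hr => by
        rw [Metric.mem_ball, dist_eq_norm] at hxball ⊢
        calc ‖x + (-r) • e - x₀‖ = ‖(x - x₀) + (-r) • e‖ := by congr 1; abel
          _ ≤ ‖x - x₀‖ + ‖(-r) • e‖ := norm_add_le _ _
          _ < R := by
            rw [hnorm_smul, abs_neg, abs_of_nonneg hr.1]
            linarith [hr.2]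
      -- Move back from the layer by the length b. Staying in Ω would force u > cb = 2ε at the
      -- starting point, which is impossible; leaving Ω produces a boundary point with the same
      -- projection.
      by_cases hall : ∀ r ∈ Icc 0 b, x + (-r) • e ∈ Ω
      · have hshift : ∀ r : ℝ, x + (-b) • e + r • e = x + (-(b - r)) • e := fun r => by
          rw [add_assoc, ← add_smul]; congr 2; ring
        have hmem : ∀ r ∈ Icc 0 b, x + (-b) • e + r • e ∈ Ω := fun r hr => by
          rw [hshift]
          exact hall _ ⟨by linarith [hr.2], by linarith [hr.1]⟩
        have h1 := hu.mul_le_sub hΩ hb0.le (x := x + (-b) • e) (e := e) (c := c)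
          (fun r hr => subset_closure (hmem r hr))
          (fun r hr => hmem r (Ioo_subset_Icc_self hr)) fun r hr => by
            have hr' := Ioo_subset_Icc_self hr
            refine (hDc _ (subset_closure (hmem r hr')) ?_).1.le
            rw [hshift]
            exact hN _ ⟨by linarith [hr.2], by linarith [hr.1]⟩
        rw [hshift, sub_self, neg_zero, zero_smul, add_zero, hcb] at h1
        have h2 := hu.pos _ (hall b ⟨hb0.le, le_rfl⟩)
        linarith
      · push Not at hall
        obtain ⟨r, hr, hrΩ⟩ := hall
        obtain ⟨t, ht, htf⟩ := exists_mem_frontier_of_path hΩ.isOpen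
          (z := fun r : ℝ => x + (-r) • e) (by fun_prop) hr (by simpa using hxΩ) hrΩ
        exact hy ⟨_, ⟨htf, hN t ht⟩, hyx _⟩
    simp [hzero]
  · have hPx : ((hyperplaneProj e x : (ℝ ∙ e)ᗮ) : RSpace n) = x + (-(inner ℝ e x : ℝ)) • e := by
      rw [← Submodule.starProjection_apply, Submodule.starProjection_orthogonal_val,
        Submodule.starProjection_unit_singleton ℝ he, neg_smul, sub_eq_add_neg]
    -- Translation invariance along the line moves its origin to the boundary point x.
    have htrans : ∫⁻ s : ℝ, F ((hyperplaneProj e x : RSpace n) + s • e) =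
        ∫⁻ s : ℝ, F (x + s • e) := by
      rw [← lintegral_add_right_eq_self (fun s : ℝ => F (x + s • e)) (-(inner ℝ e x : ℝ))]
      refine lintegral_congr fun s => ?_
      rw [hPx, add_assoc, ← add_smul, add_comm s]
    rw [htrans]
    have hball_mem : ∀ s : ℝ, x + s • e ∈ Metric.ball x₀ R → ∀ r ∈ Icc 0 s,
        x + r • e ∈ Metric.ball x₀ R := fun s hs r hr => by
      rcases hr.1.trans hr.2 |>.eq_or_lt with h0 | h0
      · have : r = 0 := le_antisymm (h0 ▸ hr.2) hr.1
        simpa [this] using hx.2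
      · have := (convex_ball x₀ R).add_smul_sub_mem hx.2 hs
          (t := r / s) ⟨div_nonneg hr.1 h0.le, (div_le_one h0).2 hr.2⟩
        rwa [add_sub_cancel_left, smul_smul, div_mul_cancel₀ _ h0.ne'] at this
    have hΩ_mem : ∀ s : ℝ, x + s • e ∈ Metric.ball x₀ R → 0 < s → x + s • e ∈ Ω := fun s hs hs0 =>
      (hside x ⟨hx.1, hR1 hx.2⟩ s (hR1 hs)).2 hs0
    have hcl_mem : ∀ s : ℝ, x + s • e ∈ Metric.ball x₀ R → 0 ≤ s → x + s • e ∈ closure Ω :=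
      fun s hs hs0 => by
        rcases hs0.eq_or_lt with h0 | h0
        · rw [← h0, zero_smul, add_zero]
          exact frontier_subset_closure hx.1
        · exact subset_closure (hΩ_mem s hs h0)
    have hrange : ∀ s : ℝ, F (x + s • e) ≠ 0 → s ∈ Icc 0 b := fun s hs => by
      obtain ⟨hsΩ, hsball, hus⟩ := hFne _ hs
      have hsR : x + s • e ∈ Metric.ball x₀ R := Metric.ball_subset_ball (by linarith) hsball
      have hs0 : 0 < s := (hside x ⟨hx.1, hR1 hx.2⟩ s (hR1 hsR)).1 hsΩ
      refine ⟨hs0.le, ?_⟩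
      have h1 := hu.mul_le_sub hΩ hs0.le (x := x) (e := e) (c := c)
        (fun r hr => hcl_mem r (hball_mem s hsR r hr) hr.1)
        (fun r hr => hΩ_mem r (hball_mem s hsR r (Ioo_subset_Icc_self hr)) hr.1)
        fun r hr => (hDc _ (hcl_mem r (hball_mem s hsR r (Ioo_subset_Icc_self hr)) hr.1.le)
          (hball_mem s hsR r (Ioo_subset_Icc_self hr))).1.le
      rw [hu.zero x hx.1, sub_zero] at h1
      have : c * s ≤ c * b := by linarith
      exact le_of_mul_le_mul_left this hcpos
    by_cases hzero : ∀ s : ℝ, F (x + s • e) = 0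
    · simp [hzero]
    push Not at hzero
    obtain ⟨s₁, hs₁⟩ := hzero
    have hs₁b := hrange s₁ hs₁
    have hmemR : ∀ r ∈ Icc 0 b, x + r • e ∈ Metric.ball x₀ R := fun r hr => by
      have h1 := (hFne _ hs₁).2.1
      rw [Metric.mem_ball, dist_eq_norm] at h1 ⊢
      calc ‖x + r • e - x₀‖ = ‖(x + s₁ • e - x₀) + (r - s₁) • e‖ := by
            congr 1; rw [sub_smul]; abel
        _ ≤ ‖x + s₁ • e - x₀‖ + ‖(r - s₁) • e‖ := norm_add_le _ _
        _ < R := by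
          rw [hnorm_smul]
          have : |r - s₁| ≤ b := abs_le.2 ⟨by linarith [hr.1, hs₁b.2], by linarith [hr.2, hs₁b.1]⟩
          linarith
    refine hu.lintegral_line_le hΩ hε hb0.le (by linarith [hH0 x])
      (fun r hr => hcl_mem r (hmemR r hr) hr.1)
      (fun r hr => hΩ_mem r (hmemR r (Ioo_subset_Icc_self hr)) hr.1)
      (fun r hr => hcpos.le.trans (hDc _ (hcl_mem r (hmemR r hr) hr.1) (hmemR r hr)).1.le)
      (fun r hr => by_contra fun h => hr (hrange r h)) fun r hr => ?_
    have hrcl := hcl_mem r (hmemR r hr) hr.1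
    refine (indicator_le_self' (fun _ _ => zero_le) _).trans (ENNReal.ofReal_le_ofReal ?_)
    have h1 := (hDc _ hrcl (hmemR r hr))
    have h2 : H (x + r • e) ≤ H x + κ' := by
      have := hHη _ hrcl x (frontier_subset_closure hx.1) (by
        rw [dist_eq_norm, add_sub_cancel_left, hnorm_smul, abs_of_nonneg hr.1]
        exact hr.2.trans_lt hbη)
      rw [Real.dist_eq] at this
      linarith [(abs_lt.1 this).2]
    have h3 := cutoffDeriv2_nonneg hε (u (x + r • e))
    have h4 : 0 ≤ D (x + r • e) e := hcpos.le.trans h1.1.le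
    -- Only one factor |∇u| is traded for the derivative along e, to produce an exact derivative;
    -- the other stays and becomes the surface density.
    calc G (x + r • e) * cutoffDeriv2 ε (u (x + r • e)) * ‖D (x + r • e)‖ ^ 2
        = (cutoffDeriv2 ε (u (x + r • e)) * (G (x + r • e) * ‖D (x + r • e)‖)) *
          ‖D (x + r • e)‖ := by ring
      _ ≤ (cutoffDeriv2 ε (u (x + r • e)) * (G (x + r • e) * ‖D (x + r • e)‖)) *
          ((1 + κ) * D (x + r • e) e) :=
          mul_le_mul_of_nonneg_left h1.2.le
            (mul_nonneg h3 (mul_nonneg (hG0 _) (norm_nonneg _)))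
      _ = H (x + r • e) * (cutoffDeriv2 ε (u (x + r • e)) * D (x + r • e) e) := by
          rw [hH]; ring
      _ ≤ _ := mul_le_mul_of_nonneg_right h2 (mul_nonneg h3 h4)

lemma integrableOn_frontier (hn : 0 < n) (hΩ : IsSmoothBoundedDomain Ω) {f : RSpace n → ℝ}
    (hf : ContinuousOn f (frontier Ω)) :
    IntegrableOn f (frontier Ω)
      (Measure.euclideanHausdorffMeasure (n - 1) : Measure (RSpace n)) := by
  obtain ⟨C, hC⟩ := hΩ.isCompact_frontier.exists_bound_of_continuousOn hf
  exact IntegrableOn.of_bound (hΩ.euclideanHausdorffMeasure_frontier_lt_top hn)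
    (hf.aestronglyMeasurable isClosed_frontier.measurableSet) C
    ((ae_restrict_iff' isClosed_frontier.measurableSet).2 (Eventually.of_forall hC))

/-- Boundary layer integrals are asymptotically dominated by surface integrals. -/
theorem eventually_integral_layer_le (hn : 0 < n) (hΩ : IsSmoothBoundedDomain Ω)
    (hu : IsBoundaryDefining Ω u) {G : RSpace n → ℝ} (hG : Continuous G) (hG0 : ∀ x, 0 ≤ G x)
    {κ : ℝ} (hκ : 0 < κ) : ∀ᶠ ε in 𝓝[>] 0,
      ∫ x in Ω, G x * cutoffDeriv2 ε (u x) * ‖fderivWithin ℝ u (closure Ω) x‖ ^ 2 ≤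
        (∫ x in frontier Ω, G x * ‖fderivWithin ℝ u (closure Ω) x‖
          ∂(Measure.euclideanHausdorffMeasure (n - 1) : Measure (RSpace n))) + κ := by
  set D := fderivWithin ℝ u (closure Ω) with hD
  have hDcont : ContinuousOn D (closure Ω) := continuousOn_fderivWithin hΩ hu.contDiffOn
  set σ : Measure (RSpace n) := Measure.euclideanHausdorffMeasure (n - 1) with hσ
  have hσfin : σ (frontier Ω) < ⊤ := hΩ.euclideanHausdorffMeasure_frontier_lt_top hn
  set m := σ.real (frontier Ω) with hm
  have hm0 : 0 ≤ m := measureReal_nonneg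
  set B := ∫ x in frontier Ω, G x * ‖D x‖ ∂σ with hB
  have hB0 : 0 ≤ B := integral_nonneg fun x => mul_nonneg (hG0 x) (norm_nonneg _)
  -- The relative error κ₁ and the additive error κ' below are tuned so that each contributes at
  -- most κ/2.
  set κ₁ := κ / (2 * (B + 1)) with hκ₁
  have hκ₁0 : 0 < κ₁ := by positivity
  have hloc := fun x₀ (hx₀ : x₀ ∈ frontier Ω) => hu.lintegral_layer_le_local hn hΩ hx₀ hκ₁0
  choose! ρ hρ hlocal using hloc
  obtain ⟨t, htf, ht⟩ := hΩ.isCompact_frontier.elim_nhds_subcover (fun x => Metric.ball x (ρ x))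
    fun x hx => Metric.ball_mem_nhds x (hρ x hx)
  set N := t.card
  set pt : Fin N → RSpace n := fun i => (t.equivFin.symm i : RSpace n)
  have hpt : ∀ i, pt i ∈ frontier Ω := fun i => htf _ (t.equivFin.symm i).2
  have hcover : frontier Ω ⊆ ⋃ i, Metric.ball (pt i) (ρ (pt i)) := fun x hx => by
    obtain ⟨y, hy, hxy⟩ : ∃ y ∈ t, x ∈ Metric.ball y (ρ y) := by simpa using ht hx
    exact mem_iUnion.2 ⟨t.equivFin ⟨y, hy⟩, by simpa [pt] using hxy⟩
  -- The partition of unity must sum to 1 on a neighbourhood of the boundary, not only on the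
  -- boundary, since the layers lie inside Ω.
  obtain ⟨L, hL, hfL, hLU⟩ := exists_compact_between hΩ.isCompact_frontier
    (isOpen_iUnion fun i => Metric.isOpen_ball) hcover
  obtain ⟨θ, hθs, hθ1, hθ01, -⟩ := exists_continuous_sum_one_of_isOpen_isCompact
    (fun i => Metric.isOpen_ball (x := pt i) (ε := ρ (pt i))) hL hLU
  have hθ1' : ∀ x ∈ L, ∑ i, θ i x = 1 := fun x hx => by simpa using hθ1 hx
  have hθ0 : ∀ i x, 0 ≤ θ i x := fun i x => (hθ01 i x).1
  set κ' := κ / (2 * (N * m + 1)) with hκ'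
  have hκ'0 : 0 < κ' := by positivity
  have hev : ∀ᶠ ε in 𝓝[>] (0 : ℝ), ∀ i : Fin N, _ := eventually_all.2 fun i =>
    hlocal (pt i) (hpt i) (fun x => G x * θ i x) (hG.mul (θ i).continuous)
      (fun x => mul_nonneg (hG0 x) (hθ0 i x))
      (fun x hx => by
        rw [image_eq_zero_of_notMem_tsupport fun h => hx (hθs i h), mul_zero]) κ' hκ'0
  -- By compactness u is bounded below away from the boundary, so layers with 2ε < a lie in `L`.
  obtain ⟨a, ha, hau⟩ : ∃ a, 0 < a ∧ ∀ x ∈ closure Ω \ interior L, a ≤ u x := by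
    refine (hΩ.isCompact_closure.diff isOpen_interior).exists_forall_le'
      (hu.contDiffOn.continuousOn.mono sdiff_subset) fun x hx => ?_
    rcases hΩ.closure_diff hx.1 with h | h
    · exact hu.pos x h
    · exact absurd (hfL h) hx.2
  filter_upwards [hev, Ioo_mem_nhdsGT (half_pos ha)] with ε hloc hε
  have hlayer : ∀ x ∈ Ω, u x ≤ 2 * ε → x ∈ L := fun x hx hux => by
    by_contra hxL
    have := hau x ⟨subset_closure hx, fun h => hxL (interior_subset h)⟩
    linarith [hε.2]
  set F : RSpace n → ℝ := fun x => G x * cutoffDeriv2 ε (u x) * ‖D x‖ ^ 2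
  have hcontF : ∀ G : RSpace n → ℝ, Continuous G →
      ContinuousOn (fun x => G x * cutoffDeriv2 ε (u x) * ‖D x‖ ^ 2) Ω := fun G hG =>
    (hG.continuousOn.mul ((continuous_cutoffDeriv2 ε).comp_continuousOn
      (hu.contDiffOn.continuousOn.mono subset_closure))).mul
      ((hDcont.mono subset_closure).norm.pow 2)
  have hF0 : ∀ x, 0 ≤ F x := fun x =>
    mul_nonneg (mul_nonneg (hG0 x) (cutoffDeriv2_nonneg hε.1 _)) (by positivity)
  have hbd : ∀ i, IntegrableOn (fun x => (1 + κ₁) * (G x * θ i x * ‖D x‖) + κ') (frontier Ω) σ :=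
    fun i => integrableOn_frontier hn hΩ (by
      have h1 := (hDcont.mono (frontier_subset_closure)).norm
      have h2 := (θ i).continuous.continuousOn (s := frontier Ω)
      have h3 := hG.continuousOn (s := frontier Ω)
      fun_prop)
  have hsum : ∑ i, ∫ x in frontier Ω, ((1 + κ₁) * (G x * θ i x * ‖D x‖) + κ') ∂σ =
      (1 + κ₁) * B + N * κ' * m := by
    rw [← integral_finsetSum _ fun i _ => hbd i]
    have : ∀ x ∈ frontier Ω, ∑ i, ((1 + κ₁) * (G x * θ i x * ‖D x‖) + κ') =
        (1 + κ₁) * (G x * ‖D x‖) + N * κ' := fun x hx => by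
      rw [Finset.sum_add_distrib, Finset.sum_const, Finset.card_univ, Fintype.card_fin,
        nsmul_eq_mul]
      congr 1
      calc ∑ i, (1 + κ₁) * (G x * θ i x * ‖D x‖) =
            ((1 + κ₁) * (G x * ‖D x‖)) * ∑ i, θ i x := by
              rw [Finset.mul_sum]; exact Finset.sum_congr rfl fun i _ => by ring
        _ = _ := by rw [hθ1' x (interior_subset (hfL hx)), mul_one]
    rw [setIntegral_congr_fun isClosed_frontier.measurableSet this, integral_add]
    · rw [integral_const_mul, setIntegral_const, smul_eq_mul]
      ring
    · exact (integrableOn_frontier hn hΩ (hG.continuousOn.mul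
        (hDcont.mono frontier_subset_closure).norm)).const_mul _
    · exact integrableOn_const hσfin.ne
  have hlint : ∫⁻ x in Ω, ENNReal.ofReal (F x) ≤ ENNReal.ofReal (B + κ) := by
    calc ∫⁻ x in Ω, ENNReal.ofReal (F x)
        ≤ ∫⁻ x in Ω, ∑ i, ENNReal.ofReal (G x * θ i x * cutoffDeriv2 ε (u x) * ‖D x‖ ^ 2) := by
          refine setLIntegral_mono' hΩ.isOpen.measurableSet fun x hx => ?_
          rw [← ENNReal.ofReal_sum_of_nonneg fun i _ => mul_nonneg (mul_nonneg
            (mul_nonneg (hG0 x) (hθ0 i x)) (cutoffDeriv2_nonneg hε.1 _)) (by positivity)]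
          refine ENNReal.ofReal_le_ofReal (le_of_eq ?_)
          by_cases hux : u x ≤ 2 * ε
          · calc F x = F x * ∑ i, θ i x := by rw [hθ1' x (hlayer x hx hux), mul_one]
              _ = _ := by rw [Finset.mul_sum]; exact Finset.sum_congr rfl fun i _ => by ring
          · simp [F, cutoffDeriv2_eq_zero_of_gt hε.1 (not_le.1 hux)]
      _ = ∑ i, ∫⁻ x in Ω, ENNReal.ofReal (G x * θ i x * cutoffDeriv2 ε (u x) * ‖D x‖ ^ 2) := by
          refine lintegral_finsetSum' _ fun i _ => ?_
          exact ((hcontF (fun x => G x * θ i x) (hG.mul (θ i).continuous)).aemeasurable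
            hΩ.isOpen.measurableSet).ennreal_ofReal
      _ ≤ ∑ i, ∫⁻ x in frontier Ω,
            ENNReal.ofReal ((1 + κ₁) * (G x * θ i x * ‖D x‖) + κ') ∂σ :=
          Finset.sum_le_sum fun i _ => hloc i
      _ = ∑ i, ENNReal.ofReal
            (∫ x in frontier Ω, ((1 + κ₁) * (G x * θ i x * ‖D x‖) + κ') ∂σ) := by
          refine Finset.sum_congr rfl fun i _ => ?_
          rw [ofReal_integral_eq_lintegral_ofReal (hbd i)]
          exact Eventually.of_forall fun x => add_nonneg (mul_nonneg (by positivity)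
            (mul_nonneg (mul_nonneg (hG0 x) (hθ0 i x)) (norm_nonneg _))) hκ'0.le
      _ = ENNReal.ofReal ((1 + κ₁) * B + N * κ' * m) := by
          rw [← hsum, ENNReal.ofReal_sum_of_nonneg]
          exact fun i _ => integral_nonneg fun x => add_nonneg (mul_nonneg (by positivity)
            (mul_nonneg (mul_nonneg (hG0 x) (hθ0 i x)) (norm_nonneg _))) hκ'0.le
      _ ≤ ENNReal.ofReal (B + κ) := by
          refine ENNReal.ofReal_le_ofReal ?_
          have h1 : κ₁ * B ≤ κ / 2 := by
            rw [hκ₁, div_mul_eq_mul_div, div_le_div_iff₀ (by positivity) two_pos]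
            nlinarith
          have h2 : N * κ' * m ≤ κ / 2 := by
            rw [hκ', mul_div_assoc', div_mul_eq_mul_div, div_le_div_iff₀ (by positivity) two_pos]
            nlinarith
          linarith
  rw [integral_eq_lintegral_of_nonneg_ae (Eventually.of_forall hF0)
    ((hcontF G hG).aestronglyMeasurable hΩ.isOpen.measurableSet)]
  exact ENNReal.toReal_le_of_le_ofReal (by positivity) hlint

end IsBoundaryDefining

/-! ### The weighted energy inequality at a fixed time -/

section coordinates

variable {n : ℕ}

/-- The `i`-th partial derivative. -/
noncomputable def pderiv (i : Fin n) (f : RSpace n → ℝ) (x : RSpace n) : ℝ :=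
  fderiv ℝ f x (EuclideanSpace.single i 1)

lemma partialWithin_eq_pderiv {s : Set (RSpace n)} {x : RSpace n} (hs : s ∈ 𝓝 x) (i : Fin n)
    (f : RSpace n → ℝ) : partialWithin i f s x = pderiv i f x := by
  rw [partialWithin, fderivWithin_of_mem_nhds hs, pderiv]

lemma divWithin_eq_sum {s : Set (RSpace n)} {x : RSpace n} (hs : s ∈ 𝓝 x)
    (F : RSpace n → RSpace n) : divWithin F s x = ∑ i, pderiv i (fun y => F y i) x :=
  Finset.sum_congr rfl fun i _ => partialWithin_eq_pderiv hs i _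

lemma gradient_coord (f : RSpace n → ℝ) (x : RSpace n) (i : Fin n) :
    gradient f x i = pderiv i f x := by
  have h : inner ℝ (gradient f x) (EuclideanSpace.single i (1 : ℝ)) = pderiv i f x := by
    rw [gradient, InnerProductSpace.toDual_symm_apply, pderiv]
  rw [← h, EuclideanSpace.inner_single_right]
  simp

lemma inner_gradient_eq_sum (v : RSpace n) (f : RSpace n → ℝ) (x : RSpace n) :
    inner ℝ v (gradient f x) = ∑ i, v i * pderiv i f x := by
  rw [PiLp.inner_apply]
  refine Finset.sum_congr rfl fun i _ => ?_
  rw [gradient_coord]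
  simp [mul_comm]

lemma sum_pderiv_sq (f : RSpace n → ℝ) (x : RSpace n) :
    ∑ i, pderiv i f x ^ 2 = ‖fderiv ℝ f x‖ ^ 2 := by
  have : ‖gradient f x‖ = ‖fderiv ℝ f x‖ := by rw [gradient, LinearIsometryEquiv.norm_map]
  rw [← this, EuclideanSpace.norm_sq_eq]
  exact Finset.sum_congr rfl fun i _ => by rw [gradient_coord, Real.norm_eq_abs, sq_abs]

lemma ContDiffOn.pderiv_of_isOpen {Ω : Set (RSpace n)} (hΩ : IsOpen Ω) {f : RSpace n → ℝ}
    {k l : WithTop ℕ∞} (hf : ContDiffOn ℝ k f Ω) (hl : l + 1 ≤ k) (i : Fin n) :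
    ContDiffOn ℝ l (pderiv i f) Ω :=
  (hf.fderiv_of_isOpen hΩ hl).clm_apply contDiffOn_const

lemma ContDiffOn.coord {E : Type*} [NormedAddCommGroup E] [NormedSpace ℝ E] {s : Set E}
    {k : WithTop ℕ∞} {F : E → RSpace n} (hF : ContDiffOn ℝ k F s) (i : Fin n) :
    ContDiffOn ℝ k (fun x => F x i) s :=
  (EuclideanSpace.proj (𝕜 := ℝ) i).contDiff.comp_contDiffOn hF

/-- The integral of a partial derivative of a compactly supported function vanishes. -/
lemma setIntegral_pderiv_eq_zero {Ω K : Set (RSpace n)} (hΩ : IsOpen Ω) (hK : IsCompact K)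
    (hKΩ : K ⊆ Ω) {F : RSpace n → ℝ} (hF : ContDiffOn ℝ 1 F Ω) (hF0 : ∀ x ∈ Ω, x ∉ K → F x = 0)
    (i : Fin n) : ∫ x in K, pderiv i F x = 0 := by
  set G := Ω.indicator F with hG
  have hGΩ : ∀ x ∈ Ω, G =ᶠ[𝓝 x] F := fun x hx => by
    filter_upwards [hΩ.mem_nhds hx] with y hy using indicator_of_mem hy _
  have hGK0 : ∀ x ∉ K, G x = 0 := fun x hx => by
    by_cases hxΩ : x ∈ Ω
    · rw [hG, indicator_of_mem hxΩ, hF0 x hxΩ hx]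
    · rw [hG, indicator_of_notMem hxΩ]
  have hGK : ∀ x ∉ K, G =ᶠ[𝓝 x] fun _ => 0 := fun x hx => by
    filter_upwards [hK.isClosed.isOpen_compl.mem_nhds hx] with y hy using hGK0 y hy
  have hGC : ContDiff ℝ 1 G := contDiff_iff_contDiffAt.2 fun x => by
    by_cases hx : x ∈ K
    · exact (hF.contDiffAt (hΩ.mem_nhds (hKΩ hx))).congr_of_eventuallyEq (hGΩ x (hKΩ hx))
    · exact contDiffAt_const.congr_of_eventuallyEq (hGK x hx)
  have hsupp : HasCompactSupport G := HasCompactSupport.intro hK hGK0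
  have hd0 : ∀ x ∉ K, pderiv i G x = 0 := fun x hx => by
    rw [pderiv, (hGK x hx).fderiv_eq]; simp
  have hint : Integrable (pderiv i G) :=
    ((hGC.continuous_fderiv one_ne_zero).clm_apply continuous_const).integrable_of_hasCompactSupport
      (HasCompactSupport.intro hK hd0)
  have h0 : ∫ x, pderiv i G x = 0 := by
    have := integral_mul_fderiv_eq_neg_fderiv_mul_of_integrable (μ := volume)
      (f := fun _ : RSpace n => (1 : ℝ)) (g := G) (v := EuclideanSpace.single i 1)
      (by simp) (by simpa using (show Integrable (fun x => fderiv ℝ G x (EuclideanSpace.single i 1)) volume from hint))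
      (by simpa using hGC.continuous.integrable_of_hasCompactSupport hsupp)
      (fun x _ => by fun_prop) (fun x _ => (hGC.differentiable one_ne_zero) x)
    simpa [pderiv] using this
  rw [← h0, ← setIntegral_eq_integral_of_forall_compl_eq_zero hd0]
  refine setIntegral_congr_fun hK.measurableSet fun x hx => ?_
  simp only [pderiv, (hGΩ x (hKΩ hx)).fderiv_eq]

end coordinates

/-- The derivative of the flux used in the weighted energy identity. -/
lemma fderiv_flux {E : Type*} [NormedAddCommGroup E] [NormedSpace ℝ E] {ε τ : ℝ} (hτ : 0 < τ)
    {u W P Q b γ m : E → ℝ} {x : E} (v : E) (hu : DifferentiableAt ℝ u x)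
    (hW : DifferentiableAt ℝ W x) (hP : DifferentiableAt ℝ P x) (hQ : DifferentiableAt ℝ Q x)
    (hb : DifferentiableAt ℝ b x) (hγ : DifferentiableAt ℝ γ x) (hm : DifferentiableAt ℝ m x) :
    fderiv ℝ (fun y => cutoff ε (u y) * softSign τ (W y) * P y
        - softAbs τ (W y) * cutoffDeriv ε (u y) * Q y - softAbs τ (W y) * cutoff ε (u y) * b y
        - γ y * cutoff ε (u y) * softSign τ (W y) * m y) x v =
      (cutoffDeriv ε (u x) * fderiv ℝ u x v * softSign τ (W x) * P x
        + cutoff ε (u x) * (softDirac τ (W x) * fderiv ℝ W x v) * P x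
        + cutoff ε (u x) * softSign τ (W x) * fderiv ℝ P x v)
      - (softSign τ (W x) * fderiv ℝ W x v * cutoffDeriv ε (u x) * Q x
        + softAbs τ (W x) * (cutoffDeriv2 ε (u x) * fderiv ℝ u x v) * Q x
        + softAbs τ (W x) * cutoffDeriv ε (u x) * fderiv ℝ Q x v)
      - (softSign τ (W x) * fderiv ℝ W x v * cutoff ε (u x) * b x
        + softAbs τ (W x) * (cutoffDeriv ε (u x) * fderiv ℝ u x v) * b x
        + softAbs τ (W x) * cutoff ε (u x) * fderiv ℝ b x v)
      - (fderiv ℝ γ x v * cutoff ε (u x) * softSign τ (W x) * m x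
        + γ x * (cutoffDeriv ε (u x) * fderiv ℝ u x v) * softSign τ (W x) * m x
        + γ x * cutoff ε (u x) * (softDirac τ (W x) * fderiv ℝ W x v) * m x
        + γ x * cutoff ε (u x) * softSign τ (W x) * fderiv ℝ m x v) := by
  have hZ : HasFDerivAt (fun y => cutoff ε (u y)) (cutoffDeriv ε (u x) • fderiv ℝ u x) x :=
    (hasDerivAt_cutoff ε (u x)).comp_hasFDerivAt x hu.hasFDerivAt
  have hZ' : HasFDerivAt (fun y => cutoffDeriv ε (u y)) (cutoffDeriv2 ε (u x) • fderiv ℝ u x) x :=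
    (hasDerivAt_cutoffDeriv ε (u x)).comp_hasFDerivAt x hu.hasFDerivAt
  have hR : HasFDerivAt (fun y => softAbs τ (W y)) (softSign τ (W x) • fderiv ℝ W x) x :=
    (hasDerivAt_softAbs hτ (W x)).comp_hasFDerivAt x hW.hasFDerivAt
  have hR' : HasFDerivAt (fun y => softSign τ (W y)) (softDirac τ (W x) • fderiv ℝ W x) x :=
    (hasDerivAt_softSign hτ (W x)).comp_hasFDerivAt x hW.hasFDerivAt
  have h := ((((hZ.fun_mul hR').fun_mul hP.hasFDerivAt).fun_sub
    ((hR.fun_mul hZ').fun_mul hQ.hasFDerivAt)).fun_sub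
    ((hR.fun_mul hZ).fun_mul hb.hasFDerivAt)).fun_sub
    (((hγ.hasFDerivAt.fun_mul hZ).fun_mul hR').fun_mul hm.hasFDerivAt)
  rw [h.fderiv]
  simp only [sub_apply, add_apply, smul_apply, smul_eq_mul]
  ring

/-- The pointwise estimate behind the weighted energy inequality. -/
lemma energy_pointwise {ζ χ₁ χ₂ ρ ρ₁ ρ₂ k u W A LU Su SW dB c h f γ Sum dM SWm μ lam₁ lam₂ κ M Γ C C'
    ε τ : ℝ} (hζ : 0 ≤ ζ) (hχ₁ : 0 ≤ χ₁) (hχ₁' : χ₁ ≤ 1) (hχ₂ : 0 ≤ χ₂) (hζu : ζ ≤ u * χ₁)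
    (huζ : u * χ₁ ≤ ζ + 2 * ε) (hρ : 0 ≤ ρ) (hρW : ρ ≤ |W|) (hρ₁ : ρ₁ = W * k) (hk : 0 ≤ k)
    (hρ₁' : |ρ₁| ≤ 1) (hρ₂ : 0 ≤ ρ₂) (hWρ : ρ ≤ W * ρ₁) (hWρ' : W * ρ₁ ≤ ρ + τ) (hWM : |W| ≤ M)
    (hA : 0 ≤ A) (hSW : 0 ≤ SW) (hSu : 0 ≤ Su) (hlam₁ : 0 ≤ lam₁) (hκ : 0 ≤ κ)
    (hLU : LU ≤ -(lam₁ * u) + κ) (hlam₂ : lam₂ ≤ c - dB - μ) (hh : -h * W ≤ μ * W ^ 2)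
    (hg : γ * W * (Sum + u * dM) ≤ κ * |W|) (hΓ : |γ * dM| ≤ Γ) (hC : ζ * |c - μ| ≤ C)
    (hC' : |γ * ζ * SWm| ≤ C' * |W|) :
    -(A * ζ * ρ₂ * SW) + χ₁ * ρ * LU + A * ρ * χ₂ * Su + ρ * ζ * dB - ζ * ρ₁ * (c * W + h - f)
      + γ * ρ₁ * (χ₁ * Sum + ζ * dM) + γ * ζ * ρ₂ * SWm ≤
    -((lam₁ + lam₂) * (ζ * ρ)) + (ζ * |f| + A * |W| * (χ₂ * Su) + κ * (M + 1) + 2 * ε * Γ + C * τ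
      + C' * (|W| * ρ₂)) := by
  have h1 : 0 ≤ A * ζ * ρ₂ * SW := by positivity
  have h2 : χ₁ * ρ * LU ≤ -(lam₁ * (ζ * ρ)) + κ * M := by
    have e1 : χ₁ * ρ * LU ≤ χ₁ * ρ * (-(lam₁ * u) + κ) :=
      mul_le_mul_of_nonneg_left hLU (mul_nonneg hχ₁ hρ)
    have e2 : lam₁ * ρ * ζ ≤ lam₁ * ρ * (u * χ₁) :=
      mul_le_mul_of_nonneg_left hζu (mul_nonneg hlam₁ hρ)
    have e3 : χ₁ * ρ ≤ M := (mul_le_of_le_one_left hρ hχ₁').trans (hρW.trans hWM)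
    have e4 := mul_le_mul_of_nonneg_left e3 hκ
    linarith
  have h3 : A * ρ * χ₂ * Su ≤ A * |W| * (χ₂ * Su) := by
    have := mul_le_mul_of_nonneg_left hρW (mul_nonneg hA (mul_nonneg hχ₂ hSu))
    linarith
  -- The regularised sign is W times a nonnegative factor k, so the one-sided condition on hW may be
  -- multiplied by ζk.
  have h4 : -(ζ * ρ₁ * h) ≤ ζ * (μ * (W * ρ₁)) := by
    have := mul_le_mul_of_nonneg_left hh (mul_nonneg hζ hk)
    rw [hρ₁]
    linarith
  have h5 : ζ * ρ₁ * f ≤ ζ * |f| := by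
    have e1 : ρ₁ * f ≤ |f| := by
      calc ρ₁ * f ≤ |ρ₁ * f| := le_abs_self _
        _ = |ρ₁| * |f| := abs_mul _ _
        _ ≤ |f| := mul_le_of_le_one_left (abs_nonneg f) hρ₁'
    have := mul_le_mul_of_nonneg_left e1 hζ
    linarith
  -- The term with div b carries ρ while the reaction carries Wρ₁; exchanging them costs at most τ
  -- times |c-μ|.
  have h6 : ρ * ζ * dB - ζ * (c - μ) * (W * ρ₁) ≤ -(lam₂ * (ζ * ρ)) + C * τ := by
    have e1 : |c - μ| * (W * ρ₁ - ρ) ≤ |c - μ| * τ :=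
      mul_le_mul_of_nonneg_left (by linarith) (abs_nonneg _)
    have e2 : -(c - μ) * (W * ρ₁ - ρ) ≤ |c - μ| * (W * ρ₁ - ρ) :=
      mul_le_mul_of_nonneg_right (neg_le_abs _) (by linarith)
    have e3 := mul_le_mul_of_nonneg_left (e2.trans e1) hζ
    have e4 : ζ * |c - μ| * τ ≤ C * τ := mul_le_mul_of_nonneg_right hC (by linarith)
    have e5 := mul_le_mul_of_nonneg_left hlam₂ (mul_nonneg hζ hρ)
    linarith
  -- The structure condition concerns div(um) = ∇u·m + u div m, whereas truncation gives χ₁∇u·m + ζ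
  -- div m. Replacing ζ by uχ₁ costs 2εΓ.
  have h7 : γ * ρ₁ * (χ₁ * Sum + ζ * dM) ≤ κ + 2 * ε * Γ := by
    have e1 : γ * ρ₁ * (Sum + u * dM) ≤ κ := by
      have := mul_le_mul_of_nonneg_right hg hk
      have e : |W| * k = |ρ₁| := by rw [hρ₁, abs_mul, abs_of_nonneg hk]
      calc γ * ρ₁ * (Sum + u * dM) = γ * W * (Sum + u * dM) * k := by rw [hρ₁]; ring
        _ ≤ κ * |W| * k := this
        _ = κ * |ρ₁| := by rw [mul_assoc, e]
        _ ≤ κ := mul_le_of_le_one_right hκ hρ₁'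
    have e2 : χ₁ * (γ * ρ₁ * (Sum + u * dM)) ≤ κ :=
      (mul_le_mul_of_nonneg_left e1 hχ₁).trans (mul_le_of_le_one_left hκ hχ₁')
    have e3 : γ * dM * ρ₁ * (ζ - u * χ₁) ≤ Γ * (2 * ε) := by
      calc γ * dM * ρ₁ * (ζ - u * χ₁) ≤ |γ * dM * ρ₁ * (ζ - u * χ₁)| := le_abs_self _
        _ = |γ * dM| * |ρ₁| * |ζ - u * χ₁| := by rw [abs_mul, abs_mul (γ * dM)]
        _ ≤ Γ * 1 * (2 * ε) := by
          have : |ζ - u * χ₁| ≤ 2 * ε := abs_le.2 ⟨by linarith, by linarith⟩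
          have hΓ0 : 0 ≤ Γ := (abs_nonneg _).trans hΓ
          gcongr
        _ = _ := by ring
    linarith
  have h8 : γ * ζ * ρ₂ * SWm ≤ C' * (|W| * ρ₂) := by
    have := mul_le_mul_of_nonneg_right ((le_abs_self _).trans hC') hρ₂
    linarith
  linarith

section energy

variable {n : ℕ}

/-- The weighted energy inequality at a fixed time; the coefficients and the solution are functions
of the space variable. -/
theorem setIntegral_energy_le {Ω K : Set (RSpace n)} (hΩ : IsOpen Ω) (hK : IsCompact K)
    (hKΩ : K ⊆ Ω) {u W A γ wt c h f μ : RSpace n → ℝ} {b m : RSpace n → RSpace n}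
    {lam₁ lam₂ κ M Γ C C' ε τ : ℝ} (hε : 0 < ε) (hτ : 0 < τ)
    (hu : ContDiffOn ℝ 2 u Ω) (hW : ContDiffOn ℝ 2 W Ω) (hA : ContDiffOn ℝ 1 A Ω)
    (hγ : ContDiffOn ℝ 1 γ Ω) (hb : ContDiffOn ℝ 1 b Ω) (hm : ContDiffOn ℝ 1 m Ω)
    (hwt : ContinuousOn wt K) (hf : ContinuousOn f K)
    (hu0 : ∀ x ∈ Ω, 0 ≤ u x) (huK : ∀ x ∈ Ω, x ∉ K → u x < ε)
    (hpde : ∀ x ∈ K, wt x - ∑ i, pderiv i (fun y => A y * pderiv i W y) x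
      + ∑ i, b x i * pderiv i W x + c x * W x + (h x + ∑ i, m x i * pderiv i γ x) = f x)
    (hA0 : ∀ x ∈ K, 0 ≤ A x) (hlam₁ : 0 ≤ lam₁) (hκ : 0 ≤ κ) (hWM : ∀ x ∈ K, |W x| ≤ M)
    (hLU : ∀ x ∈ K, ∑ i, pderiv i (fun y => A y * pderiv i u y) x + ∑ i, b x i * pderiv i u x
      ≤ -(lam₁ * u x) + κ)
    (hlam₂ : ∀ x ∈ K, lam₂ ≤ c x - ∑ i, pderiv i (fun y => b y i) x - μ x)
    (hh : ∀ x ∈ K, -h x * W x ≤ μ x * W x ^ 2)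
    (hg : ∀ x ∈ K, γ x * W x * (∑ i, pderiv i u x * m x i
      + u x * ∑ i, pderiv i (fun y => m y i) x) ≤ κ * |W x|)
    (hΓ : ∀ x ∈ K, |γ x * ∑ i, pderiv i (fun y => m y i) x| ≤ Γ)
    (hC : ∀ x ∈ K, cutoff ε (u x) * |c x - μ x| ≤ C)
    (hC' : ∀ x ∈ K, |γ x * cutoff ε (u x) * ∑ i, pderiv i W x * m x i| ≤ C' * |W x|) :
    ∫ x in K, cutoff ε (u x) * (softSign τ (W x) * wt x) ≤
      -((lam₁ + lam₂) * ∫ x in K, cutoff ε (u x) * softAbs τ (W x)) +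
      ∫ x in K, (cutoff ε (u x) * |f x| + A x * |W x| * (cutoffDeriv2 ε (u x) *
        ‖fderiv ℝ u x‖ ^ 2) + κ * (M + 1) + 2 * ε * Γ + C * τ
        + C' * (|W x| * softDirac τ (W x))) := by
  -- This field collects all integrations by parts: its first two terms move the diffusion from W
  -- onto the truncated weight, the third handles transport, the fourth convection. It vanishes
  -- outside `K`, so its divergence integrates to zero.
  set F : Fin n → RSpace n → ℝ := fun i y => cutoff ε (u y) * softSign τ (W y) *
    (A y * pderiv i W y) - softAbs τ (W y) * cutoffDeriv ε (u y) * (A y * pderiv i u y)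
    - softAbs τ (W y) * cutoff ε (u y) * b y i
    - γ y * cutoff ε (u y) * softSign τ (W y) * m y i with hF
  have hu1 : ContDiffOn ℝ 1 u Ω := hu.of_le one_le_two
  have hW1 : ContDiffOn ℝ 1 W Ω := hW.of_le one_le_two
  have hP : ∀ i, ContDiffOn ℝ 1 (fun y => A y * pderiv i W y) Ω := fun i =>
    hA.mul (hW.pderiv_of_isOpen hΩ (by norm_num) i)
  have hQ : ∀ i, ContDiffOn ℝ 1 (fun y => A y * pderiv i u y) Ω := fun i =>
    hA.mul (hu.pderiv_of_isOpen hΩ (by norm_num) i)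
  have hZ : ContDiffOn ℝ 1 (fun y => cutoff ε (u y)) Ω :=
    ((contDiff_cutoff ε).of_le one_le_two).comp_contDiffOn hu1
  have hZ' : ContDiffOn ℝ 1 (fun y => cutoffDeriv ε (u y)) Ω :=
    (contDiff_cutoffDeriv ε (n := 1)).comp_contDiffOn hu1
  have hR : ContDiffOn ℝ 1 (fun y => softAbs τ (W y)) Ω :=
    (contDiff_softAbs hτ).comp_contDiffOn hW1
  have hR' : ContDiffOn ℝ 1 (fun y => softSign τ (W y)) Ω :=
    (contDiff_softSign hτ).comp_contDiffOn hW1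
  have hFC : ∀ i, ContDiffOn ℝ 1 (F i) Ω := fun i =>
    ((((hZ.mul hR').mul (hP i)).sub ((hR.mul hZ').mul (hQ i))).sub
      ((hR.mul hZ).mul (hb.coord i))).sub (((hγ.mul hZ).mul hR').mul (hm.coord i))
  have hF0 : ∀ i, ∀ x ∈ Ω, x ∉ K → F i x = 0 := fun i x hx hxK => by
    have h1 := (huK x hx hxK).le
    simp [hF, cutoff_eq_zero hε h1, cutoffDeriv_eq_zero hε h1]
  have hdivcont : ∀ i, ContinuousOn (pderiv i (F i)) K := fun i =>
    ((hFC i).pderiv_of_isOpen hΩ (l := 0) (by norm_num) i).continuousOn.mono hKΩ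
  have hdiv : ∫ x in K, ∑ i, pderiv i (F i) x = 0 := by
    rw [integral_finsetSum _ fun i _ => (hdivcont i).integrableOn_compact hK]
    exact Finset.sum_eq_zero fun i _ =>
      setIntegral_pderiv_eq_zero hΩ hK hKΩ (hFC i) (hF0 i) i
  have hdivint : IntegrableOn (fun x => ∑ i, pderiv i (F i) x) K :=
    (continuousOn_finsetSum _ fun i _ => hdivcont i).integrableOn_compact hK
  have hWK := hW.continuousOn.mono hKΩ
  have huK' := hu.continuousOn.mono hKΩ
  have hZK := hZ.continuousOn.mono hKΩ
  have hRK := hR.continuousOn.mono hKΩ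
  have hR'K := hR'.continuousOn.mono hKΩ
  have hAK := hA.continuousOn.mono hKΩ
  have hLcont : ContinuousOn (fun x => cutoff ε (u x) * (softSign τ (W x) * wt x)) K := by fun_prop
  have hMcont : ContinuousOn (fun x => cutoff ε (u x) * softAbs τ (W x)) K := by fun_prop
  have hdirac : ContinuousOn (fun x => softDirac τ (W x)) K :=
    (continuous_softDirac hτ).comp_continuousOn hWK
  have hc2 : ContinuousOn (fun x => cutoffDeriv2 ε (u x)) K :=
    (continuous_cutoffDeriv2 ε).comp_continuousOn huK'
  have hfd : ContinuousOn (fun x => ‖fderiv ℝ u x‖ ^ 2) K :=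
    ((hu.continuousOn_fderiv_of_isOpen hΩ (by norm_num)).mono hKΩ).norm.pow 2
  have hRcont : ContinuousOn (fun x => cutoff ε (u x) * |f x| + A x * |W x| * (cutoffDeriv2 ε (u x) *
        ‖fderiv ℝ u x‖ ^ 2) + κ * (M + 1) + 2 * ε * Γ + C * τ
        + C' * (|W x| * softDirac τ (W x))) K := by
    have h1 := hf.abs
    have h2 := hWK.abs
    exact (((((hZK.mul h1).add ((hAK.mul h2).mul (hc2.mul hfd))).add continuousOn_const).add
      continuousOn_const).add continuousOn_const).add ((h2.mul hdirac).const_mul C')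
  have hNint : IntegrableOn (fun x => -((lam₁ + lam₂) * (cutoff ε (u x) * softAbs τ (W x)))) K :=
    ContinuousOn.integrableOn_compact hK (by fun_prop)
  -- Subtracting the vanishing integral of div F makes the claim an inequality between integrands.
  rw [← integral_const_mul, ← integral_neg, ← integral_add hNint (hRcont.integrableOn_compact hK),
    ← sub_zero (∫ x in K, cutoff ε (u x) * (softSign τ (W x) * wt x)), ← hdiv, ← integral_sub
    (hLcont.integrableOn_compact hK) hdivint]
  refine setIntegral_mono_on ((hLcont.integrableOn_compact hK).sub hdivint)
    (hNint.add (hRcont.integrableOn_compact hK))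
    hK.measurableSet fun x hx => ?_
  have hxΩ := hKΩ hx
  have hnh := hΩ.mem_nhds hxΩ
  have hdA : ∀ {g : RSpace n → ℝ}, ContDiffOn ℝ 1 g Ω → DifferentiableAt ℝ g x := fun hg =>
    (hg.contDiffAt hnh).differentiableAt one_ne_zero
  have hexp : ∀ i, pderiv i (F i) x =
      cutoff ε (u x) * softSign τ (W x) * pderiv i (fun y => A y * pderiv i W y) x
      - cutoff ε (u x) * softSign τ (W x) * (b x i * pderiv i W x)
      - cutoff ε (u x) * softSign τ (W x) * (m x i * pderiv i γ x)
      + A x * cutoff ε (u x) * softDirac τ (W x) * pderiv i W x ^ 2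
      - cutoffDeriv ε (u x) * softAbs τ (W x) * pderiv i (fun y => A y * pderiv i u y) x
      - cutoffDeriv ε (u x) * softAbs τ (W x) * (b x i * pderiv i u x)
      - A x * softAbs τ (W x) * cutoffDeriv2 ε (u x) * pderiv i u x ^ 2
      - softAbs τ (W x) * cutoff ε (u x) * pderiv i (fun y => b y i) x
      - γ x * softSign τ (W x) * cutoffDeriv ε (u x) * (pderiv i u x * m x i)
      - γ x * softSign τ (W x) * cutoff ε (u x) * pderiv i (fun y => m y i) x
      - γ x * cutoff ε (u x) * softDirac τ (W x) * (pderiv i W x * m x i) := fun i => by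
    have := fderiv_flux (ε := ε) hτ (EuclideanSpace.single i 1) (hdA hu1) (hdA hW1) (hdA (hP i))
      (hdA (hQ i)) (hdA (hb.coord i)) (hdA hγ) (hdA (hm.coord i))
    rw [pderiv, hF]
    rw [this]
    simp only [pderiv]
    ring
  -- Here the equation eliminates div(A∇W) and m·∇γ, so that no second derivatives of W and no
  -- derivatives of γ remain.
  have hsum : ∑ i, pderiv i (F i) x = cutoff ε (u x) * (softSign τ (W x) * wt x)
      - (-(A x * cutoff ε (u x) * softDirac τ (W x) * ∑ i, pderiv i W x ^ 2)
      + cutoffDeriv ε (u x) * softAbs τ (W x) * (∑ i, pderiv i (fun y => A y * pderiv i u y) x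
        + ∑ i, b x i * pderiv i u x)
      + A x * softAbs τ (W x) * cutoffDeriv2 ε (u x) * ‖fderiv ℝ u x‖ ^ 2
      + softAbs τ (W x) * cutoff ε (u x) * ∑ i, pderiv i (fun y => b y i) x
      - cutoff ε (u x) * softSign τ (W x) * (c x * W x + h x - f x)
      + γ x * softSign τ (W x) * (cutoffDeriv ε (u x) * ∑ i, pderiv i u x * m x i
        + cutoff ε (u x) * ∑ i, pderiv i (fun y => m y i) x)
      + γ x * cutoff ε (u x) * softDirac τ (W x) * ∑ i, pderiv i W x * m x i) := by
    rw [Finset.sum_congr rfl fun i _ => hexp i]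
    simp only [Finset.sum_add_distrib, Finset.sum_sub_distrib, ← Finset.mul_sum]
    rw [← hpde x hx, ← sum_pderiv_sq u]
    ring
  have hk := sqrt_sq_add_pos hτ (W x)
  have hfin := energy_pointwise (ζ := cutoff ε (u x)) (χ₁ := cutoffDeriv ε (u x))
    (χ₂ := cutoffDeriv2 ε (u x)) (ρ := softAbs τ (W x)) (ρ₁ := softSign τ (W x))
    (ρ₂ := softDirac τ (W x)) (k := 1 / √(W x ^ 2 + τ ^ 2)) (f := f x)
    (SW := ∑ i, pderiv i W x ^ 2) (Su := ‖fderiv ℝ u x‖ ^ 2)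
    (cutoff_nonneg (hu0 x hxΩ)) (cutoffDeriv_nonneg _ _) (cutoffDeriv_le_one _ _)
    (cutoffDeriv2_nonneg hε _) (cutoff_le_mul hε (hu0 x hxΩ)) (mul_cutoffDeriv_le hε (hu0 x hxΩ))
    (softAbs_nonneg _ _) (softAbs_le hτ _) (by rw [softSign]; ring) (by positivity)
    (abs_softSign_le hτ _) (softDirac_nonneg hτ _) (softAbs_le_mul_softSign hτ _)
    (mul_softSign_le hτ _) (hWM x hx) (hA0 x hx) (Finset.sum_nonneg fun i _ => sq_nonneg _)
    (by positivity) hlam₁ hκ (hLU x hx) (hlam₂ x hx) (hh x hx) (hg x hx) (hΓ x hx) (hC x hx)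
    (hC' x hx)
  rw [hsum]
  linarith

end energy

/-! ### Parametric integrals over compact sets -/

section parametric

variable {E : Type*} [NormedAddCommGroup E] [MeasurableSpace E] [BorelSpace E]

/-- A function continuous on a compact set has a bounded continuous extension. -/
lemma IsCompact.exists_bounded_continuous_extension {X : Type*} [TopologicalSpace X] [T2Space X]
    [NormalSpace X] {K : Set X} (hK : IsCompact K) {F : X → ℝ} (hF : ContinuousOn F K) :
    ∃ (G : X → ℝ) (B : ℝ), Continuous G ∧ (∀ x, |G x| ≤ B) ∧ EqOn G F K := by
  have : CompactSpace K := isCompact_iff_compactSpace.1 hK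
  obtain ⟨G, hG, hGF⟩ := BoundedContinuousFunction.exists_norm_eq_domRestrict_eq_of_closed
    (BoundedContinuousFunction.mkOfCompact ⟨K.domRestrict F, hF.domRestrict⟩) hK.isClosed
  refine ⟨G, ‖G‖, G.continuous, fun x => G.norm_coe_le_norm x, fun x hx => ?_⟩
  exact DFunLike.congr_fun hGF ⟨x, hx⟩

variable {ν : Measure E} {K : Set E} {a b : ℝ}

lemma continuous_setIntegral_of_bounded (hνK : ν K < ⊤) {G : E × ℝ → ℝ} {B : ℝ}
    (hG : Continuous G) (hB : ∀ z, |G z| ≤ B) : Continuous fun t => ∫ x in K, G (x, t) ∂ν := by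
  have : IsFiniteMeasure (ν.restrict K) := ⟨by rwa [Measure.restrict_apply_univ]⟩
  refine continuous_of_dominated (bound := fun _ => B) (fun t => ?_)
    (fun t => Eventually.of_forall fun x => hB _) (integrable_const B)
    (Eventually.of_forall fun x => by fun_prop)
  exact (show Continuous fun x => G (x, t) by fun_prop).measurable.aestronglyMeasurable

lemma continuousOn_setIntegral_param (hK : IsCompact K) (hνK : ν K < ⊤) {F : E → ℝ → ℝ}
    (hF : ContinuousOn (fun z : E × ℝ => F z.1 z.2) (K ×ˢ Icc a b)) :
    ContinuousOn (fun t => ∫ x in K, F x t ∂ν) (Icc a b) := by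
  obtain ⟨G, B, hG, hB, hGF⟩ := (hK.prod isCompact_Icc).exists_bounded_continuous_extension hF
  refine (continuous_setIntegral_of_bounded hνK hG hB).continuousOn.congr fun t ht => ?_
  exact setIntegral_congr_fun hK.measurableSet fun x hx => (hGF (mk_mem_prod hx ht)).symm

lemma setIntegral_intervalIntegral_swap [SecondCountableTopology E] (hK : IsCompact K)
    (hνK : ν K < ⊤) (hab : a ≤ b) {F : E → ℝ → ℝ}
    (hF : ContinuousOn (fun z : E × ℝ => F z.1 z.2) (K ×ˢ Icc a b)) :
    ∫ x in K, (∫ t in a..b, F x t) ∂ν = ∫ t in a..b, ∫ x in K, F x t ∂ν := by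
  have : IsFiniteMeasure (ν.restrict K) := ⟨by rwa [Measure.restrict_apply_univ]⟩
  obtain ⟨G, B, hG, hB, hGF⟩ := (hK.prod isCompact_Icc).exists_bounded_continuous_extension hF
  have h1 : ∫ x in K, (∫ t in a..b, F x t) ∂ν = ∫ x in K, (∫ t in a..b, G (x, t)) ∂ν :=
    setIntegral_congr_fun hK.measurableSet fun x hx =>
      intervalIntegral.integral_congr fun t ht => by
        rw [uIcc_of_le hab] at ht
        exact (hGF (mk_mem_prod hx ht)).symm
  have h2 : ∫ t in a..b, ∫ x in K, F x t ∂ν = ∫ t in a..b, ∫ x in K, G (x, t) ∂ν :=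
    intervalIntegral.integral_congr fun t ht => setIntegral_congr_fun hK.measurableSet fun x hx =>
      by
        rw [uIcc_of_le hab] at ht
        exact (hGF (mk_mem_prod hx ht)).symm
  rw [h1, h2]
  simp only [intervalIntegral.integral_of_le hab]
  refine integral_integral_swap (f := fun x t => G (x, t)) ?_
  exact Integrable.of_bound (C := B) hG.measurable.aestronglyMeasurable
    (Eventually.of_forall fun z => hB z)

end parametric

/-- The equation holds only for 0 < t < T; continuity carries the comparison of times to the
endpoints. -/
lemma antitoneOn_Icc_of_Ioo {f : ℝ → ℝ} {a b : ℝ} (hab : a < b) (hf : ContinuousOn f (Icc a b))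
    (h : ∀ s ∈ Ioo a b, ∀ t ∈ Ioo a b, s ≤ t → f t ≤ f s) : f b ≤ f a := by
  have h1 : ∀ s ∈ Ioo a b, f b ≤ f s := fun s hs => by
    have ht : Tendsto f (𝓝[<] b) (𝓝 (f b)) :=
      ((hf b (right_mem_Icc.2 hab.le)).mono_left (nhdsWithin_le_iff.2 (Icc_mem_nhdsLT hab)))
    refine le_of_tendsto ht ?_
    filter_upwards [Ioo_mem_nhdsLT hs.2] with t ht
    exact h s hs t ⟨hs.1.trans ht.1, ht.2⟩ ht.1.le
  have ht : Tendsto f (𝓝[>] a) (𝓝 (f a)) :=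
    ((hf a (left_mem_Icc.2 hab.le)).mono_left (nhdsWithin_le_iff.2 (Icc_mem_nhdsGT hab)))
  refine ge_of_tendsto ht ?_
  filter_upwards [Ioo_mem_nhdsGT hab] with s hs using h1 s hs

lemma tendsto_intervalIntegral_setIntegral {E : Type*} [NormedAddCommGroup E] [MeasurableSpace E]
    [BorelSpace E] {ν : Measure E} {K : Set E} {a b : ℝ} (hK : IsCompact K) (hνK : ν K < ⊤)
    (hab : a ≤ b) {F : ℕ → E → ℝ → ℝ} {F₀ : E → ℝ → ℝ} {B : ℝ}
    (hF : ∀ k, ContinuousOn (fun z : E × ℝ => F k z.1 z.2) (K ×ˢ Icc a b))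
    (hB : ∀ k, ∀ x ∈ K, ∀ t ∈ Icc a b, |F k x t| ≤ B)
    (hlim : ∀ x ∈ K, ∀ t ∈ Icc a b, Tendsto (fun k => F k x t) atTop (𝓝 (F₀ x t))) :
    Tendsto (fun k => ∫ t in a..b, ∫ x in K, F k x t ∂ν) atTop
      (𝓝 (∫ t in a..b, ∫ x in K, F₀ x t ∂ν)) := by
  have : IsFiniteMeasure (ν.restrict K) := ⟨by rwa [Measure.restrict_apply_univ]⟩
  have hslice : ∀ k, ∀ t ∈ Icc a b, ContinuousOn (fun x => F k x t) K := fun k t ht =>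
    (hF k).comp (by fun_prop : ContinuousOn (fun x : E => (x, t)) K) fun x hx => mk_mem_prod hx ht
  have hsub : uIoc a b ⊆ Icc a b := by rw [uIoc_of_le hab]; exact Ioc_subset_Icc_self
  refine intervalIntegral.tendsto_integral_filter_of_dominated_convergence
    (fun _ => B * ν.real K) (Eventually.of_forall fun k => ?_) (Eventually.of_forall fun k => ?_)
    intervalIntegrable_const (Eventually.of_forall fun t ht => ?_)
  · exact ((continuousOn_setIntegral_param hK hνK (hF k)).mono hsub).aestronglyMeasurable
      measurableSet_uIoc
  · refine Eventually.of_forall fun t ht => ?_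
    exact norm_setIntegral_le_of_norm_le_const hνK fun x hx => hB k x hx t (hsub ht)
  · refine tendsto_integral_of_dominated_convergence (fun _ => B) (fun k => ?_)
      (integrable_const B) (fun k => ?_) ?_
    · exact (hslice k t (hsub ht)).aestronglyMeasurable hK.measurableSet
    · exact (ae_restrict_iff' hK.measurableSet).2 (Eventually.of_forall fun x hx =>
        hB k x hx t (hsub ht))
    · exact (ae_restrict_iff' hK.measurableSet).2 (Eventually.of_forall fun x hx =>
        hlim x hx t (hsub ht))

/-! ### Coefficients and solutions on time slices -/

section slices

variable {n : ℕ} {Ω : Set (RSpace n)}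

lemma ContDiffOn.slice {V : Type*} [NormedAddCommGroup V] [NormedSpace ℝ V]
    {F : RSpace n → ℝ → V} {k : WithTop ℕ∞}
    (hF : ContDiffOn ℝ k (fun z : RSpace n × ℝ => F z.1 z.2) (closure Ω ×ˢ Ici 0)) {t : ℝ}
    (ht : 0 ≤ t) : ContDiffOn ℝ k (fun y => F y t) Ω :=
  hF.comp (contDiffOn_id.prodMk contDiffOn_const) fun _ hy => ⟨subset_closure hy, ht⟩

/-- The derivative relative to the closed cylinder is continuous, hence bounded on compact time
intervals, and restricts to the ordinary derivative inside. -/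
lemma IsSmoothBoundedDomain.exists_bound_pderiv (hΩ : IsSmoothBoundedDomain Ω)
    {F : RSpace n → ℝ → ℝ}
    (hF : ContDiffOn ℝ 1 (fun z : RSpace n × ℝ => F z.1 z.2) (closure Ω ×ˢ Ici 0)) (T : ℝ) :
    ∃ B, 0 ≤ B ∧ ∀ x ∈ Ω, ∀ t ∈ Ioo 0 T, ∀ i, |pderiv i (fun y => F y t) x| ≤ B := by
  have hcont := hF.continuousOn_fderivWithin
    (hΩ.uniqueDiffOn_closure.prod (uniqueDiffOn_Ici 0)) le_rfl
  obtain ⟨B, hB⟩ := (hΩ.isCompact_closure.prod (isCompact_Icc (a := (0 : ℝ)) (b := T))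
    ).exists_bound_of_continuousOn (hcont.mono (prod_mono le_rfl Icc_subset_Ici_self))
  refine ⟨max B 0, le_max_right _ _, fun x hx t ht i => ?_⟩
  have hmem : closure Ω ×ˢ Ici (0 : ℝ) ∈ 𝓝 (x, t) :=
    prod_mem_nhds (mem_of_superset (hΩ.isOpen.mem_nhds hx) subset_closure) (Ici_mem_nhds ht.1)
  have hd := ((hF.contDiffAt hmem).differentiableAt one_ne_zero).hasFDerivAt
  rw [← fderivWithin_of_mem_nhds hmem] at hd
  have h2 : HasFDerivAt (fun y : RSpace n => (y, t)) (ContinuousLinearMap.inl ℝ (RSpace n) ℝ) x :=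
    hasFDerivAt_prodMk_left x t
  have h3 : HasFDerivAt (fun y => F y t) ((fderivWithin ℝ (fun z : RSpace n × ℝ => F z.1 z.2)
      (closure Ω ×ˢ Ici 0) (x, t)).comp (ContinuousLinearMap.inl ℝ (RSpace n) ℝ)) x :=
    HasFDerivAt.comp x (f := fun y => (y, t)) hd h2
  rw [pderiv, h3.fderiv, ← Real.norm_eq_abs]
  refine (ContinuousLinearMap.le_opNorm _ _).trans (le_max_of_le_left ?_)
  rw [PiLp.norm_single, norm_one, mul_one]
  refine (ContinuousLinearMap.opNorm_comp_le _ _).trans ?_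
  exact (mul_le_of_le_one_right (norm_nonneg _) (ContinuousLinearMap.norm_inl_le_one ..)).trans
    (hB (x, t) ⟨subset_closure hx, ht.1.le, ht.2.le⟩)

variable {S : ParabolicSystem n} {I : ParabolicInput n} {T : ℝ} {w : RSpace n → ℝ → ℝ}

lemma ParabolicSystem.IsSmooth.contDiffOn_g (hS : S.IsSmooth Ω) {t : ℝ} (ht : 0 ≤ t)
    {W : RSpace n → ℝ} (hW : ContDiffOn ℝ 1 W Ω) : ContDiffOn ℝ 1 (fun y => S.g y t (W y)) Ω :=
  (hS.g.of_le (by norm_num)).comp (contDiffOn_id.prodMk (contDiffOn_const.prodMk hW))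
    fun _ hy => ⟨subset_closure hy, ht, mem_univ _⟩

lemma IsDirichletSolution.pde_coord (hΩ : IsOpen Ω) (hw : IsDirichletSolution S I Ω T w)
    {x : RSpace n} (hx : x ∈ Ω) {t : ℝ} (ht : t ∈ Ioo 0 T) :
    deriv (fun τ => w x τ) t
      - ∑ i, pderiv i (fun y => S.a y t * pderiv i (fun y' => w y' t) y) x
      + ∑ i, S.b x t i * pderiv i (fun y => w y t) x + S.c x t * w x t
      + (S.h x t (w x t) (gradient (fun y => w y t) x)
        + ∑ i, S.m x t i * pderiv i (fun y => S.g y t (w y t)) x) = I.f x t := by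
  rw [← hw.pde x hx t ht, divWithin_eq_sum (hΩ.mem_nhds hx), inner_gradient_eq_sum,
    inner_gradient_eq_sum]
  simp only [PiLp.smul_apply, gradient_coord, smul_eq_mul]

lemma IsDirichletSolution.exists_bound (hΩ : IsSmoothBoundedDomain Ω)
    (hw : IsDirichletSolution S I Ω T w) :
    ∃ M, 0 ≤ M ∧ ∀ x ∈ closure Ω, ∀ t ∈ Icc 0 T, |w x t| ≤ M := by
  obtain ⟨M, hM⟩ := (hΩ.isCompact_closure.prod isCompact_Icc).exists_bound_of_continuousOn hw.cont
  exact ⟨max M 0, le_max_right _ _, fun x hx t ht => le_max_of_le_left (hM (x, t) ⟨hx, ht⟩)⟩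

lemma IsDirichletSolution.continuousOn_g (hS : S.IsSmooth Ω) (hw : IsDirichletSolution S I Ω T w) :
    ContinuousOn (fun z : RSpace n × ℝ => S.g z.1 z.2 (w z.1 z.2)) (closure Ω ×ˢ Icc 0 T) :=
  hS.g.continuousOn.comp (continuousOn_fst.prodMk (continuousOn_snd.prodMk hw.cont))
    fun _ hz => ⟨hz.1, hz.2.1, mem_univ _⟩

lemma IsDirichletSolution.exists_bound_g (hΩ : IsSmoothBoundedDomain Ω) (hS : S.IsSmooth Ω)
    (hw : IsDirichletSolution S I Ω T w) :
    ∃ B, 0 ≤ B ∧ ∀ x ∈ closure Ω, ∀ t ∈ Icc 0 T, |S.g x t (w x t)| ≤ B := by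
  obtain ⟨B, hB⟩ := (hΩ.isCompact_closure.prod isCompact_Icc).exists_bound_of_continuousOn
    (hw.continuousOn_g hS)
  exact ⟨max B 0, le_max_right _ _, fun x hx t ht => le_max_of_le_left (hB (x, t) ⟨hx, ht⟩)⟩

/-- The convection flux is linearly bounded along a solution. -/
lemma IsDirichletSolution.exists_bound_g_linear {μ : RSpace n → ℝ → ℝ} {cLow : ℝ}
    (hΩ : IsSmoothBoundedDomain Ω) (hS : S.IsSmooth Ω) (hsign : SignAssumption S Ω μ cLow)
    (hw : IsDirichletSolution S I Ω T w) :
    ∃ B, 0 ≤ B ∧ ∀ x ∈ Ω, ∀ t ∈ Ioo 0 T, |S.g x t (w x t)| ≤ B * |w x t| := by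
  obtain ⟨B, hB0, hB⟩ := hw.exists_bound_g hΩ hS
  obtain ⟨s₀, g₀, hs₀, hg₀, hg⟩ := hsign.g_linear
  obtain ⟨N, hN⟩ := (hΩ.isCompact_closure.prod (isCompact_Icc (a := (0 : ℝ)) (b := T))
    ).exists_bound_of_continuousOn (hg₀.mono (prod_mono le_rfl Icc_subset_Ici_self))
  -- For |w| ≤ s₀ the assumed linear bound applies; for |w| ≥ s₀ boundedness of g is itself a linear
  -- bound with slope B/s₀.
  refine ⟨max N (B / s₀), le_max_of_le_right (by positivity), fun x hx t ht => ?_⟩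
  rcases le_total |w x t| s₀ with h | h
  · refine (hg x hx t ht.1 _ (abs_le.1 h)).trans (mul_le_mul_of_nonneg_right ?_ (abs_nonneg _))
    exact (hN (x, t) ⟨subset_closure hx, ht.1.le, ht.2.le⟩).trans (le_max_left _ _)
  · refine (hB x (subset_closure hx) t ⟨ht.1.le, ht.2.le⟩).trans ?_
    calc B = B / s₀ * s₀ := by field_simp
      _ ≤ B / s₀ * |w x t| := by gcongr
      _ ≤ _ := by gcongr; exact le_max_right _ _

end slices

/-! ### Time evolution of weighted `L¹`-norms -/

/-- A boundary defining function `u` which is a supersolution, up to an error `κ`, of the equations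
governing the weighted `L¹`-norm of the solution `w`. -/
structure IsSuperWeight {n : ℕ} (S : ParabolicSystem n) (Ω : Set (RSpace n)) (T : ℝ)
    (μ w : RSpace n → ℝ → ℝ) (u : RSpace n → ℝ) (lam₁ lam₂ κ : ℝ) : Prop where
  defining : IsBoundaryDefining Ω u
  contDiffOn : ContDiffOn ℝ 2 u Ω
  lam₁_nonneg : 0 ≤ lam₁
  κ_nonneg : 0 ≤ κ
  elliptic : ∀ x ∈ Ω, ∀ t ∈ Ioo 0 T, ∑ i, pderiv i (fun y => S.a y t * pderiv i u y) x
    + ∑ i, S.b x t i * pderiv i u x ≤ -(lam₁ * u x) + κ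
  reaction : ∀ x ∈ Ω, ∀ t ∈ Ioo 0 T,
    lam₂ ≤ S.c x t - ∑ i, pderiv i (fun y => S.b y t i) x - μ x t
  convection : ∀ x ∈ Ω, ∀ t ∈ Ioo 0 T, S.g x t (w x t) * w x t * (∑ i, pderiv i u x * S.m x t i
    + u x * ∑ i, pderiv i (fun y => S.m y t i) x) ≤ κ * |w x t|

section superlevel

variable {n : ℕ} {Ω : Set (RSpace n)} {u : RSpace n → ℝ} {ε : ℝ}

/-- The superlevel set `{u ≥ ε}`. -/
def superlevel (Ω : Set (RSpace n)) (u : RSpace n → ℝ) (ε : ℝ) : Set (RSpace n) :=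
  closure Ω ∩ u ⁻¹' Ici ε

lemma IsBoundaryDefining.isCompact_superlevel (hΩ : IsSmoothBoundedDomain Ω)
    (hu : IsBoundaryDefining Ω u) : IsCompact (superlevel Ω u ε) :=
  hΩ.isCompact_closure.of_isClosed_subset
    (hu.contDiffOn.continuousOn.preimage_isClosed_of_isClosed isClosed_closure isClosed_Ici)
    inter_subset_left

lemma IsBoundaryDefining.superlevel_subset (hΩ : IsSmoothBoundedDomain Ω)
    (hu : IsBoundaryDefining Ω u) (hε : 0 < ε) : superlevel Ω u ε ⊆ Ω := fun x hx => by
  rcases hΩ.closure_diff hx.1 with h | h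
  · exact h
  · have := hx.2
    rw [mem_preimage, hu.zero x h, mem_Ici] at this
    exact absurd this (not_le.2 hε)

lemma lt_of_notMem_superlevel {x : RSpace n} (hx : x ∈ Ω) (h : x ∉ superlevel Ω u ε) : u x < ε :=
  not_le.1 fun h' => h ⟨subset_closure hx, h'⟩

end superlevel

namespace IsSuperWeight

variable {n : ℕ} {Ω : Set (RSpace n)} {S : ParabolicSystem n} {I : ParabolicInput n} {T : ℝ}
  {w μ : RSpace n → ℝ → ℝ} {u : RSpace n → ℝ} {cLow lam₁ lam₂ κ M Γ C C' ε τ t t₁ t₂ : ℝ}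

/-- The energy inequality along a solution. -/
lemma energy_le (hu : IsSuperWeight S Ω T μ w u lam₁ lam₂ κ) (hΩ : IsSmoothBoundedDomain Ω)
    (hS : S.IsSmooth Ω) (hI : I.IsAdmissible S Ω) (hsign : SignAssumption S Ω μ cLow)
    (ha : ∀ x ∈ closure Ω, ∀ t, 0 ≤ t → 0 ≤ S.a x t) (hw : IsDirichletSolution S I Ω T w)
    (hε : 0 < ε) (hτ : 0 < τ) (ht : t ∈ Ioo 0 T)
    (hM : ∀ x ∈ Ω, |w x t| ≤ M)
    (hΓ : ∀ x ∈ Ω, |S.g x t (w x t) * ∑ i, pderiv i (fun y => S.m y t i) x| ≤ Γ)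
    (hC : ∀ x ∈ superlevel Ω u ε, cutoff ε (u x) * |S.c x t - μ x t| ≤ C)
    (hC' : ∀ x ∈ superlevel Ω u ε, |S.g x t (w x t) * cutoff ε (u x) *
      ∑ i, pderiv i (fun y => w y t) x * S.m x t i| ≤ C' * |w x t|) :
    ∫ x in superlevel Ω u ε, cutoff ε (u x) * (softSign τ (w x t) * deriv (fun τ => w x τ) t) ≤
      -((lam₁ + lam₂) * ∫ x in superlevel Ω u ε, cutoff ε (u x) * softAbs τ (w x t)) +
      ∫ x in superlevel Ω u ε, (cutoff ε (u x) * |I.f x t| + S.a x t * |w x t| *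
        (cutoffDeriv2 ε (u x) * ‖fderiv ℝ u x‖ ^ 2) + κ * (M + 1) + 2 * ε * Γ + C * τ
        + C' * (|w x t| * softDirac τ (w x t))) := by
  have hKΩ := hu.defining.superlevel_subset hΩ hε
  have hWC : ContDiffOn ℝ 2 (fun y => w y t) Ω := hw.regular.diff_x t ht
  have hline : ContinuousOn (fun x : RSpace n => (x, t)) (superlevel Ω u ε) := by fun_prop
  refine setIntegral_energy_le hΩ.isOpen (hu.defining.isCompact_superlevel hΩ) hKΩ
    (A := fun x => S.a x t) (W := fun x => w x t) (γ := fun x => S.g x t (w x t))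
    (c := fun x => S.c x t) (h := fun x => S.h x t (w x t) (gradient (fun y => w y t) x))
    (f := fun x => I.f x t) (μ := fun x => μ x t) (b := fun x => S.b x t) (m := fun x => S.m x t)
    (wt := fun x => deriv (fun τ => w x τ) t)
    hε hτ hu.contDiffOn hWC
    ((hS.a.of_le one_le_two).slice ht.1.le) (hS.contDiffOn_g ht.1.le (hWC.of_le one_le_two))
    ((hS.b.of_le one_le_two).slice ht.1.le) ((hS.m.of_le one_le_two).slice ht.1.le)
    (hw.regular.cont_t.comp hline fun x hx => ⟨hKΩ hx, ht⟩)
    (hI.f.continuousOn.comp hline fun x hx => ⟨hx.1, ht.1.le⟩)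
    (fun x hx => (hu.defining.pos x hx).le) (fun x hx => lt_of_notMem_superlevel hx)
    (fun x hx => hw.pde_coord hΩ.isOpen (hKΩ hx) ht) (fun x hx => ha x hx.1 t ht.1.le)
    hu.lam₁_nonneg hu.κ_nonneg (fun x hx => hM x (hKΩ hx))
    (fun x hx => hu.elliptic x (hKΩ hx) t ht) (fun x hx => hu.reaction x (hKΩ hx) t ht)
    (fun x hx => hsign.h_sign x (hKΩ hx) t ht.1 _ _)
    (fun x hx => hu.convection x (hKΩ hx) t ht) (fun x hx => hΓ x (hKΩ hx)) hC hC'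

/-- The regularised weighted norm between two positive times. -/
lemma softAbs_le (hu : IsSuperWeight S Ω T μ w u lam₁ lam₂ κ) (hΩ : IsSmoothBoundedDomain Ω)
    (hS : S.IsSmooth Ω) (hI : I.IsAdmissible S Ω) (hsign : SignAssumption S Ω μ cLow)
    (ha : ∀ x ∈ closure Ω, ∀ t, 0 ≤ t → 0 ≤ S.a x t) (hw : IsDirichletSolution S I Ω T w)
    (hε : 0 < ε) (hτ : 0 < τ) (h₁ : 0 < t₁) (h₁₂ : t₁ ≤ t₂) (h₂ : t₂ < T)
    (hM : ∀ x ∈ Ω, ∀ t ∈ Icc t₁ t₂, |w x t| ≤ M)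
    (hΓ : ∀ x ∈ Ω, ∀ t ∈ Icc t₁ t₂,
      |S.g x t (w x t) * ∑ i, pderiv i (fun y => S.m y t i) x| ≤ Γ)
    (hC : ∀ x ∈ superlevel Ω u ε, ∀ t ∈ Icc t₁ t₂, cutoff ε (u x) * |S.c x t - μ x t| ≤ C)
    (hC' : ∀ x ∈ superlevel Ω u ε, ∀ t ∈ Icc t₁ t₂, |S.g x t (w x t) * cutoff ε (u x) *
      ∑ i, pderiv i (fun y => w y t) x * S.m x t i| ≤ C' * |w x t|) :
    (∫ x in superlevel Ω u ε, Real.exp ((lam₁ + lam₂) * t₂) * (cutoff ε (u x) * softAbs τ (w x t₂)))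
      - ∫ x in superlevel Ω u ε, Real.exp ((lam₁ + lam₂) * t₁) *
        (cutoff ε (u x) * softAbs τ (w x t₁)) ≤
      ∫ t in t₁..t₂, ∫ x in superlevel Ω u ε, Real.exp ((lam₁ + lam₂) * t) *
        (cutoff ε (u x) * |I.f x t| + S.a x t * |w x t| *
        (cutoffDeriv2 ε (u x) * ‖fderiv ℝ u x‖ ^ 2) + κ * (M + 1) + 2 * ε * Γ + C * τ
        + C' * (|w x t| * softDirac τ (w x t))) := by
  set K := superlevel Ω u ε with hKdef
  have hK : IsCompact K := hu.defining.isCompact_superlevel hΩ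
  have hKΩ : K ⊆ Ω := hu.defining.superlevel_subset hΩ hε
  have hsub : K ×ˢ Icc t₁ t₂ ⊆ Ω ×ˢ Ioo 0 T := prod_mono hKΩ fun t ht =>
    ⟨h₁.trans_le ht.1, ht.2.trans_lt h₂⟩
  have hsub' : K ×ˢ Icc t₁ t₂ ⊆ closure Ω ×ˢ Ici 0 := prod_mono inter_subset_left fun t ht =>
    h₁.le.trans ht.1
  have hwc : ContinuousOn (fun z : RSpace n × ℝ => w z.1 z.2) (K ×ˢ Icc t₁ t₂) :=
    hw.regular.cont.mono hsub
  have hwt := hw.regular.cont_t.mono hsub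
  have huc : ContinuousOn (fun z : RSpace n × ℝ => u z.1) (K ×ˢ Icc t₁ t₂) :=
    (hu.contDiffOn.continuousOn.mono hKΩ).comp continuousOn_fst fun z hz => hz.1
  have hζ : ContinuousOn (fun z : RSpace n × ℝ => cutoff ε (u z.1)) (K ×ˢ Icc t₁ t₂) :=
    (continuous_cutoff ε).comp_continuousOn huc
  have hρ : ContinuousOn (fun z : RSpace n × ℝ => softAbs τ (w z.1 z.2)) (K ×ˢ Icc t₁ t₂) :=
    (contDiff_softAbs hτ (n := 0)).continuous.comp_continuousOn hwc
  have hρ' : ContinuousOn (fun z : RSpace n × ℝ => softSign τ (w z.1 z.2)) (K ×ˢ Icc t₁ t₂) :=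
    (contDiff_softSign hτ (n := 0)).continuous.comp_continuousOn hwc
  have hρ'' : ContinuousOn (fun z : RSpace n × ℝ => softDirac τ (w z.1 z.2)) (K ×ˢ Icc t₁ t₂) :=
    (continuous_softDirac hτ).comp_continuousOn hwc
  have hχ : ContinuousOn (fun z : RSpace n × ℝ => cutoffDeriv2 ε (u z.1)) (K ×ˢ Icc t₁ t₂) :=
    (continuous_cutoffDeriv2 ε).comp_continuousOn huc
  have hDu : ContinuousOn (fun z : RSpace n × ℝ => ‖fderiv ℝ u z.1‖) (K ×ˢ Icc t₁ t₂) :=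
    ((hu.contDiffOn.continuousOn_fderiv_of_isOpen hΩ.isOpen (by norm_num)).mono hKΩ).norm.comp
      continuousOn_fst fun z hz => hz.1
  have hfc : ContinuousOn (fun z : RSpace n × ℝ => |I.f z.1 z.2|) (K ×ˢ Icc t₁ t₂) :=
    (hI.f.continuousOn.mono hsub').abs
  have hac := hS.a.continuousOn.mono hsub'
  have hexp : ContinuousOn (fun z : RSpace n × ℝ => Real.exp ((lam₁ + lam₂) * z.2))
    (K ×ˢ Icc t₁ t₂) := by fun_prop
  -- The time derivative of the integrand with its exponential factor, which is designed to absorb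
  -- the decay term.
  set D : RSpace n → ℝ → ℝ := fun x t => Real.exp ((lam₁ + lam₂) * t) *
    ((lam₁ + lam₂) * (cutoff ε (u x) * softAbs τ (w x t))
      + cutoff ε (u x) * (softSign τ (w x t) * deriv (fun τ => w x τ) t)) with hD
  set R : RSpace n → ℝ → ℝ := fun x t => Real.exp ((lam₁ + lam₂) * t) *
        (cutoff ε (u x) * |I.f x t| + S.a x t * |w x t| *
        (cutoffDeriv2 ε (u x) * ‖fderiv ℝ u x‖ ^ 2) + κ * (M + 1) + 2 * ε * Γ + C * τ
        + C' * (|w x t| * softDirac τ (w x t))) with hR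
  have hDc : ContinuousOn (fun z : RSpace n × ℝ => D z.1 z.2) (K ×ˢ Icc t₁ t₂) :=
    hexp.mul (((hζ.mul hρ).const_mul _).add (hζ.mul (hρ'.mul hwt)))
  have hRc : ContinuousOn (fun z : RSpace n × ℝ => R z.1 z.2) (K ×ˢ Icc t₁ t₂) :=
    hexp.mul ((((((hζ.mul hfc).add ((hac.mul hwc.abs).mul (hχ.mul (hDu.pow 2)))).add
      continuousOn_const).add continuousOn_const).add continuousOn_const).add
      ((hwc.abs.mul hρ'').const_mul C'))
  have hslice : ∀ {F : RSpace n × ℝ → ℝ}, ContinuousOn F (K ×ˢ Icc t₁ t₂) → ∀ t ∈ Icc t₁ t₂,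
      IntegrableOn (fun x => F (x, t)) K := fun hF t ht =>
    (hF.comp (by fun_prop : ContinuousOn (fun x : RSpace n => (x, t)) K)
      fun x hx => ⟨hx, ht⟩).integrableOn_compact hK
  have hY : ∀ t ∈ Icc t₁ t₂, IntegrableOn (fun x => Real.exp ((lam₁ + lam₂) * t) *
      (cutoff ε (u x) * softAbs τ (w x t))) K := fun t ht =>
    hslice (F := fun z => Real.exp ((lam₁ + lam₂) * z.2) * (cutoff ε (u z.1) *
      softAbs τ (w z.1 z.2))) (hexp.mul (hζ.mul hρ)) t ht
  rw [← integral_sub (hY t₂ (right_mem_Icc.2 h₁₂)) (hY t₁ (left_mem_Icc.2 h₁₂))]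
  -- The fundamental theorem is applied at fixed x and followed by Fubini, which avoids
  -- differentiating under the integral sign.
  have hftc : ∀ x ∈ K, Real.exp ((lam₁ + lam₂) * t₂) * (cutoff ε (u x) * softAbs τ (w x t₂))
      - Real.exp ((lam₁ + lam₂) * t₁) * (cutoff ε (u x) * softAbs τ (w x t₁)) =
      ∫ t in t₁..t₂, D x t := fun x hx => by
    refine (intervalIntegral.integral_eq_sub_of_hasDerivAt (f := fun t =>
      Real.exp ((lam₁ + lam₂) * t) * (cutoff ε (u x) * softAbs τ (w x t))) (fun t ht => ?_) ?_).symm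
    · rw [uIcc_of_le h₁₂] at ht
      have htT := (hsub (mk_mem_prod hx ht)).2
      have h1 : HasDerivAt (fun t => Real.exp ((lam₁ + lam₂) * t))
          (Real.exp ((lam₁ + lam₂) * t) * (lam₁ + lam₂)) t := by
        simpa using ((hasDerivAt_id t).const_mul (lam₁ + lam₂)).exp
      have h2 : HasDerivAt (fun t => softAbs τ (w x t)) _ t :=
        (hasDerivAt_softAbs hτ (w x t)).comp t (hw.regular.diff_t x (hKΩ hx) t htT).hasDerivAt
      refine (h1.fun_mul (h2.const_mul (cutoff ε (u x)))).congr_deriv ?_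
      simp only [hD]
      ring
    · refine ContinuousOn.intervalIntegrable ?_
      rw [uIcc_of_le h₁₂]
      exact hDc.comp (by fun_prop : ContinuousOn (fun t : ℝ => (x, t)) (Icc t₁ t₂))
        fun t ht => ⟨hx, ht⟩
  rw [setIntegral_congr_fun hK.measurableSet hftc,
    setIntegral_intervalIntegral_swap hK hK.measure_lt_top h₁₂ hDc]
  refine intervalIntegral.integral_mono_on h₁₂
    (ContinuousOn.intervalIntegrable ?_) (ContinuousOn.intervalIntegrable ?_) fun t ht => ?_
  · rw [uIcc_of_le h₁₂]; exact continuousOn_setIntegral_param hK hK.measure_lt_top hDc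
  · rw [uIcc_of_le h₁₂]; exact continuousOn_setIntegral_param hK hK.measure_lt_top hRc
  · have hen := hu.energy_le hΩ hS hI hsign ha hw hε hτ (t := t)
      ⟨h₁.trans_le ht.1, ht.2.trans_lt h₂⟩ (fun x hx => hM x hx t ht) (fun x hx => hΓ x hx t ht)
      (fun x hx => hC x hx t ht) (fun x hx => hC' x hx t ht)
    simp only [hD]
    rw [integral_const_mul, integral_const_mul]
    refine mul_le_mul_of_nonneg_left ?_ (Real.exp_pos _).le
    have hi₁ : IntegrableOn (fun x => (lam₁ + lam₂) * (cutoff ε (u x) * softAbs τ (w x t))) K :=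
      (hslice (hζ.mul hρ) t ht).const_mul _
    have hi₂ : IntegrableOn (fun x => cutoff ε (u x) *
        (softSign τ (w x t) * deriv (fun τ => w x τ) t)) K := hslice (hζ.mul (hρ'.mul hwt)) t ht
    rw [integral_add hi₁ hi₂, integral_const_mul]
    linarith

end IsSuperWeight

namespace IsSuperWeight

variable {n : ℕ} {Ω : Set (RSpace n)} {S : ParabolicSystem n} {I : ParabolicInput n} {T : ℝ}
  {w μ : RSpace n → ℝ → ℝ} {u : RSpace n → ℝ} {cLow lam₁ lam₂ κ M Γ ε t₁ t₂ : ℝ}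

/-- The right-hand side of the evolution inequality for the truncated weight. -/
noncomputable def layerRate (S : ParabolicSystem n) (I : ParabolicInput n) (w : RSpace n → ℝ → ℝ)
    (u : RSpace n → ℝ) (ε lam c : ℝ) (x : RSpace n) (t : ℝ) : ℝ :=
  Real.exp (lam * t) * (cutoff ε (u x) * |I.f x t| + S.a x t * |w x t| *
    (cutoffDeriv2 ε (u x) * ‖fderiv ℝ u x‖ ^ 2) + c)

lemma continuousOn_layerRate (hu : IsSuperWeight S Ω T μ w u lam₁ lam₂ κ)
    (hΩ : IsSmoothBoundedDomain Ω) (hS : S.IsSmooth Ω) (hI : I.IsAdmissible S Ω)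
    (hw : IsDirichletSolution S I Ω T w) (hε : 0 < ε) (lam c : ℝ) :
    ContinuousOn (fun z : RSpace n × ℝ => layerRate S I w u ε lam c z.1 z.2)
      (superlevel Ω u ε ×ˢ Icc 0 T) := by
  have hKΩ := hu.defining.superlevel_subset hΩ hε
  have hsub' : superlevel Ω u ε ×ˢ Icc 0 T ⊆ closure Ω ×ˢ Ici 0 :=
    prod_mono inter_subset_left Icc_subset_Ici_self
  have hwc : ContinuousOn (fun z : RSpace n × ℝ => w z.1 z.2) (superlevel Ω u ε ×ˢ Icc 0 T) :=
    hw.cont.mono (prod_mono inter_subset_left le_rfl)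
  have huc : ContinuousOn (fun z : RSpace n × ℝ => u z.1) (superlevel Ω u ε ×ˢ Icc 0 T) :=
    (hu.contDiffOn.continuousOn.mono hKΩ).comp continuousOn_fst fun z hz => hz.1
  have hDu : ContinuousOn (fun z : RSpace n × ℝ => ‖fderiv ℝ u z.1‖)
      (superlevel Ω u ε ×ˢ Icc 0 T) :=
    ((hu.contDiffOn.continuousOn_fderiv_of_isOpen hΩ.isOpen (by norm_num)).mono hKΩ).norm.comp
      continuousOn_fst fun z hz => hz.1
  have hfc := (hI.f.continuousOn.mono hsub').abs
  have hac := hS.a.continuousOn.mono hsub'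
  exact (by fun_prop : ContinuousOn (fun z : RSpace n × ℝ => Real.exp (lam * z.2)) _).mul
    (((((continuous_cutoff ε).comp_continuousOn huc).mul hfc).add ((hac.mul hwc.abs).mul
      (((continuous_cutoffDeriv2 ε).comp_continuousOn huc).mul (hDu.pow 2)))).add continuousOn_const)

/-- The truncated weighted norm between two positive times. -/
lemma truncated_le_of_pos (hu : IsSuperWeight S Ω T μ w u lam₁ lam₂ κ)
    (hΩ : IsSmoothBoundedDomain Ω)
    (hS : S.IsSmooth Ω) (hI : I.IsAdmissible S Ω) (hsign : SignAssumption S Ω μ cLow)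
    (ha : ∀ x ∈ closure Ω, ∀ t, 0 ≤ t → 0 ≤ S.a x t) (hw : IsDirichletSolution S I Ω T w)
    (hε : 0 < ε) (h₁ : 0 < t₁) (h₁₂ : t₁ ≤ t₂) (h₂ : t₂ < T)
    (hM : ∀ x ∈ closure Ω, ∀ t ∈ Icc 0 T, |w x t| ≤ M)
    (hΓ : ∀ x ∈ Ω, ∀ t ∈ Ioo 0 T,
      |S.g x t (w x t) * ∑ i, pderiv i (fun y => S.m y t i) x| ≤ Γ) :
    (∫ x in superlevel Ω u ε, Real.exp ((lam₁ + lam₂) * t₂) * (cutoff ε (u x) * |w x t₂|))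
      - ∫ x in superlevel Ω u ε, Real.exp ((lam₁ + lam₂) * t₁) * (cutoff ε (u x) * |w x t₁|) ≤
      ∫ t in t₁..t₂, ∫ x in superlevel Ω u ε,
        layerRate S I w u ε (lam₁ + lam₂) (κ * (M + 1) + 2 * ε * Γ) x t := by
  set K := superlevel Ω u ε with hKdef
  have hK : IsCompact K := hu.defining.isCompact_superlevel hΩ
  have hKΩ : K ⊆ Ω := hu.defining.superlevel_subset hΩ hε
  have hJ : ∀ t ∈ Icc t₁ t₂, t ∈ Ioo 0 T := fun t ht => ⟨h₁.trans_le ht.1, ht.2.trans_lt h₂⟩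
  have hJ' : ∀ t ∈ Icc t₁ t₂, t ∈ Icc 0 T := fun t ht => Ioo_subset_Icc_self (hJ t ht)
  have hsub : K ×ˢ Icc t₁ t₂ ⊆ Ω ×ˢ Ioo 0 T := prod_mono hKΩ hJ
  have hsub' : K ×ˢ Icc t₁ t₂ ⊆ closure Ω ×ˢ Ici 0 := prod_mono inter_subset_left fun t ht =>
    h₁.le.trans ht.1
  have hKJ : IsCompact (K ×ˢ Icc t₁ t₂) := hK.prod isCompact_Icc
  have hwc : ContinuousOn (fun z : RSpace n × ℝ => w z.1 z.2) (K ×ˢ Icc t₁ t₂) :=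
    hw.regular.cont.mono hsub
  have huc : ContinuousOn (fun z : RSpace n × ℝ => u z.1) (K ×ˢ Icc t₁ t₂) :=
    (hu.contDiffOn.continuousOn.mono hKΩ).comp continuousOn_fst fun z hz => hz.1
  have hζ : ContinuousOn (fun z : RSpace n × ℝ => cutoff ε (u z.1)) (K ×ˢ Icc t₁ t₂) :=
    (continuous_cutoff ε).comp_continuousOn huc
  -- The constants `C` and `N` depend on ε and on the times, as they come from a compact subset of
  -- the open cylinder (∇w may blow up at its boundary). This forces τ → 0 before ε → 0.
  obtain ⟨C, hC⟩ := hKJ.exists_bound_of_continuousOn (hζ.mul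
    (((hS.c.continuousOn.mono hsub').sub (hsign.μ_cont.mono hsub')).abs))
  obtain ⟨N, hN⟩ := hKJ.exists_bound_of_continuousOn (hζ.mul (continuousOn_finsetSum Finset.univ
    fun (i : Fin n) _ => ((hw.regular.cont_x.mono hsub).clm_apply
      (continuousOn_const (c := (EuclideanSpace.single i 1 : RSpace n)))).mul
      ((EuclideanSpace.proj (𝕜 := ℝ) i).continuous.comp_continuousOn
        (hS.m.continuousOn.mono hsub'))))
  obtain ⟨B, hB0, hB⟩ := hw.exists_bound_g_linear hΩ hS hsign
  have hC' : ∀ x ∈ K, ∀ t ∈ Icc t₁ t₂, |S.g x t (w x t) * cutoff ε (u x) *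
      ∑ i, pderiv i (fun y => w y t) x * S.m x t i| ≤ B * N * |w x t| := fun x hx t ht => by
    have h1 := hB x (hKΩ hx) t (hJ t ht)
    have h2 : |cutoff ε (u x) * ∑ i, pderiv i (fun y => w y t) x * S.m x t i| ≤ N :=
      hN (x, t) ⟨hx, ht⟩
    rw [mul_assoc, abs_mul]
    calc _ ≤ B * |w x t| * N := mul_le_mul h1 h2 (abs_nonneg _) (by positivity)
      _ = _ := by ring
  -- A sequence is chosen because dominated convergence is used for both the space and the time
  -- integrals.
  set τ : ℕ → ℝ := fun k => 1 / ((k : ℝ) + 1) with hτdef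
  have hτ : ∀ k, 0 < τ k := fun k => by simp only [hτdef]; positivity
  have hτ1 : ∀ k, τ k ≤ 1 := fun k => by
    simp only [hτdef]; rw [div_le_one (by positivity)]; linarith [(Nat.cast_nonneg k : (0:ℝ) ≤ k)]
  have hτlim : Tendsto τ atTop (𝓝 0) := tendsto_one_div_add_atTop_nhds_zero_nat
  have hsoft : ∀ s : ℝ, Tendsto (fun k => softAbs (τ k) s) atTop (𝓝 |s|) := fun s =>
    tendsto_of_tendsto_of_tendsto_of_le_of_le (by simpa using hτlim.const_sub |s|)
      tendsto_const_nhds (fun k => by linarith [abs_le_softAbs_add (τ k) s])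
      fun k => _root_.softAbs_le (hτ k) s
  have hR0 := (hu.continuousOn_layerRate hΩ hS hI hw hε (lam₁ + lam₂)
    (κ * (M + 1) + 2 * ε * Γ)).mono (prod_mono le_rfl hJ')
  have hexp : ContinuousOn (fun z : RSpace n × ℝ => Real.exp ((lam₁ + lam₂) * z.2))
    (K ×ˢ Icc t₁ t₂) := by fun_prop
  have hlhs : ∀ t ∈ Icc t₁ t₂, Tendsto (fun k => ∫ x in K, Real.exp ((lam₁ + lam₂) * t) *
      (cutoff ε (u x) * softAbs (τ k) (w x t))) atTop
      (𝓝 (∫ x in K, Real.exp ((lam₁ + lam₂) * t) * (cutoff ε (u x) * |w x t|))) := fun t ht => by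
    have hline : ContinuousOn (fun x : RSpace n => (x, t)) K := by fun_prop
    have hmap : MapsTo (fun x : RSpace n => (x, t)) K (K ×ˢ Icc t₁ t₂) := fun x hx => ⟨hx, ht⟩
    refine tendsto_integral_of_dominated_convergence
      (fun x => Real.exp ((lam₁ + lam₂) * t) * (cutoff ε (u x) * |w x t|)) (fun k => ?_)
      (((hexp.mul (hζ.mul hwc.abs)).comp hline hmap).integrableOn_compact hK) (fun k => ?_)
      (Eventually.of_forall fun x => ((hsoft _).const_mul _).const_mul _)
    · exact ((hexp.mul (hζ.mul ((contDiff_softAbs (hτ k) (n := 0)).continuous.comp_continuousOn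
        hwc))).comp hline hmap).aestronglyMeasurable hK.measurableSet
    · refine (ae_restrict_iff' hK.measurableSet).2 (Eventually.of_forall fun x hx => ?_)
      have h0 : 0 ≤ cutoff ε (u x) := cutoff_nonneg (hu.defining.pos x (hKΩ hx)).le
      have h1 := softAbs_nonneg (τ k) (w x t)
      rw [Real.norm_of_nonneg (by positivity)]
      gcongr
      exact _root_.softAbs_le (hτ k) _
  obtain ⟨B₁, hB₁⟩ := hKJ.exists_bound_of_continuousOn hR0
  obtain ⟨B₂, hB₂⟩ := hKJ.exists_bound_of_continuousOn hexp
  -- The error Cτ tends to zero and stays below |C|; the Dirac error is bounded by |BN| and tends to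
  -- zero pointwise, so `layerRate` alone survives.
  have hrhs := tendsto_intervalIntegral_setIntegral (ν := volume) (B := B₁ + B₂ * (|C| + |B * N|))
    (F := fun k x t => Real.exp ((lam₁ + lam₂) * t) *
        (cutoff ε (u x) * |I.f x t| + S.a x t * |w x t| *
        (cutoffDeriv2 ε (u x) * ‖fderiv ℝ u x‖ ^ 2) + κ * (M + 1) + 2 * ε * Γ + C * τ k
        + B * N * (|w x t| * softDirac (τ k) (w x t))))
    (F₀ := layerRate S I w u ε (lam₁ + lam₂) (κ * (M + 1) + 2 * ε * Γ))
    hK hK.measure_lt_top h₁₂ (fun k => ?_) (fun k x hx t ht => ?_) (fun x hx t ht => ?_)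
  · refine le_of_tendsto_of_tendsto' ((hlhs t₂ (right_mem_Icc.2 h₁₂)).sub
      (hlhs t₁ (left_mem_Icc.2 h₁₂))) hrhs fun k => ?_
    exact hu.softAbs_le hΩ hS hI hsign ha hw hε (hτ k) h₁ h₁₂ h₂
      (fun x hx t ht => hM x (subset_closure hx) t (hJ' t ht))
      (fun x hx t ht => hΓ x hx t (hJ t ht))
      (fun x hx t ht => (le_abs_self _).trans (hC (x, t) ⟨hx, ht⟩)) hC'
  · refine (hR0.add (hexp.mul ((continuousOn_const (c := C * τ k)).add ((hwc.abs.mul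
      ((continuous_softDirac (hτ k)).comp_continuousOn hwc)).const_mul (B * N))))).congr
      fun z _ => ?_
    simp only [layerRate, Pi.add_apply, Pi.mul_apply, Function.comp_apply]
    ring
  · have e : Real.exp ((lam₁ + lam₂) * t) *
        (cutoff ε (u x) * |I.f x t| + S.a x t * |w x t| *
        (cutoffDeriv2 ε (u x) * ‖fderiv ℝ u x‖ ^ 2) + κ * (M + 1) + 2 * ε * Γ + C * τ k
        + B * N * (|w x t| * softDirac (τ k) (w x t))) =
        layerRate S I w u ε (lam₁ + lam₂) (κ * (M + 1) + 2 * ε * Γ) x t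
        + Real.exp ((lam₁ + lam₂) * t) *
          (C * τ k + B * N * (|w x t| * softDirac (τ k) (w x t))) := by
      simp only [layerRate]; ring
    rw [e]
    refine (abs_add_le _ _).trans (add_le_add (hB₁ (x, t) ⟨hx, ht⟩) ?_)
    rw [abs_mul]
    refine mul_le_mul (hB₂ (x, t) ⟨hx, ht⟩) ((abs_add_le _ _).trans (add_le_add ?_ ?_))
      (abs_nonneg _) ((norm_nonneg _).trans (hB₂ (x, t) ⟨hx, ht⟩))
    · rw [abs_mul, abs_of_pos (hτ k)]
      exact mul_le_of_le_one_right (abs_nonneg _) (hτ1 k)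
    · rw [abs_mul, abs_of_nonneg (mul_nonneg (abs_nonneg _) (softDirac_nonneg (hτ k) _))]
      exact mul_le_of_le_one_right (abs_nonneg _) (abs_mul_softDirac_le_one (hτ k) _)
  · have h1 := (((hτlim.const_mul C).const_add (cutoff ε (u x) * |I.f x t| + S.a x t * |w x t| *
        (cutoffDeriv2 ε (u x) * ‖fderiv ℝ u x‖ ^ 2) + κ * (M + 1) + 2 * ε * Γ)).add
        ((tendsto_abs_mul_softDirac hτ hτlim (w x t)).const_mul (B * N))).const_mul
        (Real.exp ((lam₁ + lam₂) * t))
    refine h1.trans (le_of_eq ?_)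
    simp only [layerRate]
    ring_nf

/-- The truncated weighted norm at the final time. -/
lemma truncated_le (hu : IsSuperWeight S Ω T μ w u lam₁ lam₂ κ) (hΩ : IsSmoothBoundedDomain Ω)
    (hS : S.IsSmooth Ω) (hI : I.IsAdmissible S Ω) (hsign : SignAssumption S Ω μ cLow)
    (ha : ∀ x ∈ closure Ω, ∀ t, 0 ≤ t → 0 ≤ S.a x t) (hw : IsDirichletSolution S I Ω T w)
    (hT : 0 < T) (hε : 0 < ε) (hM : ∀ x ∈ closure Ω, ∀ t ∈ Icc 0 T, |w x t| ≤ M)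
    (hΓ : ∀ x ∈ Ω, ∀ t ∈ Ioo 0 T,
      |S.g x t (w x t) * ∑ i, pderiv i (fun y => S.m y t i) x| ≤ Γ) :
    Real.exp ((lam₁ + lam₂) * T) * ∫ x in superlevel Ω u ε, cutoff ε (u x) * |w x T| ≤
      (∫ x in superlevel Ω u ε, cutoff ε (u x) * |w x 0|) +
      ∫ t in 0..T, ∫ x in superlevel Ω u ε,
        layerRate S I w u ε (lam₁ + lam₂) (κ * (M + 1) + 2 * ε * Γ) x t := by
  have hK := hu.defining.isCompact_superlevel hΩ (ε := ε)
  have hKΩ := hu.defining.superlevel_subset hΩ hε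
  have hRc := hu.continuousOn_layerRate hΩ hS hI hw hε (lam₁ + lam₂) (κ * (M + 1) + 2 * ε * Γ)
  have hr := continuousOn_setIntegral_param (ν := volume) hK hK.measure_lt_top hRc
  have hwc : ContinuousOn (fun z : RSpace n × ℝ => w z.1 z.2) (superlevel Ω u ε ×ˢ Icc 0 T) :=
    hw.cont.mono (prod_mono inter_subset_left le_rfl)
  have huc : ContinuousOn (fun z : RSpace n × ℝ => u z.1) (superlevel Ω u ε ×ˢ Icc 0 T) :=
    (hu.contDiffOn.continuousOn.mono hKΩ).comp continuousOn_fst fun z hz => hz.1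
  have hY := continuousOn_setIntegral_param (ν := volume) hK hK.measure_lt_top
    (F := fun x t => Real.exp ((lam₁ + lam₂) * t) * (cutoff ε (u x) * |w x t|))
    ((by fun_prop : ContinuousOn (fun z : RSpace n × ℝ => Real.exp ((lam₁ + lam₂) * z.2)) _).mul
      (((continuous_cutoff ε).comp_continuousOn huc).mul hwc.abs))
  set r := fun t => ∫ x in superlevel Ω u ε,
        layerRate S I w u ε (lam₁ + lam₂) (κ * (M + 1) + 2 * ε * Γ) x t with hrdef
  have hrint : ∀ a ∈ Icc 0 T, ∀ b ∈ Icc 0 T, IntervalIntegrable r volume a b := fun a ha b hb =>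
    (hr.mono (by
      intro x hx
      exact (convex_Icc (0 : ℝ) T).ordConnected.uIcc_subset ha hb hx)).intervalIntegrable
  have hprim : ContinuousOn (fun t => ∫ s in (0 : ℝ)..t, r s) (Icc 0 T) := by
    have := intervalIntegral.continuousOn_primitive_interval' (hrint 0 (left_mem_Icc.2 hT.le) T
      (right_mem_Icc.2 hT.le)) left_mem_uIcc
    rwa [uIcc_of_le hT.le] at this
  -- Weighted norm minus the primitive of the rate is nonincreasing inside (0,T) and continuous up
  -- to both ends.
  have key := antitoneOn_Icc_of_Ioo hT (hY.sub hprim) fun s hs t ht hst => by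
    have h := hu.truncated_le_of_pos hΩ hS hI hsign ha hw hε hs.1 hst ht.2 hM hΓ
    have h0 := intervalIntegral.integral_add_adjacent_intervals
      (hrint 0 (left_mem_Icc.2 hT.le) s (Ioo_subset_Icc_self hs))
      (hrint s (Ioo_subset_Icc_self hs) t (Ioo_subset_Icc_self ht))
    simp only [Pi.sub_apply]
    linarith
  simp only [Pi.sub_apply, intervalIntegral.integral_same, mul_zero, Real.exp_zero, one_mul,
    sub_zero, integral_const_mul] at key
  linarith

end IsSuperWeight

/-! ### Space-time boundary layers and the limit of vanishing truncation -/

lemma continuousOn_setIntegral_param_of_subset {E : Type*} [NormedAddCommGroup E]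
    [MeasurableSpace E] [BorelSpace E] {ν : Measure E} {K A : Set E} {a b : ℝ}
    (hK : IsCompact K) (hA : A ⊆ K) (hAm : MeasurableSet A) (hνA : ν A < ⊤) {F : E → ℝ → ℝ}
    (hF : ContinuousOn (fun z : E × ℝ => F z.1 z.2) (K ×ˢ Icc a b)) :
    ContinuousOn (fun t => ∫ x in A, F x t ∂ν) (Icc a b) := by
  obtain ⟨G, B, hG, hB, hGF⟩ := (hK.prod isCompact_Icc).exists_bounded_continuous_extension hF
  refine (continuous_setIntegral_of_bounded hνA hG hB).continuousOn.congr fun t ht => ?_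
  exact setIntegral_congr_fun hAm fun x hx => (hGF (mk_mem_prod (hA hx) ht)).symm

namespace IsSmoothBoundedDomain

variable {n : ℕ} {Ω : Set (RSpace n)} {T : ℝ}

lemma volume_lt_top (hΩ : IsSmoothBoundedDomain Ω) : volume Ω < ⊤ := hΩ.isBounded.measure_lt_top

lemma integrableOn_of_continuousOn (hΩ : IsSmoothBoundedDomain Ω) {F : RSpace n → ℝ}
    (hF : ContinuousOn F (closure Ω)) : IntegrableOn F Ω :=
  (hF.integrableOn_compact hΩ.isCompact_closure).mono_set subset_closure

lemma integrableOn_slice (hΩ : IsSmoothBoundedDomain Ω) {F : RSpace n → ℝ → ℝ}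
    (hF : ContinuousOn (fun z : RSpace n × ℝ => F z.1 z.2) (closure Ω ×ˢ Icc 0 T)) {t : ℝ}
    (ht : t ∈ Icc 0 T) : IntegrableOn (fun x => F x t) Ω :=
  hΩ.integrableOn_of_continuousOn (hF.comp (by fun_prop :
    ContinuousOn (fun x : RSpace n => (x, t)) (closure Ω)) fun _ hx => ⟨hx, ht⟩)

lemma continuousOn_integral (hΩ : IsSmoothBoundedDomain Ω) {F : RSpace n → ℝ → ℝ}
    (hF : ContinuousOn (fun z : RSpace n × ℝ => F z.1 z.2) (closure Ω ×ˢ Icc 0 T)) :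
    ContinuousOn (fun t => ∫ x in Ω, F x t) (Icc 0 T) :=
  continuousOn_setIntegral_param_of_subset hΩ.isCompact_closure subset_closure
    hΩ.isOpen.measurableSet hΩ.volume_lt_top hF

lemma continuousOn_integral_frontier (hn : 0 < n) (hΩ : IsSmoothBoundedDomain Ω)
    {F : RSpace n → ℝ → ℝ}
    (hF : ContinuousOn (fun z : RSpace n × ℝ => F z.1 z.2) (closure Ω ×ˢ Icc 0 T)) :
    ContinuousOn (fun t => ∫ x in frontier Ω, F x t
      ∂(Measure.euclideanHausdorffMeasure (n - 1) : Measure (RSpace n))) (Icc 0 T) :=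
  continuousOn_setIntegral_param hΩ.isCompact_frontier
    (hΩ.euclideanHausdorffMeasure_frontier_lt_top hn)
    (hF.mono (prod_mono frontier_subset_closure le_rfl))

end IsSmoothBoundedDomain

namespace IsBoundaryDefining

variable {n : ℕ} {Ω : Set (RSpace n)} {u : RSpace n → ℝ} {T ε : ℝ}

/-- Integrals over a superlevel set of functions vanishing below the level. -/
lemma setIntegral_superlevel (hΩ : IsSmoothBoundedDomain Ω) (hu : IsBoundaryDefining Ω u)
    (hε : 0 < ε) {F : RSpace n → ℝ} (hF : ∀ x ∈ Ω, u x < ε → F x = 0) :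
    ∫ x in superlevel Ω u ε, F x = ∫ x in Ω, F x :=
  (setIntegral_eq_of_subset_of_forall_sdiff_eq_zero hΩ.isOpen.measurableSet
    (hu.superlevel_subset hΩ hε) fun x hx =>
      hF x hx.1 (lt_of_notMem_superlevel hx.1 hx.2)).symm

/-- The space-time integral over the layer `{ε < u < 2ε}` is asymptotically bounded by the
boundary integral. -/
theorem eventually_spacetime_layer_le (hn : 0 < n) (hΩ : IsSmoothBoundedDomain Ω)
    (hu : IsBoundaryDefining Ω u) (hu2 : ContDiffOn ℝ 2 u Ω) (hT : 0 < T) {H : RSpace n → ℝ → ℝ}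
    (hH : ContinuousOn (fun z : RSpace n × ℝ => H z.1 z.2) (closure Ω ×ˢ Icc 0 T))
    (hH0 : ∀ x ∈ closure Ω, ∀ t ∈ Icc 0 T, 0 ≤ H x t) {η : ℝ} (hη : 0 < η) :
    ∀ᶠ ε in 𝓝[>] 0, ∫ t in 0..T, ∫ x in superlevel Ω u ε,
        H x t * (cutoffDeriv2 ε (u x) * ‖fderiv ℝ u x‖ ^ 2) ≤
      (∫ t in 0..T, ∫ x in frontier Ω, H x t * ‖fderivWithin ℝ u (closure Ω) x‖
        ∂(Measure.euclideanHausdorffMeasure (n - 1) : Measure (RSpace n))) + η := by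
  obtain ⟨H', B, hH'c, -, hH'⟩ :=
    (hΩ.isCompact_closure.prod isCompact_Icc).exists_bounded_continuous_extension hH
  -- Integrating in time first turns the space-time layer into a spatial one with a fixed density.
  -- The absolute value keeps it nonnegative off the closure, where the extension `H'` is
  -- uncontrolled.
  set G : RSpace n → ℝ := fun x => ∫ t in 0..T, |H' (x, t)| with hG
  have hGc : Continuous G := intervalIntegral.continuous_parametric_intervalIntegral_of_continuous'
    (f := fun x t => |H' (x, t)|) (by simp only [Function.uncurry_def]; fun_prop) 0 T
  have hG0 : ∀ x, 0 ≤ G x := fun x => intervalIntegral.integral_nonneg hT.le fun t _ => abs_nonneg _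
  have hGH : ∀ x ∈ closure Ω, ∀ c : ℝ, ∫ t in 0..T, H x t * c = G x * c := fun x hx c => by
    rw [intervalIntegral.integral_mul_const, hG]
    congr 1
    refine intervalIntegral.integral_congr fun t ht => ?_
    rw [uIcc_of_le hT.le] at ht
    rw [hH' (mk_mem_prod hx ht), abs_of_nonneg (hH0 x hx t ht)]
  filter_upwards [hu.eventually_integral_layer_le hn hΩ hGc hG0 hη, self_mem_nhdsWithin]
    with ε hε hε0
  have hK := hu.isCompact_superlevel hΩ (ε := ε)
  have hKΩ := hu.superlevel_subset hΩ hε0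
  have huc : ContinuousOn (fun z : RSpace n × ℝ => cutoffDeriv2 ε (u z.1) * ‖fderiv ℝ u z.1‖ ^ 2)
      (superlevel Ω u ε ×ˢ Icc 0 T) :=
    ((((continuous_cutoffDeriv2 ε).comp_continuousOn hu2.continuousOn).mul
      ((hu2.continuousOn_fderiv_of_isOpen hΩ.isOpen (by norm_num)).norm.pow 2)).mono hKΩ).comp
      continuousOn_fst fun z hz => hz.1
  rw [← setIntegral_intervalIntegral_swap hK hK.measure_lt_top hT.le
    ((hH.mono (prod_mono inter_subset_left le_rfl)).mul huc)]
  rw [← setIntegral_intervalIntegral_swap hΩ.isCompact_frontier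
    (hΩ.euclideanHausdorffMeasure_frontier_lt_top hn) hT.le
    ((hH.mono (prod_mono frontier_subset_closure le_rfl)).mul
      (((continuousOn_fderivWithin hΩ hu.contDiffOn).norm.mono frontier_subset_closure).comp
        continuousOn_fst fun z hz => hz.1))]
  rw [setIntegral_congr_fun hK.measurableSet fun x hx => hGH x hx.1 _,
    setIntegral_congr_fun isClosed_frontier.measurableSet fun x hx =>
      hGH x (frontier_subset_closure hx) _]
  refine le_trans (le_of_eq ?_) hε
  rw [hu.setIntegral_superlevel hΩ hε0 fun x _ hxε => by
    rw [cutoffDeriv2_eq_zero_of_lt hε0 hxε]; ring]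
  refine setIntegral_congr_fun hΩ.isOpen.measurableSet fun x hx => ?_
  rw [fderivWithin_of_mem_nhds (mem_of_superset (hΩ.isOpen.mem_nhds hx) subset_closure), mul_assoc]

end IsBoundaryDefining

namespace IsSuperWeight

variable {n : ℕ} {Ω : Set (RSpace n)} {S : ParabolicSystem n} {I : ParabolicInput n} {T : ℝ}
  {w μ : RSpace n → ℝ → ℝ} {u : RSpace n → ℝ} {cLow lam₁ lam₂ κ M Γ : ℝ}

/-- The weighted `L¹`-estimate with a boundary defining weight. -/
theorem integral_le (hu : IsSuperWeight S Ω T μ w u lam₁ lam₂ κ) (hn : 0 < n)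
    (hΩ : IsSmoothBoundedDomain Ω)
    (hS : S.IsSmooth Ω) (hI : I.IsAdmissible S Ω) (hsign : SignAssumption S Ω μ cLow)
    (ha : ∀ x ∈ closure Ω, ∀ t, 0 ≤ t → 0 ≤ S.a x t) (hw : IsDirichletSolution S I Ω T w)
    (hT : 0 < T) (hM : ∀ x ∈ closure Ω, ∀ t ∈ Icc 0 T, |w x t| ≤ M) :
    Real.exp ((lam₁ + lam₂) * T) * ∫ x in Ω, u x * |w x T| ≤
      (∫ x in Ω, u x * |w x 0|)
      + (∫ t in 0..T, Real.exp ((lam₁ + lam₂) * t) * ∫ x in Ω, u x * |I.f x t|)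
      + (∫ t in 0..T, Real.exp ((lam₁ + lam₂) * t) * ∫ x in frontier Ω,
          S.a x t * |w x t| * ‖fderivWithin ℝ u (closure Ω) x‖
          ∂(Measure.euclideanHausdorffMeasure (n - 1) : Measure (RSpace n)))
      + κ * ((M + 1) * volume.real Ω * ∫ t in 0..T, Real.exp ((lam₁ + lam₂) * t)) := by
  obtain ⟨Bg, hBg0, hBg⟩ := hw.exists_bound_g hΩ hS
  choose Bm hBm0 hBm using fun i : Fin n => hΩ.exists_bound_pderiv (F := fun x t => S.m x t i)
    ((hS.m.of_le one_le_two).coord i) T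
  set Γ := Bg * ∑ i, Bm i with hΓdef
  have hΓ : ∀ x ∈ Ω, ∀ t ∈ Ioo 0 T,
      |S.g x t (w x t) * ∑ i, pderiv i (fun y => S.m y t i) x| ≤ Γ := fun x hx t ht => by
    rw [abs_mul]
    refine mul_le_mul (hBg x (subset_closure hx) t (Ioo_subset_Icc_self ht)) ?_ (abs_nonneg _) hBg0
    exact (Finset.abs_sum_le_sum_abs _ _).trans (Finset.sum_le_sum fun i _ => hBm i x hx t ht i)
  have hΓ0 : 0 ≤ Γ := mul_nonneg hBg0 (Finset.sum_nonneg fun i _ => hBm0 i)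
  obtain ⟨x₀, hx₀⟩ := hΩ.isConnected.nonempty
  have hM0 : 0 ≤ M := (abs_nonneg _).trans (hM x₀ (subset_closure hx₀) 0 (left_mem_Icc.2 hT.le))
  set lam := lam₁ + lam₂ with hlam
  set V := volume.real Ω with hV
  have hV0 : 0 ≤ V := measureReal_nonneg
  set E := ∫ t in 0..T, Real.exp (lam * t) with hE
  have hucl : ContinuousOn u (closure Ω) := hu.defining.contDiffOn.continuousOn
  have hfcl := hI.f.continuousOn.mono (prod_mono le_rfl Icc_subset_Ici_self :
    closure Ω ×ˢ Icc 0 T ⊆ closure Ω ×ˢ Ici 0)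
  have hacl := hS.a.continuousOn.mono (prod_mono le_rfl Icc_subset_Ici_self :
    closure Ω ×ˢ Icc 0 T ⊆ closure Ω ×ˢ Ici 0)
  have hexpc : Continuous fun t : ℝ => Real.exp (lam * t) := by fun_prop
  have hucl' : ContinuousOn (fun z : RSpace n × ℝ => u z.1) (closure Ω ×ˢ Icc 0 T) :=
    hucl.comp continuousOn_fst fun z hz => hz.1
  have hwsl : ∀ t ∈ Icc 0 T, IntegrableOn (fun x => u x * |w x t|) Ω := fun t ht =>
    hΩ.integrableOn_slice (F := fun x t => u x * |w x t|) (hucl'.mul hw.cont.abs) ht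
  have hζsl : ∀ ε, ∀ t ∈ Icc 0 T, IntegrableOn (fun x => cutoff ε (u x) * |w x t|) Ω :=
    fun ε t ht => hΩ.integrableOn_slice (F := fun x t => cutoff ε (u x) * |w x t|)
      (((continuous_cutoff ε).comp_continuousOn hucl').mul hw.cont.abs) ht
  have h0T : (0 : ℝ) ∈ Icc 0 T := left_mem_Icc.2 hT.le
  have hTT : T ∈ Icc 0 T := right_mem_Icc.2 hT.le
  set H : RSpace n → ℝ → ℝ := fun x t => Real.exp (lam * t) * (S.a x t * |w x t|) with hH
  have hHc : ContinuousOn (fun z : RSpace n × ℝ => H z.1 z.2) (closure Ω ×ˢ Icc 0 T) :=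
    (hexpc.comp continuous_snd).continuousOn.mul (hacl.mul hw.cont.abs)
  have hH0 : ∀ x ∈ closure Ω, ∀ t ∈ Icc 0 T, 0 ≤ H x t := fun x hx t ht =>
    mul_nonneg (Real.exp_pos _).le (mul_nonneg (ha x hx t ht.1) (abs_nonneg _))
  have hbdry : ∫ t in 0..T, ∫ x in frontier Ω, H x t * ‖fderivWithin ℝ u (closure Ω) x‖
      ∂(Measure.euclideanHausdorffMeasure (n - 1) : Measure (RSpace n)) =
      ∫ t in 0..T, Real.exp (lam * t) * ∫ x in frontier Ω,
          S.a x t * |w x t| * ‖fderivWithin ℝ u (closure Ω) x‖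
          ∂(Measure.euclideanHausdorffMeasure (n - 1) : Measure (RSpace n)) := by
    refine intervalIntegral.integral_congr fun t _ => ?_
    simp only [hH, mul_assoc]
    rw [integral_const_mul]
  rw [← hbdry]
  set P₁ := ∫ t in 0..T, Real.exp (lam * t) * ∫ x in Ω, u x * |I.f x t|
  set P₂ := ∫ t in 0..T, ∫ x in frontier Ω, H x t * ‖fderivWithin ℝ u (closure Ω) x‖
      ∂(Measure.euclideanHausdorffMeasure (n - 1) : Measure (RSpace n))
  set A₀ := ∫ x in Ω, u x * |w x 0|
  set A := ∫ x in Ω, u x * |w x T|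
  -- The estimate at fixed ε: passing between `cutoff ε u` and u costs 2εMV at time T, and nothing
  -- in the initial and source terms, where truncation only decreases the weight.
  have hstep : ∀ ε > 0, Real.exp (lam * T) * (A - 2 * ε * M * V) ≤ A₀ + (P₁ +
      (∫ t in 0..T, ∫ x in superlevel Ω u ε,
        H x t * (cutoffDeriv2 ε (u x) * ‖fderiv ℝ u x‖ ^ 2))
      + E * ((κ * (M + 1) + 2 * ε * Γ) * V)) := fun ε hε => by
    have hK := hu.defining.isCompact_superlevel hΩ (ε := ε)
    have hKΩ := hu.defining.superlevel_subset hΩ hε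
    set c := κ * (M + 1) + 2 * ε * Γ with hc
    have hc0 : 0 ≤ c := by have := hu.κ_nonneg; positivity
    have hKint : ∀ v : RSpace n → ℝ, ∫ x in superlevel Ω u ε, cutoff ε (u x) * v x =
        ∫ x in Ω, cutoff ε (u x) * v x := fun v =>
      hu.defining.setIntegral_superlevel hΩ hε fun x _ hxε => by
        rw [cutoff_eq_zero hε hxε.le, zero_mul]
    have h1 : A - 2 * ε * M * V ≤ ∫ x in superlevel Ω u ε, cutoff ε (u x) * |w x T| := by
      rw [hKint, sub_le_iff_le_add]
      calc A ≤ ∫ x in Ω, (cutoff ε (u x) * |w x T| + 2 * ε * M) := by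
            refine setIntegral_mono_on (hwsl T hTT) ((hζsl ε T hTT).add
              (integrableOn_const hΩ.volume_lt_top.ne)) hΩ.isOpen.measurableSet fun x hx => ?_
            have h2 := mul_le_mul_of_nonneg_right (le_cutoff_add hε (hu.defining.pos x hx).le)
              (abs_nonneg (w x T))
            have h3 := mul_le_mul_of_nonneg_left (hM x (subset_closure hx) T hTT)
              (by positivity : 0 ≤ 2 * ε)
            linarith
        _ = _ := by
            rw [integral_add (hζsl ε T hTT) (integrableOn_const hΩ.volume_lt_top.ne),
              setIntegral_const, smul_eq_mul, mul_comm V]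
    have h2 : ∫ x in superlevel Ω u ε, cutoff ε (u x) * |w x 0| ≤ A₀ := by
      rw [hKint]
      exact setIntegral_mono_on (hζsl ε 0 h0T) (hwsl 0 h0T) hΩ.isOpen.measurableSet fun x hx =>
        mul_le_mul_of_nonneg_right (cutoff_le (hu.defining.pos x hx).le) (abs_nonneg _)
    have hlr := hu.continuousOn_layerRate hΩ hS hI hw hε lam c
    have huK : ContinuousOn (fun z : RSpace n × ℝ => cutoffDeriv2 ε (u z.1) *
        ‖fderiv ℝ u z.1‖ ^ 2) (superlevel Ω u ε ×ˢ Icc 0 T) :=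
      ((((continuous_cutoffDeriv2 ε).comp_continuousOn hu.contDiffOn.continuousOn).mul
        ((hu.contDiffOn.continuousOn_fderiv_of_isOpen hΩ.isOpen (by norm_num)).norm.pow 2)).mono
          hKΩ).comp continuousOn_fst fun z hz => hz.1
    have hHK : ContinuousOn (fun z : RSpace n × ℝ => H z.1 z.2 * (cutoffDeriv2 ε (u z.1) *
        ‖fderiv ℝ u z.1‖ ^ 2)) (superlevel Ω u ε ×ˢ Icc 0 T) :=
      (hHc.mono (prod_mono inter_subset_left le_rfl)).mul huK
    have hii : ∀ {r : ℝ → ℝ}, ContinuousOn r (Icc 0 T) → IntervalIntegrable r volume 0 T :=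
      fun hr => ContinuousOn.intervalIntegrable (by rwa [uIcc_of_le hT.le])
    have hi₁ : IntervalIntegrable (fun t => Real.exp (lam * t) * ∫ x in Ω, u x * |I.f x t|)
      volume 0 T := hii (hexpc.continuousOn.mul (hΩ.continuousOn_integral
      (F := fun x t => u x * |I.f x t|) (hucl'.mul hfcl.abs)))
    have hi₂ := hii (continuousOn_setIntegral_param (ν := volume) hK hK.measure_lt_top
      (F := fun x t => H x t * (cutoffDeriv2 ε (u x) * ‖fderiv ℝ u x‖ ^ 2)) hHK)
    have hi₃ : IntervalIntegrable (fun t => Real.exp (lam * t) * (c * V)) volume 0 T :=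
      hii (by fun_prop)
    have h3 : ∫ t in 0..T, ∫ x in superlevel Ω u ε, layerRate S I w u ε lam c x t ≤
        P₁ + (∫ t in 0..T, ∫ x in superlevel Ω u ε,
          H x t * (cutoffDeriv2 ε (u x) * ‖fderiv ℝ u x‖ ^ 2)) + E * (c * V) := by
      have h4 := intervalIntegral.integral_mono_on hT.le
        (hii (continuousOn_setIntegral_param (ν := volume) hK hK.measure_lt_top hlr))
        ((hi₁.add hi₂).add hi₃) fun t ht => ?_
      · refine h4.trans (le_of_eq ?_)
        rw [intervalIntegral.integral_add (hi₁.add hi₂) hi₃, intervalIntegral.integral_add hi₁ hi₂,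
          intervalIntegral.integral_mul_const]
      · have hline : ContinuousOn (fun x : RSpace n => (x, t)) (superlevel Ω u ε) := by fun_prop
        have hfsl : IntegrableOn (fun x => cutoff ε (u x) * |I.f x t|) Ω :=
          hΩ.integrableOn_slice (F := fun x t => cutoff ε (u x) * |I.f x t|)
            (((continuous_cutoff ε).comp_continuousOn hucl').mul hfcl.abs) ht
        have hj₁ : IntegrableOn (fun x => Real.exp (lam * t) * (cutoff ε (u x) * |I.f x t|))
            (superlevel Ω u ε) := (hfsl.mono_set hKΩ).const_mul _
        have hj₂ : IntegrableOn (fun x => H x t * (cutoffDeriv2 ε (u x) * ‖fderiv ℝ u x‖ ^ 2))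
            (superlevel Ω u ε) :=
          (hHK.comp hline fun x hx => ⟨hx, ht⟩).integrableOn_compact hK
        have e : ∀ x, layerRate S I w u ε lam c x t = Real.exp (lam * t) *
            (cutoff ε (u x) * |I.f x t|) + H x t * (cutoffDeriv2 ε (u x) * ‖fderiv ℝ u x‖ ^ 2)
            + Real.exp (lam * t) * c := fun x => by simp only [layerRate, hH]; ring
        simp only [e]
        have hj₁₂ : IntegrableOn (fun x => Real.exp (lam * t) * (cutoff ε (u x) * |I.f x t|) +
            H x t * (cutoffDeriv2 ε (u x) * ‖fderiv ℝ u x‖ ^ 2)) (superlevel Ω u ε) := hj₁.add hj₂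
        rw [integral_add hj₁₂ (integrableOn_const hK.measure_lt_top.ne),
          integral_add hj₁ hj₂, integral_const_mul, setIntegral_const, smul_eq_mul, hKint]
        refine add_le_add (add_le_add ?_ le_rfl) ?_
        · refine mul_le_mul_of_nonneg_left ?_ (Real.exp_pos _).le
          exact setIntegral_mono_on hfsl (hΩ.integrableOn_slice (F := fun x t => u x * |I.f x t|)
            (hucl'.mul hfcl.abs) ht) hΩ.isOpen.measurableSet fun x hx =>
            mul_le_mul_of_nonneg_right (cutoff_le (hu.defining.pos x hx).le) (abs_nonneg _)
        · have : volume.real (superlevel Ω u ε) ≤ V :=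
            measureReal_mono hKΩ hΩ.volume_lt_top.ne
          have h5 : 0 ≤ Real.exp (lam * t) * c := mul_nonneg (Real.exp_pos _).le hc0
          calc _ ≤ V * (Real.exp (lam * t) * c) := mul_le_mul_of_nonneg_right this h5
            _ = _ := by ring
    have h5 := hu.truncated_le hΩ hS hI hsign ha hw hT hε hM hΓ
    have h6 := mul_le_mul_of_nonneg_left h1 (Real.exp_pos (lam * T)).le
    linarith
  -- The layer bound holds only eventually and up to η, so ε → 0 is taken at fixed η and then η is
  -- removed.
  refine le_of_forall_pos_le_add fun η hη => ?_
  have hlay := hu.defining.eventually_spacetime_layer_le hn hΩ hu.contDiffOn hT hHc hH0 hη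
  have hl : Tendsto (fun ε => Real.exp (lam * T) * (A - 2 * ε * M * V)) (𝓝[>] 0)
      (𝓝 (Real.exp (lam * T) * (A - 2 * 0 * M * V))) :=
    ((by fun_prop : Continuous fun ε => Real.exp (lam * T) * (A - 2 * ε * M * V)).tendsto 0).mono_left
      nhdsWithin_le_nhds
  have hr : Tendsto (fun ε => A₀ + (P₁ + (P₂ + η) + E * ((κ * (M + 1) + 2 * ε * Γ) * V))) (𝓝[>] 0)
      (𝓝 (A₀ + (P₁ + (P₂ + η) + E * ((κ * (M + 1) + 2 * 0 * Γ) * V)))) :=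
    ((by fun_prop : Continuous fun ε => A₀ + (P₁ + (P₂ + η) + E * ((κ * (M + 1) + 2 * ε * Γ) * V))
      ).tendsto 0).mono_left nhdsWithin_le_nhds
  have hfin := le_of_tendsto_of_tendsto hl hr (by
    filter_upwards [hlay, self_mem_nhdsWithin] with ε hε hε0
    have := hstep ε hε0
    linarith)
  linarith

end IsSuperWeight

/-! ### Weights possibly degenerate at the boundary -/

section pderiv

variable {n : ℕ} {f g : RSpace n → ℝ} {x : RSpace n} {i : Fin n}

lemma pderiv_add (hf : DifferentiableAt ℝ f x) (hg : DifferentiableAt ℝ g x) :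
    pderiv i (fun y => f y + g y) x = pderiv i f x + pderiv i g x := by
  rw [pderiv, fderiv_fun_add hf hg]; rfl

lemma pderiv_mul (hf : DifferentiableAt ℝ f x) (hg : DifferentiableAt ℝ g x) :
    pderiv i (fun y => f y * g y) x = f x * pderiv i g x + g x * pderiv i f x := by
  rw [pderiv, fderiv_fun_mul hf hg]; rfl

lemma pderiv_const_mul (hg : DifferentiableAt ℝ g x) (c : ℝ) :
    pderiv i (fun y => c * g y) x = c * pderiv i g x := by
  rw [pderiv, fderiv_const_mul hg]; rfl

lemma pderiv_congr (h : f =ᶠ[𝓝 x] g) : pderiv i f x = pderiv i g x := by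
  rw [pderiv, h.fderiv_eq, pderiv]

/-- The divergence form operator is additive in the unknown function. -/
lemma sum_pderiv_flux_add {Ω : Set (RSpace n)} (hΩ : IsOpen Ω) {a P q : RSpace n → ℝ}
    (hP : ContDiffOn ℝ 2 P Ω) (hq : ContDiffOn ℝ 2 q Ω) {x : RSpace n} (hx : x ∈ Ω)
    (ha : DifferentiableAt ℝ a x) (δ : ℝ) :
    ∑ i, pderiv i (fun y => a y * pderiv i (fun x => P x + δ * q x) y) x =
      (∑ i, pderiv i (fun y => a y * pderiv i P y) x)
        + δ * ∑ i, pderiv i (fun y => a y * pderiv i q y) x := by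
  have h0 : ∀ {f : RSpace n → ℝ}, ContDiffOn ℝ 2 f Ω → ∀ y ∈ Ω, DifferentiableAt ℝ f y :=
    fun hf y hy => (hf.contDiffAt (hΩ.mem_nhds hy)).differentiableAt two_ne_zero
  have h1 : ∀ {f : RSpace n → ℝ}, ContDiffOn ℝ 2 f Ω → ∀ i, DifferentiableAt ℝ (pderiv i f) x :=
    fun hf i => ((hf.pderiv_of_isOpen hΩ (l := 1) (by norm_num) i).contDiffAt
        (hΩ.mem_nhds hx)).differentiableAt one_ne_zero
  rw [Finset.mul_sum, ← Finset.sum_add_distrib]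
  refine Finset.sum_congr rfl fun i _ => ?_
  have h2 : (fun y => a y * pderiv i (fun x => P x + δ * q x) y) =ᶠ[𝓝 x]
      fun y => a y * pderiv i P y + δ * (a y * pderiv i q y) := by
    filter_upwards [hΩ.mem_nhds hx] with y hy
    rw [pderiv_add (h0 hP y hy) ((h0 hq y hy).const_mul δ), pderiv_const_mul (h0 hq y hy)]
    ring
  rw [pderiv_congr h2, pderiv_add (ha.fun_mul (h1 hP i)) ((ha.fun_mul (h1 hq i)).const_mul δ),
    pderiv_const_mul (ha.fun_mul (h1 hq i))]

end pderiv

/-- A nonnegative weight, vanishing on the boundary, which is a supersolution of the equations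
governing the weighted `L¹`-norm of the solution `w`. -/
structure IsWeight {n : ℕ} (S : ParabolicSystem n) (Ω : Set (RSpace n)) (T : ℝ)
    (μ w : RSpace n → ℝ → ℝ) (P : RSpace n → ℝ) (lam₁ lam₂ : ℝ) : Prop where
  contDiffOn_closure : ContDiffOn ℝ 1 P (closure Ω)
  contDiffOn : ContDiffOn ℝ 2 P Ω
  nonneg : ∀ x ∈ Ω, 0 ≤ P x
  zero : ∀ x ∈ frontier Ω, P x = 0
  lam₁_nonneg : 0 ≤ lam₁
  elliptic : ∀ x ∈ Ω, ∀ t ∈ Ioo 0 T, ∑ i, pderiv i (fun y => S.a y t * pderiv i P y) x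
    + ∑ i, S.b x t i * pderiv i P x ≤ -(lam₁ * P x)
  reaction : ∀ x ∈ Ω, ∀ t ∈ Ioo 0 T,
    lam₂ ≤ S.c x t - ∑ i, pderiv i (fun y => S.b y t i) x - μ x t
  convection : ∀ x ∈ Ω, ∀ t ∈ Ioo 0 T, S.g x t (w x t) * w x t * (∑ i, pderiv i P x * S.m x t i
    + P x * ∑ i, pderiv i (fun y => S.m y t i) x) ≤ 0

namespace IsWeight

variable {n : ℕ} {Ω : Set (RSpace n)} {S : ParabolicSystem n} {I : ParabolicInput n} {T : ℝ}
  {w μ : RSpace n → ℝ → ℝ} {P q : RSpace n → ℝ} {cLow lam₁ lam₂ δ : ℝ}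

/-- P is nonnegative and vanishes on ∂Ω, so its inward derivatives are nonnegative and cannot cancel
the positive inward derivative of δq. -/
lemma isBoundaryDefining_add (hP : IsWeight S Ω T μ w P lam₁ lam₂) (hΩ : IsSmoothBoundedDomain Ω)
    (hq : ContDiff ℝ 2 q) (hqpos : ∀ x ∈ Ω, 0 < q x) (hqzero : ∀ x ∈ frontier Ω, q x = 0)
    (hqin : ∀ x ∈ frontier Ω, ∃ v, (∀ᶠ σ : ℝ in 𝓝[>] 0, x + σ • v ∈ Ω) ∧ 0 < fderiv ℝ q x v)
    (hδ : 0 < δ) : IsBoundaryDefining Ω (fun x => P x + δ * q x) where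
  contDiffOn := hP.contDiffOn_closure.add ((hq.of_le one_le_two).contDiffOn.const_smul δ)
  pos x hx := add_pos_of_nonneg_of_pos (hP.nonneg x hx) (mul_pos hδ (hqpos x hx))
  zero x hx := by rw [hP.zero x hx, hqzero x hx]; ring
  fderiv_ne x hx h := by
    obtain ⟨v, hv, hvq⟩ := hqin x hx
    have hxc := frontier_subset_closure hx
    have hPd := (hP.contDiffOn_closure.differentiableOn one_ne_zero x hxc).hasFDerivWithinAt
    have hqd := ((hq.differentiable two_ne_zero) x).hasFDerivAt.hasFDerivWithinAt (s := closure Ω)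
    have h1 := (hPd.fun_add (hqd.const_mul δ)).fderivWithin (hΩ.uniqueDiffOn_closure x hxc)
    rw [h] at h1
    have h2 := DFunLike.congr_fun h1 v
    have h3 := nonneg_of_hasFDerivWithinAt_of_inward hPd subset_closure hP.nonneg (hP.zero x hx) hv
    simp only [zero_apply, add_apply, smul_apply, smul_eq_mul] at h2
    nlinarith [mul_pos hδ hvq]

lemma norm_fderivWithin_add_le (hP : IsWeight S Ω T μ w P lam₁ lam₂)
    (hΩ : IsSmoothBoundedDomain Ω) (hq : ContDiff ℝ 2 q) (hδ : 0 < δ) {x : RSpace n}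
    (hx : x ∈ closure Ω) : ‖fderivWithin ℝ (fun x => P x + δ * q x) (closure Ω) x‖ ≤
      ‖fderivWithin ℝ P (closure Ω) x‖ + δ * ‖fderiv ℝ q x‖ := by
  have hPd := (hP.contDiffOn_closure.differentiableOn one_ne_zero x hx).hasFDerivWithinAt
  have hqd := ((hq.differentiable two_ne_zero) x).hasFDerivAt.hasFDerivWithinAt (s := closure Ω)
  rw [(hPd.fun_add (hqd.const_mul δ)).fderivWithin (hΩ.uniqueDiffOn_closure x hx)]
  refine (norm_add_le _ _).trans ?_
  rw [norm_smul, Real.norm_of_nonneg hδ.le]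

/-- Adding a small multiple of a defining function to a weight gives a boundary defining weight. -/
lemma exists_isSuperWeight (hP : IsWeight S Ω T μ w P lam₁ lam₂) (hΩ : IsSmoothBoundedDomain Ω)
    (hS : S.IsSmooth Ω) (hw : IsDirichletSolution S I Ω T w)
    (hq : ContDiff ℝ 2 q) (hqpos : ∀ x ∈ Ω, 0 < q x) (hqzero : ∀ x ∈ frontier Ω, q x = 0)
    (hqin : ∀ x ∈ frontier Ω, ∃ v, (∀ᶠ σ : ℝ in 𝓝[>] 0, x + σ • v ∈ Ω) ∧ 0 < fderiv ℝ q x v) :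
    ∃ κ, 0 ≤ κ ∧ ∀ δ > 0,
      IsSuperWeight S Ω T μ w (fun x => P x + δ * q x) lam₁ lam₂ (δ * κ) := by
  have hq1 : ∀ i, ContDiff ℝ 1 (pderiv i q) := fun i =>
    (hq.fderiv_right (m := 1) (by norm_num)).clm_apply contDiff_const
  have hqprod : ∀ {V : Type} [NormedAddCommGroup V] [NormedSpace ℝ V] {f : RSpace n → V},
      ContDiff ℝ 1 f → ContDiffOn ℝ 1 (fun z : RSpace n × ℝ => f z.1) (closure Ω ×ˢ Ici 0) :=
    fun hf => (hf.comp contDiff_fst).contDiffOn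
  choose B₁ hB₁0 hB₁ using fun i : Fin n => hΩ.exists_bound_pderiv
    (F := fun x t => S.a x t * pderiv i q x) ((hS.a.of_le one_le_two).mul (hqprod (hq1 i))) T
  choose B₂ hB₂0 hB₂ using fun i : Fin n => hΩ.exists_bound_pderiv
    (F := fun x t => q x * S.m x t i)
    ((hqprod (hq.of_le one_le_two)).mul ((hS.m.of_le one_le_two).coord i)) T
  obtain ⟨B₃, hB₃⟩ := (hΩ.isCompact_closure.prod (isCompact_Icc (a := (0 : ℝ)) (b := T))
    ).exists_bound_of_continuousOn (f := fun z => ∑ i, S.b z.1 z.2 i * pderiv i q z.1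
      + lam₁ * q z.1) (by
      refine (continuousOn_finsetSum _ fun i _ => ?_).add
        ((hq.continuous.comp continuous_fst).continuousOn.const_mul lam₁)
      exact ((hS.b.coord i).continuousOn.mono (prod_mono le_rfl Icc_subset_Ici_self)).mul
        ((hq1 i).continuous.comp continuous_fst).continuousOn)
  obtain ⟨Bg, hBg0, hBg⟩ := hw.exists_bound_g hΩ hS
  -- The two entries bound the contribution of q to the elliptic and to the convection inequality.
  -- Neither depends on δ, so the total error is linear in δ.
  refine ⟨max (∑ i, B₁ i + B₃) (Bg * ∑ i, B₂ i), le_max_of_le_right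
    (mul_nonneg hBg0 (Finset.sum_nonneg fun i _ => hB₂0 i)), fun δ hδ => ?_⟩
  have hqΩ : ∀ x, DifferentiableAt ℝ q x := hq.differentiable two_ne_zero
  have hPΩ : ∀ x ∈ Ω, DifferentiableAt ℝ P x := fun x hx =>
    (hP.contDiffOn.contDiffAt (hΩ.isOpen.mem_nhds hx)).differentiableAt two_ne_zero
  have hpd : ∀ i, ∀ x ∈ Ω, pderiv i (fun x => P x + δ * q x) x = pderiv i P x + δ * pderiv i q x :=
    fun i x hx => by
      rw [pderiv_add (hPΩ x hx) ((hqΩ x).const_mul δ), pderiv_const_mul (hqΩ x)]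
  refine ⟨hP.isBoundaryDefining_add hΩ hq hqpos hqzero hqin hδ,
    hP.contDiffOn.add (hq.contDiffOn.const_smul δ), hP.lam₁_nonneg,
    mul_nonneg hδ.le (le_max_of_le_right
      (mul_nonneg hBg0 (Finset.sum_nonneg fun i _ => hB₂0 i))), fun x hx t ht => ?_, hP.reaction,
    fun x hx t ht => ?_⟩
  · have haΩ := (hS.a.of_le one_le_two).slice ht.1.le
    have ha : DifferentiableAt ℝ (fun y => S.a y t) x :=
      (haΩ.contDiffAt (hΩ.isOpen.mem_nhds hx)).differentiableAt one_ne_zero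
    have h1 := hP.elliptic x hx t ht
    have h2 : ∑ i, pderiv i (fun y => S.a y t * pderiv i q y) x ≤ ∑ i, B₁ i :=
      Finset.sum_le_sum fun i _ => (le_abs_self _).trans (hB₁ i x hx t ht i)
    have h3 := (le_abs_self _).trans (hB₃ (x, t) ⟨subset_closure hx, ht.1.le, ht.2.le⟩)
    simp only at h3
    have h4 : (∑ i, pderiv i (fun y => S.a y t * pderiv i q y) x)
        + (∑ i, S.b x t i * pderiv i q x + lam₁ * q x) ≤
        max (∑ i, B₁ i + B₃) (Bg * ∑ i, B₂ i) := (add_le_add h2 h3).trans (le_max_left _ _)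
    have h5 := mul_le_mul_of_nonneg_left h4 hδ.le
    rw [sum_pderiv_flux_add hΩ.isOpen hP.contDiffOn hq.contDiffOn hx ha]
    simp only [hpd _ x hx, mul_add, Finset.sum_add_distrib, mul_left_comm _ δ,
      ← Finset.mul_sum] at h1 h5 ⊢
    linarith
  · have hm : ∀ i, DifferentiableAt ℝ (fun y => S.m y t i) x := fun i =>
      ((((hS.m.of_le one_le_two).slice ht.1.le).coord i).contDiffAt
        (hΩ.isOpen.mem_nhds hx)).differentiableAt one_ne_zero
    have h1 := hP.convection x hx t ht
    have e : ∑ i, pderiv i q x * S.m x t i + q x * ∑ i, pderiv i (fun y => S.m y t i) x =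
        ∑ i, pderiv i (fun y => q y * S.m y t i) x := by
      rw [Finset.mul_sum, ← Finset.sum_add_distrib]
      refine Finset.sum_congr rfl fun i _ => ?_
      rw [pderiv_mul (hqΩ x) (hm i)]
      ring
    have h2 : |∑ i, pderiv i (fun y => q y * S.m y t i) x| ≤ ∑ i, B₂ i :=
      (Finset.abs_sum_le_sum_abs _ _).trans (Finset.sum_le_sum fun i _ => hB₂ i x hx t ht i)
    have h3 : S.g x t (w x t) * w x t * ∑ i, pderiv i (fun y => q y * S.m y t i) x ≤
        max (∑ i, B₁ i + B₃) (Bg * ∑ i, B₂ i) * |w x t| := by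
      refine (le_abs_self _).trans ?_
      rw [abs_mul, abs_mul]
      have h4 := mul_le_mul (hBg x (subset_closure hx) t (Ioo_subset_Icc_self ht)) h2
        (abs_nonneg _) hBg0
      have h5 := mul_le_mul_of_nonneg_right (h4.trans (le_max_right (∑ i, B₁ i + B₃) _))
        (abs_nonneg (w x t))
      linarith
    have h6 := mul_le_mul_of_nonneg_left h3 hδ.le
    rw [← e] at h6
    simp only [hpd _ x hx, add_mul, Finset.sum_add_distrib, mul_assoc, ← Finset.mul_sum] at h1 h6 ⊢
    linarith

/-- The weighted `L¹`-estimate for the norm weighted by `P`. -/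
theorem integral_le (hP : IsWeight S Ω T μ w P lam₁ lam₂) (hn : 0 < n)
    (hΩ : IsSmoothBoundedDomain Ω)
    (hS : S.IsSmooth Ω) (hI : I.IsAdmissible S Ω) (hsign : SignAssumption S Ω μ cLow)
    (ha : ∀ x ∈ closure Ω, ∀ t, 0 ≤ t → 0 ≤ S.a x t) (hw : IsDirichletSolution S I Ω T w)
    (hT : 0 < T) :
    Real.exp ((lam₁ + lam₂) * T) * ∫ x in Ω, P x * |w x T| ≤
      (∫ x in Ω, P x * |w x 0|)
      + (∫ t in 0..T, Real.exp ((lam₁ + lam₂) * t) * ∫ x in Ω, P x * |I.f x t|)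
      + (∫ t in 0..T, Real.exp ((lam₁ + lam₂) * t) * ∫ x in frontier Ω,
          S.a x t * |w x t| * ‖fderivWithin ℝ P (closure Ω) x‖
          ∂(Measure.euclideanHausdorffMeasure (n - 1) : Measure (RSpace n))) := by
  obtain ⟨q, hq, hqpos, hqzero, hqin⟩ := hΩ.exists_global_definingFunction
  obtain ⟨κ, hκ0, hκ⟩ := hP.exists_isSuperWeight hΩ hS hw hq hqpos hqzero hqin
  obtain ⟨M, hM0, hM⟩ := hw.exists_bound hΩ
  set lam := lam₁ + lam₂ with hlam
  have hsub : closure Ω ×ˢ Icc 0 T ⊆ closure Ω ×ˢ Ici 0 := prod_mono le_rfl Icc_subset_Ici_self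
  have hfcl := hI.f.continuousOn.mono hsub
  have hacl := hS.a.continuousOn.mono hsub
  have hPcl : ContinuousOn (fun z : RSpace n × ℝ => P z.1) (closure Ω ×ˢ Icc 0 T) :=
    hP.contDiffOn_closure.continuousOn.comp continuousOn_fst fun z hz => hz.1
  have hqcl : ContinuousOn (fun z : RSpace n × ℝ => q z.1) (closure Ω ×ˢ Icc 0 T) :=
    (hq.continuous.comp continuous_fst).continuousOn
  have hDPcl : ContinuousOn (fun z : RSpace n × ℝ => ‖fderivWithin ℝ P (closure Ω) z.1‖)
      (closure Ω ×ˢ Icc 0 T) :=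
    (IsBoundaryDefining.continuousOn_fderivWithin hΩ hP.contDiffOn_closure).norm.comp
      continuousOn_fst fun z hz => hz.1
  have hDqcl : ContinuousOn (fun z : RSpace n × ℝ => ‖fderiv ℝ q z.1‖) (closure Ω ×ˢ Icc 0 T) :=
    ((hq.continuous_fderiv two_ne_zero).norm.comp continuous_fst).continuousOn
  have hii : ∀ {r : ℝ → ℝ}, ContinuousOn r (Icc 0 T) →
      IntervalIntegrable (fun t => Real.exp (lam * t) * r t) volume 0 T := fun hr =>
    ContinuousOn.intervalIntegrable (by
      rw [uIcc_of_le hT.le]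
      exact (by fun_prop : ContinuousOn (fun t : ℝ => Real.exp (lam * t)) (Icc 0 T)).mul hr)
  have hcv : ∀ {v : RSpace n → ℝ → ℝ}, ContinuousOn (fun z : RSpace n × ℝ => v z.1 z.2)
      (closure Ω ×ˢ Icc 0 T) → ∀ δ : ℝ, ∀ t ∈ Icc 0 T, ∫ x in Ω, (P x + δ * q x) * |v x t| =
      (∫ x in Ω, P x * |v x t|) + δ * ∫ x in Ω, q x * |v x t| := fun {v} hv δ t ht => by
    have h1 : IntegrableOn (fun x => P x * |v x t|) Ω :=
      hΩ.integrableOn_slice (F := fun x t => P x * |v x t|) (hPcl.mul hv.abs) ht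
    have h2 : IntegrableOn (fun x => q x * |v x t|) Ω :=
      hΩ.integrableOn_slice (F := fun x t => q x * |v x t|) (hqcl.mul hv.abs) ht
    rw [← integral_const_mul, ← integral_add h1 (h2.const_mul δ)]
    exact integral_congr_ae (Eventually.of_forall fun x => by simp only; ring)
  have h0T : (0 : ℝ) ∈ Icc 0 T := left_mem_Icc.2 hT.le
  have hTT : T ∈ Icc 0 T := right_mem_Icc.2 hT.le
  set σ : Measure (RSpace n) := Measure.euclideanHausdorffMeasure (n - 1) with hσ
  have hcP := hΩ.continuousOn_integral (F := fun x t => P x * |I.f x t|) (hPcl.mul hfcl.abs)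
  have hcq := hΩ.continuousOn_integral (F := fun x t => q x * |I.f x t|) (hqcl.mul hfcl.abs)
  have hbPc := (hacl.mul hw.cont.abs).mul hDPcl
  have hbqc := (hacl.mul hw.cont.abs).mul hDqcl
  have hbP := IsSmoothBoundedDomain.continuousOn_integral_frontier hn hΩ
    (F := fun x t => S.a x t * |w x t| * ‖fderivWithin ℝ P (closure Ω) x‖) hbPc
  have hbq := IsSmoothBoundedDomain.continuousOn_integral_frontier hn hΩ
    (F := fun x t => S.a x t * |w x t| * ‖fderiv ℝ q x‖) hbqc
  set R := (∫ x in Ω, P x * |w x 0|)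
      + (∫ t in 0..T, Real.exp (lam * t) * ∫ x in Ω, P x * |I.f x t|)
      + (∫ t in 0..T, Real.exp (lam * t) * ∫ x in frontier Ω,
          S.a x t * |w x t| * ‖fderivWithin ℝ P (closure Ω) x‖ ∂σ) with hR
  set B := (∫ x in Ω, q x * |w x 0|)
      + (∫ t in 0..T, Real.exp (lam * t) * ∫ x in Ω, q x * |I.f x t|)
      + (∫ t in 0..T, Real.exp (lam * t) * ∫ x in frontier Ω,
          S.a x t * |w x t| * ‖fderiv ℝ q x‖ ∂σ)
      + κ * ((M + 1) * volume.real Ω * ∫ t in 0..T, Real.exp (lam * t)) with hB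
  -- Every term of the estimate for P + δq is bounded by its counterpart for P plus δ times a
  -- constant, so δ may tend to zero.
  have key : ∀ δ > 0, Real.exp (lam * T) * ∫ x in Ω, P x * |w x T| ≤ R + δ * B := fun δ hδ => by
    have h1 := (hκ δ hδ).integral_le hn hΩ hS hI hsign ha hw hT hM
    rw [hcv hw.cont δ T hTT, hcv hw.cont δ 0 h0T] at h1
    have h2 : ∫ t in 0..T, Real.exp (lam * t) * ∫ x in Ω, (P x + δ * q x) * |I.f x t| =
        (∫ t in 0..T, Real.exp (lam * t) * ∫ x in Ω, P x * |I.f x t|)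
        + δ * ∫ t in 0..T, Real.exp (lam * t) * ∫ x in Ω, q x * |I.f x t| := by
      rw [← intervalIntegral.integral_const_mul, ← intervalIntegral.integral_add (hii hcP)
        ((hii hcq).const_mul δ)]
      refine intervalIntegral.integral_congr fun t ht => ?_
      rw [uIcc_of_le hT.le] at ht
      rw [hcv hfcl δ t ht]
      ring
    -- The gradient norm is not additive, so the triangle inequality is used in place of the
    -- identity available for the other terms.
    have h3 : ∫ t in 0..T, Real.exp (lam * t) * ∫ x in frontier Ω, S.a x t * |w x t| *
          ‖fderivWithin ℝ (fun x => P x + δ * q x) (closure Ω) x‖ ∂σ ≤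
        (∫ t in 0..T, Real.exp (lam * t) * ∫ x in frontier Ω,
          S.a x t * |w x t| * ‖fderivWithin ℝ P (closure Ω) x‖ ∂σ)
        + δ * ∫ t in 0..T, Real.exp (lam * t) * ∫ x in frontier Ω,
          S.a x t * |w x t| * ‖fderiv ℝ q x‖ ∂σ := by
      rw [← intervalIntegral.integral_const_mul, ← intervalIntegral.integral_add (hii hbP)
        ((hii hbq).const_mul δ)]
      have hu1 := (hκ δ hδ).defining.contDiffOn
      have hDu : ContinuousOn (fun z : RSpace n × ℝ =>
          ‖fderivWithin ℝ (fun x => P x + δ * q x) (closure Ω) z.1‖) (closure Ω ×ˢ Icc 0 T) :=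
        (IsBoundaryDefining.continuousOn_fderivWithin hΩ hu1).norm.comp
          continuousOn_fst fun z hz => hz.1
      have hbuc := (hacl.mul hw.cont.abs).mul hDu
      refine intervalIntegral.integral_mono_on hT.le (hii
        (IsSmoothBoundedDomain.continuousOn_integral_frontier hn hΩ (F := fun x t =>
          S.a x t * |w x t| * ‖fderivWithin ℝ (fun x => P x + δ * q x) (closure Ω) x‖) hbuc))
        ((hii hbP).add ((hii hbq).const_mul δ)) fun t ht => ?_
      have hsl : ∀ {F : RSpace n × ℝ → ℝ}, ContinuousOn F (closure Ω ×ˢ Icc 0 T) →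
          IntegrableOn (fun x => F (x, t)) (frontier Ω) σ := fun hF =>
        IsBoundaryDefining.integrableOn_frontier hn hΩ (hF.comp (by fun_prop :
          ContinuousOn (fun x : RSpace n => (x, t)) (frontier Ω))
          fun x hx => ⟨frontier_subset_closure hx, ht⟩)
      have hslP := hsl hbPc
      have hslq := hsl hbqc
      have h4 := setIntegral_mono_on (hsl hbuc) (hslP.add (hslq.const_mul δ))
        isClosed_frontier.measurableSet fun x hx => ?_
      · rw [integral_add' hslP (hslq.const_mul δ), integral_const_mul] at h4
        have h5 := mul_le_mul_of_nonneg_left h4 (Real.exp_pos (lam * t)).le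
        rw [mul_add, mul_left_comm] at h5
        exact h5
      · have hxc := frontier_subset_closure hx
        have h5 := mul_le_mul_of_nonneg_left (hP.norm_fderivWithin_add_le hΩ hq hδ hxc)
          (mul_nonneg (ha x hxc t ht.1) (abs_nonneg (w x t)))
        rw [mul_add, mul_left_comm] at h5
        exact h5
    have h4 : 0 ≤ Real.exp (lam * T) * (δ * ∫ x in Ω, q x * |w x T|) :=
      mul_nonneg (Real.exp_pos _).le (mul_nonneg hδ.le (setIntegral_nonneg
        hΩ.isOpen.measurableSet fun x hx => mul_nonneg (hqpos x hx).le (abs_nonneg _)))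
    rw [h2] at h1
    rw [hR, hB]
    linarith
  have hl : Tendsto (fun δ : ℝ => R + δ * B) (𝓝[>] 0) (𝓝 (R + 0 * B)) :=
    ((by fun_prop : Continuous fun δ : ℝ => R + δ * B).tendsto 0).mono_left nhdsWithin_le_nhds
  rw [zero_mul, add_zero] at hl
  exact ge_of_tendsto hl (by filter_upwards [self_mem_nhdsWithin] with δ hδ using key δ hδ)

end IsWeight

/-! ### The weight is nonnegative -/

section

variable {n : ℕ}

/-- The second derivative is nonnegative at a local minimum. -/
lemma IsLocalMin.deriv_deriv_nonneg {f : ℝ → ℝ} {x : ℝ} (h : IsLocalMin f x)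
    (hc : ContinuousAt f x) : 0 ≤ deriv (deriv f) x := by
  by_contra! hlt
  -- A negative second derivative would make the point a local maximum too, hence f locally constant
  -- with zero second derivative.
  have hmax := isLocalMax_of_deriv_deriv_neg hlt h.deriv_eq_zero hc
  have hconst : f =ᶠ[𝓝 x] fun _ => f x := by
    filter_upwards [h, hmax] with y h1 h2 using le_antisymm h2 h1
  have h1 : deriv f =ᶠ[𝓝 x] fun _ => 0 := by
    filter_upwards [hconst.eventuallyEq_nhds] with y hy
    rw [hy.deriv_eq, deriv_const]
  rw [h1.deriv_eq, deriv_const] at hlt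
  exact lt_irrefl _ hlt

lemma hasDerivAt_comp_line {f : RSpace n → ℝ} {x : RSpace n} {i : Fin n} {s : ℝ}
    (hf : DifferentiableAt ℝ f (x + s • EuclideanSpace.single i 1)) :
    HasDerivAt (fun s : ℝ => f (x + s • EuclideanSpace.single i 1))
      (pderiv i f (x + s • EuclideanSpace.single i 1)) s := by
  have h1 : HasDerivAt (fun s : ℝ => x + s • (EuclideanSpace.single i 1 : RSpace n))
      (EuclideanSpace.single i 1) s := by
    simpa using ((hasDerivAt_id s).smul_const (EuclideanSpace.single i 1 : RSpace n)).const_add x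
  exact hf.hasFDerivAt.comp_hasDerivAt s h1

lemma IsLocalMin.pderiv_pderiv_nonneg {Ω : Set (RSpace n)} (hΩ : IsOpen Ω) {f : RSpace n → ℝ}
    (hf : ContDiffOn ℝ 2 f Ω) {x : RSpace n} (hx : x ∈ Ω) (h : IsLocalMin f x) (i : Fin n) :
    0 ≤ pderiv i (pderiv i f) x := by
  set γ : ℝ → RSpace n := fun s => x + s • EuclideanSpace.single i 1 with hγ
  have hγc : Continuous γ := by fun_prop
  have hγ0 : γ 0 = x := by simp [hγ]
  have hd : ∀ y ∈ Ω, DifferentiableAt ℝ f y := fun y hy =>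
    (hf.contDiffAt (hΩ.mem_nhds hy)).differentiableAt two_ne_zero
  have hev : ∀ᶠ s in 𝓝 (0 : ℝ), γ s ∈ Ω :=
    hγc.continuousAt.eventually_mem (by rw [hγ0]; exact hΩ.mem_nhds hx)
  have h1 : deriv (fun s => f (γ s)) =ᶠ[𝓝 0] fun s => pderiv i f (γ s) := by
    filter_upwards [hev] with s hs using (hasDerivAt_comp_line (hd _ hs)).deriv
  have hd2 : DifferentiableAt ℝ (pderiv i f) (x + (0 : ℝ) • EuclideanSpace.single i 1) := by
    rw [zero_smul, add_zero]
    exact ((hf.pderiv_of_isOpen hΩ (l := 1) (by norm_num) i).contDiffAt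
      (hΩ.mem_nhds hx)).differentiableAt one_ne_zero
  have h2 : deriv (deriv fun s => f (γ s)) 0 = pderiv i (pderiv i f) x := by
    rw [h1.deriv_eq, (hasDerivAt_comp_line hd2).deriv, zero_smul, add_zero]
  rw [← h2]
  have hmin : IsLocalMin (fun s => f (γ s)) 0 := by
    have h3 : ∀ᶠ y in 𝓝 (γ 0), f x ≤ f y := by rw [hγ0]; exact h
    have := hγc.continuousAt.eventually h3
    rw [← hγ0] at this
    exact this
  refine hmin.deriv_deriv_nonneg ?_
  exact (hasDerivAt_comp_line (hd _ (by simpa using hx))).continuousAt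

lemma pderiv_comp_coord {ζ : ℝ → ℝ} {ζ' : ℝ} {x : RSpace n} {j : Fin n}
    (hζ : HasDerivAt ζ ζ' (x j)) (i : Fin n) :
    pderiv i (fun y => ζ (y j)) x = if i = j then ζ' else 0 := by
  have h1 : HasFDerivAt (fun y : RSpace n => ζ (y j))
      (ζ' • (EuclideanSpace.proj j : RSpace n →L[ℝ] ℝ)) x :=
    hζ.comp_hasFDerivAt x (EuclideanSpace.proj (𝕜 := ℝ) j).hasFDerivAt
  rw [pderiv, h1.fderiv]
  by_cases h : i = j
  · simp [h]
  · simp [h, Ne.symm h]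

/-- The divergence form operator on functions of a single coordinate. -/
lemma sum_pderiv_flux_coord {ζ ζ' : ℝ → ℝ} {ζ'' : ℝ} {x : RSpace n} {j : Fin n} {a : RSpace n → ℝ}
    (ha : DifferentiableAt ℝ a x) (hζ : ∀ s : ℝ, HasDerivAt ζ (ζ' s) s)
    (hζ' : HasDerivAt ζ' ζ'' (x j)) :
    ∑ i, pderiv i (fun y => a y * pderiv i (fun y => ζ (y j)) y) x =
      a x * ζ'' + ζ' (x j) * pderiv j a x := by
  have h1 : ∀ i, (fun y => a y * pderiv i (fun y => ζ (y j)) y) =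
      fun y => a y * if i = j then ζ' (y j) else 0 := fun i =>
    funext fun y => by rw [pderiv_comp_coord (hζ _)]
  have hd : DifferentiableAt ℝ (fun y : RSpace n => ζ' (y j)) x :=
    (hζ'.comp_hasFDerivAt x (EuclideanSpace.proj (𝕜 := ℝ) j).hasFDerivAt).differentiableAt
  rw [Finset.sum_eq_single j]
  · simp only [h1, if_true]
    rw [pderiv_mul ha hd, pderiv_comp_coord hζ', if_pos rfl]
  · intro i _ hij
    simp only [h1, if_neg hij, mul_zero]
    simp [pderiv]
  · simp

/-- A supersolution vanishing on the boundary is nonnegative. -/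
theorem nonneg_of_elliptic_le {Ω : Set (RSpace n)} (hn : 0 < n) (hΩ : IsSmoothBoundedDomain Ω)
    {a p : RSpace n → ℝ} {b : RSpace n → RSpace n} {aLow B : ℝ} (haLow : 0 < aLow)
    (ha : ContDiffOn ℝ 1 a Ω) (ha_low : ∀ x ∈ Ω, aLow ≤ a x)
    (hB : ∀ x ∈ Ω, ∀ i, |pderiv i a x + b x i| ≤ B)
    (hpc : ContinuousOn p (closure Ω)) (hp : ContDiffOn ℝ 2 p Ω) (hp0 : ∀ x ∈ frontier Ω, p x = 0)
    (hL : ∀ x ∈ Ω, ∑ i, pderiv i (fun y => a y * pderiv i p y) x + ∑ i, b x i * pderiv i p x ≤ 0)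
    {x : RSpace n} (hx : x ∈ Ω) : 0 ≤ p x := by
  by_contra! hneg
  set j : Fin n := ⟨0, hn⟩
  have hB0 : 0 ≤ B := (abs_nonneg _).trans (hB x hx j)
  -- This choice gives aγ > |∂ⱼa + bⱼ|, so e^{γxⱼ} is a strict subsolution.
  set γ := B / aLow + 1 with hγ
  have hγ0 : 0 < γ := by positivity
  have hγB : B < aLow * γ := by rw [hγ, mul_add, mul_div_cancel₀ _ haLow.ne']; linarith
  set e : RSpace n → ℝ := fun y => Real.exp (γ * y j) with he
  have heC : ContDiff ℝ 2 e := by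
    have : ContDiff ℝ 2 (fun y : RSpace n => y j) := (EuclideanSpace.proj (𝕜 := ℝ) j).contDiff
    fun_prop
  obtain ⟨N, hN⟩ := hΩ.isCompact_closure.exists_bound_of_continuousOn heC.continuous.continuousOn
  have hN0 : 0 < N := (Real.exp_pos _).trans_le ((le_abs_self _).trans (hN x (subset_closure hx)))
  -- Small enough that p - εe^{γxⱼ} is lower at x than anywhere on the boundary, so that its minimum
  -- is interior.
  set ε := -p x / N with hε
  have hε0 : 0 < ε := div_pos (by linarith) hN0
  set v : RSpace n → ℝ := fun y => p y + (-ε) * e y with hv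
  have hvC : ContDiffOn ℝ 2 v Ω := hp.add (heC.contDiffOn.const_smul (-ε))
  have hvcl : ContinuousOn v (closure Ω) :=
    hpc.add (heC.continuous.continuousOn.const_smul (-ε))
  obtain ⟨y, hy, hmin⟩ := hΩ.isCompact_closure.exists_isMinOn ⟨x, subset_closure hx⟩ hvcl
  have hyΩ : y ∈ Ω := by
    rcases hΩ.closure_diff hy with h | h
    · exact h
    · exfalso
      have h1 : v y ≤ v x := hmin (subset_closure hx)
      have h2 : ε * e y ≤ -p x := by
        calc ε * e y ≤ ε * N := by gcongr; exact (le_abs_self _).trans (hN y hy)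
          _ = -p x := by rw [hε]; field_simp
      have h3 : 0 < ε * e x := mul_pos hε0 (Real.exp_pos _)
      simp only [hv, hp0 y h] at h1
      linarith
  have hloc : IsLocalMin v y := by
    filter_upwards [hΩ.isOpen.mem_nhds hyΩ] with z hz using hmin (subset_closure hz)
  have hnh := hΩ.isOpen.mem_nhds hyΩ
  have had : DifferentiableAt ℝ a y := (ha.contDiffAt hnh).differentiableAt one_ne_zero
  have hgrad : ∀ i, pderiv i v y = 0 := fun i => by
    rw [pderiv, hloc.fderiv_eq_zero]; rfl
  have hpos : 0 ≤ ∑ i, pderiv i (fun z => a z * pderiv i v z) y :=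
    Finset.sum_nonneg fun i _ => by
      have h1 : DifferentiableAt ℝ (pderiv i v) y :=
        ((hvC.pderiv_of_isOpen hΩ.isOpen (l := 1) (by norm_num) i).contDiffAt
          hnh).differentiableAt one_ne_zero
      rw [pderiv_mul had h1, hgrad, zero_mul, add_zero]
      exact mul_nonneg (haLow.le.trans (ha_low y hyΩ))
        (hloc.pderiv_pderiv_nonneg hΩ.isOpen hvC hyΩ i)
  have hexp : ∀ s : ℝ, HasDerivAt (fun s => Real.exp (γ * s)) (γ * Real.exp (γ * s)) s := fun s => by
    have := ((hasDerivAt_id s).const_mul γ).exp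
    simpa [mul_comm] using this
  rw [sum_pderiv_flux_add hΩ.isOpen hp heC.contDiffOn hyΩ had,
    sum_pderiv_flux_coord had hexp ((hexp _).const_mul γ)] at hpos
  have hpd : ∀ i, pderiv i p y = ε * if i = j then γ * Real.exp (γ * y j) else 0 := fun i => by
    have h1 := hgrad i
    rw [hv, pderiv_add ((hp.contDiffAt hnh).differentiableAt two_ne_zero)
      (((heC.differentiable two_ne_zero) y).const_mul (-ε)),
      pderiv_const_mul ((heC.differentiable two_ne_zero) y), pderiv_comp_coord (hexp _)] at h1
    linarith
  -- At the interior minimum ∇p = ε∇e and div(a∇p) ≥ ε div(a∇e), so the operator applied to p is at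
  -- least ε times its positive value on e, contradicting the supersolution property.
  have hLy := hL y hyΩ
  simp only [hpd, mul_ite, mul_zero, Finset.sum_ite_eq', Finset.mem_univ, if_true] at hLy
  have h2 : 0 < ε * γ * Real.exp (γ * y j) := by positivity
  have h3 : 0 < a y * γ + (pderiv j a y + b y j) := by
    have h4 := (abs_le.1 (hB y hyΩ j)).1
    have h5 := mul_le_mul_of_nonneg_right (ha_low y hyΩ) hγ0.le
    linarith
  have h4 := mul_pos h2 h3
  linarith

end

/-! ### Admissible weights -/

section weights

variable {n : ℕ} {Ω : Set (RSpace n)} {S : ParabolicSystem n} {I : ParabolicInput n} {T : ℝ}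
  {w μ : RSpace n → ℝ → ℝ} {p : RSpace n → ℝ} {p₀ aLow aUp bLow cLow k l t : ℝ}
  {ψ₁ : RSpace n → ℝ → ℝ} {ψ₂ : ℝ → ℝ} {j : Fin n}

lemma ParabolicSystem.IsSmooth.differentiableAt_a (hS : S.IsSmooth Ω) (hΩ : IsOpen Ω) {x : RSpace n}
    (hx : x ∈ Ω) (ht : 0 ≤ t) : DifferentiableAt ℝ (fun y => S.a y t) x :=
  (((hS.a.of_le one_le_two).slice ht).contDiffAt (hΩ.mem_nhds hx)).differentiableAt one_ne_zero

namespace DirichletAssumption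

lemma elliptic (hdir : DirichletAssumption S Ω p p₀ ψ₁ ψ₂) (hΩ : IsOpen Ω) {x : RSpace n}
    (hx : x ∈ Ω) (ht : 0 < t) : ∑ i, pderiv i (fun y => S.a y t * pderiv i p y) x
      + ∑ i, S.b x t i * pderiv i p x ≤ -p₀ := by
  have h := hdir.p_ineq x hx t ht
  rw [divWithin_eq_sum (hΩ.mem_nhds hx), inner_gradient_eq_sum] at h
  simpa only [PiLp.smul_apply, gradient_coord, smul_eq_mul] using h

lemma divWithin_smul_eq (hdir : DirichletAssumption S Ω p p₀ ψ₁ ψ₂) (hΩ : IsOpen Ω)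
    (hS : S.IsSmooth Ω) {s : Set (RSpace n)} {x : RSpace n} (hx : x ∈ Ω) (hs : Ω ⊆ s)
    (ht : 0 ≤ t) : divWithin (fun y => p y • S.m y t) s x =
      ∑ i, pderiv i p x * S.m x t i + p x * ∑ i, pderiv i (fun y => S.m y t i) x := by
  rw [divWithin_eq_sum (mem_of_superset (hΩ.mem_nhds hx) hs), Finset.mul_sum,
    ← Finset.sum_add_distrib]
  refine Finset.sum_congr rfl fun i _ => ?_
  have hp : DifferentiableAt ℝ p x :=
    (hdir.p_C2.contDiffAt (hΩ.mem_nhds hx)).differentiableAt two_ne_zero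
  have hm : DifferentiableAt ℝ (fun y => S.m y t i) x :=
    ((((hS.m.of_le one_le_two).slice ht).coord i).contDiffAt (hΩ.mem_nhds hx)).differentiableAt
      one_ne_zero
  simp only [PiLp.smul_apply, smul_eq_mul]
  rw [pderiv_mul hp hm]
  ring

lemma convection (hdir : DirichletAssumption S Ω p p₀ ψ₁ ψ₂) (hΩ : IsOpen Ω)
    (hS : S.IsSmooth Ω) {x : RSpace n} (hx : x ∈ Ω) (ht : 0 ≤ t) (s : ℝ) :
    S.g x t s * s * (∑ i, pderiv i p x * S.m x t i
      + p x * ∑ i, pderiv i (fun y => S.m y t i) x) ≤ 0 := by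
  rw [← hdir.divWithin_smul_eq hΩ hS hx subset_closure ht]
  exact hdir.g_sign x (subset_closure hx) t ht s

/-- Since p is independent of time, the maximum principle may be applied with the coefficients
frozen at the single time t = 1. -/
lemma p_nonneg (hdir : DirichletAssumption S Ω p p₀ ψ₁ ψ₂) (hn : 0 < n)
    (hΩ : IsSmoothBoundedDomain Ω) (hS : S.IsSmooth Ω) (hgrowth : GrowthAssumption S Ω aLow aUp)
    {x : RSpace n} (hx : x ∈ Ω) : 0 ≤ p x := by
  obtain ⟨B, -, hB⟩ := hΩ.exists_bound_pderiv (F := S.a) (hS.a.of_le one_le_two) 2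
  obtain ⟨N, hN⟩ := hΩ.isCompact_closure.exists_bound_of_continuousOn (f := fun x => S.b x 1)
    (hS.b.continuousOn.comp (by fun_prop : ContinuousOn (fun x : RSpace n => (x, (1 : ℝ))) _)
      fun x hx => ⟨hx, mem_Ici.2 zero_le_one⟩)
  refine nonneg_of_elliptic_le hn hΩ (a := fun x => S.a x 1) (b := fun x => S.b x 1) (B := B + N)
    hgrowth.aLow_pos ((hS.a.of_le one_le_two).slice zero_le_one)
    (fun x hx => (hgrowth.a_bounds x (subset_closure hx) 1 zero_le_one).1) (fun x hx i => ?_)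
    hdir.p_C1.continuousOn hdir.p_C2 hdir.p_boundary (fun x hx => ?_) hx
  · exact (abs_add_le _ _).trans (add_le_add (hB x hx 1 ⟨one_pos, one_lt_two⟩ i)
      ((PiLp.norm_apply_le (S.b x 1) i).trans (hN x (subset_closure hx))))
  · exact (hdir.elliptic hΩ.isOpen hx one_pos).trans (neg_nonpos.2 hdir.p₀_nonneg)

end DirichletAssumption

lemma SignAssumption.reaction (hsign : SignAssumption S Ω μ cLow) (hΩ : IsOpen Ω) {x : RSpace n}
    (hx : x ∈ Ω) (ht : 0 < t) :
    cLow ≤ S.c x t - ∑ i, pderiv i (fun y => S.b y t i) x - μ x t := by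
  have h := hsign.cLow_le x hx t ht
  rwa [divWithin_eq_sum (hΩ.mem_nhds hx)] at h

/-- The function `p` is a weight with decay rate `cLow`. -/
lemma DirichletAssumption.isWeight (hdir : DirichletAssumption S Ω p p₀ ψ₁ ψ₂) (hn : 0 < n)
    (hΩ : IsSmoothBoundedDomain Ω) (hS : S.IsSmooth Ω) (hgrowth : GrowthAssumption S Ω aLow aUp)
    (hsign : SignAssumption S Ω μ cLow) : IsWeight S Ω T μ w p 0 cLow where
  contDiffOn_closure := hdir.p_C1
  contDiffOn := hdir.p_C2
  nonneg x hx := hdir.p_nonneg hn hΩ hS hgrowth hx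
  zero := hdir.p_boundary
  lam₁_nonneg := le_rfl
  elliptic x hx t ht := by
    have := hdir.elliptic hΩ.isOpen hx ht.1
    have := hdir.p₀_nonneg
    linarith
  reaction x hx t ht := hsign.reaction hΩ.isOpen hx ht.1
  convection x hx t ht := hdir.convection hΩ.isOpen hS hx ht.1.le _

/-- The coordinates of the points of `Ω` are bounded by the maximal norm on the boundary. -/
lemma IsSmoothBoundedDomain.abs_coord_le (hΩ : IsSmoothBoundedDomain Ω) {x : RSpace n}
    (hx : x ∈ closure Ω) (j : Fin n) : |x j| ≤ maxBoundaryDist Ω := by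
  -- A nonconstant linear function attains its maximum over the closure on the boundary, since an
  -- interior point can be moved further in direction σeⱼ.
  have key : ∀ σ : ℝ, |σ| = 1 → σ * x j ≤ maxBoundaryDist Ω := fun σ hσ => by
    have hσ2 : σ * σ = 1 := by rw [← abs_mul_abs_self, hσ, one_mul]
    obtain ⟨y, hy, hmax⟩ := hΩ.isCompact_closure.exists_isMaxOn ⟨x, hx⟩
      (f := fun y : RSpace n => σ * y j) (by fun_prop)
    have hyf : y ∈ frontier Ω := by
      rcases hΩ.closure_diff hy with h | h
      · exfalso
        have hc : Continuous fun s : ℝ => y + s • (EuclideanSpace.single j σ : RSpace n) := by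
          fun_prop
        have hev : ∀ᶠ s in 𝓝 (0 : ℝ), y + s • (EuclideanSpace.single j σ : RSpace n) ∈ Ω :=
          hc.continuousAt.eventually_mem (by simpa using hΩ.isOpen.mem_nhds h)
        obtain ⟨s, hs, hs0⟩ := ((hev.filter_mono nhdsWithin_le_nhds).and
          (self_mem_nhdsWithin (s := Ioi (0 : ℝ)))).exists
        have h1 : σ * (y + s • (EuclideanSpace.single j σ : RSpace n)) j ≤ σ * y j :=
          hmax (subset_closure hs)
        simp only [PiLp.add_apply, PiLp.smul_apply, PiLp.single_apply, if_true, smul_eq_mul] at h1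
        have h2 : (0 : ℝ) < s := hs0
        nlinarith
      · exact h
    calc σ * x j ≤ σ * y j := hmax hx
      _ ≤ |σ * y j| := le_abs_self _
      _ = ‖y j‖ := by rw [abs_mul, hσ, one_mul, Real.norm_eq_abs]
      _ ≤ ‖y‖ := PiLp.norm_apply_le y j
      _ ≤ maxBoundaryDist Ω :=
        le_csSup (hΩ.isCompact_frontier.bddAbove_image continuous_norm.continuousOn)
          (mem_image_of_mem _ hyf)
  have h1 := key 1 (by simp)
  have h2 := key (-1) (by simp)
  exact abs_le.2 ⟨by linarith, by linarith⟩

end weights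

/-! ### The exponential modification of the weight -/

/-- The function `s ↦ 1 / (k + e^{ls})`. -/
noncomputable def expWeight (k l s : ℝ) : ℝ := (k + Real.exp (l * s))⁻¹

/-- The derivative of `expWeight k l`. -/
noncomputable def expWeightDeriv (k l s : ℝ) : ℝ :=
  -(l * Real.exp (l * s)) / (k + Real.exp (l * s)) ^ 2

section expWeight

variable {k l : ℝ}

lemma expWeight_pos (hk : 0 < k) (s : ℝ) : 0 < expWeight k l s := by
  have := Real.exp_pos (l * s)
  unfold expWeight; positivity

lemma hasDerivAt_exp_mul (l s : ℝ) :
    HasDerivAt (fun s => Real.exp (l * s)) (l * Real.exp (l * s)) s := by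
  have := ((hasDerivAt_id s).const_mul l).exp
  simpa [mul_comm] using this

lemma hasDerivAt_expWeight (hk : 0 < k) (s : ℝ) :
    HasDerivAt (expWeight k l) (expWeightDeriv k l s) s :=
  ((hasDerivAt_exp_mul l s).const_add k).fun_inv (by have := Real.exp_pos (l * s); positivity)

lemma hasDerivAt_expWeightDeriv (hk : 0 < k) (s : ℝ) :
    HasDerivAt (expWeightDeriv k l) (-(expWeight k l s * (l * Real.exp (l * s) *
      expWeight k l s) * (l - 2 * (l * Real.exp (l * s) * expWeight k l s)))) s := by
  have hE := Real.exp_pos (l * s)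
  have hQ : k + Real.exp (l * s) ≠ 0 := by positivity
  refine ((((hasDerivAt_exp_mul l s).const_mul l).fun_neg).fun_div
    (((hasDerivAt_exp_mul l s).const_add k).fun_pow 2) (by positivity)).congr_deriv ?_
  simp only [expWeight]
  field_simp
  ring

lemma contDiff_expWeight (hk : 0 < k) {m : WithTop ℕ∞} : ContDiff ℝ m (expWeight k l) :=
  ContDiff.inv (by fun_prop) fun s => by have := Real.exp_pos (l * s); positivity

lemma expWeightDeriv_eq (s : ℝ) :
    expWeightDeriv k l s = -(expWeight k l s * (l * Real.exp (l * s) * expWeight k l s)) := by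
  rw [expWeightDeriv, expWeight, div_eq_mul_inv, ← inv_pow]
  ring

/-- The pointwise estimate behind the decay rate. -/
lemma elliptic_expWeight_le {D aLow aUp bLow p₀ a p Lp pj aj bj s : ℝ} (hk : 0 < k) (hl : 0 < l)
    (hs : |s| ≤ D) (haLow : 0 < aLow) (ha : aLow ≤ a) (ha' : a ≤ aUp) (hp₀ : 0 < p₀) (hp : 0 ≤ p)
    (hLp : Lp ≤ -p₀) (hb : bLow ≤ (bj + aj) / a) (hlb : 0 < l + bLow)
    (hk₁ : 2 * l * Real.exp (l * D) / (l + bLow) < k)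
    (hk₂ : 2 * aUp * l * Real.exp (l * D) / p₀ * |pj| < k) :
    expWeight k l s * Lp + 2 * (a * (pj * expWeightDeriv k l s)) + p * (a *
      (-(expWeight k l s * (l * Real.exp (l * s) * expWeight k l s)
        * (l - 2 * (l * Real.exp (l * s) * expWeight k l s)))) + expWeightDeriv k l s * aj
      + bj * expWeightDeriv k l s) ≤ -(decayRate D aLow bLow k l * (p * expWeight k l s)) := by
  obtain ⟨hs1, hs2⟩ := abs_le.1 hs
  have hz := expWeight_pos (l := l) hk s
  have hE := Real.exp_pos (l * s)
  have hE1 : Real.exp (l * s) ≤ Real.exp (l * D) := Real.exp_le_exp.2 (by gcongr)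
  have hE2 : Real.exp (-(l * D)) ≤ Real.exp (l * s) :=
    Real.exp_le_exp.2 (by rw [← mul_neg]; gcongr)
  have ha0 : 0 < a := haLow.trans_le ha
  rw [expWeightDeriv_eq]
  set E := Real.exp (l * s)
  set E' := Real.exp (l * D)
  set z := expWeight k l s with hzdef
  have hzQ : z * (k + E) = 1 := inv_mul_cancel₀ (by positivity)
  set y := l * E * z with hy
  have hy0 : 0 < y := by positivity
  -- The cross term 2a∂ⱼp∂ⱼz is absorbed by zLp ≤ -p₀z; this is the purpose of the condition on k
  -- involving ∂ⱼp and p₀.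
  have hfirst : z * Lp + 2 * (a * (pj * -(z * y))) ≤ 0 := by
    have h1 : 2 * a * |pj| * (l * E) ≤ k * p₀ := by
      have haUp : 0 ≤ aUp := ha0.le.trans ha'
      rw [div_mul_eq_mul_div, div_lt_iff₀ hp₀] at hk₂
      calc 2 * a * |pj| * (l * E) ≤ 2 * aUp * |pj| * (l * E') := by gcongr
        _ = 2 * aUp * l * E' * |pj| := by ring
        _ ≤ k * p₀ := hk₂.le
    have h2 : -(2 * a * pj * (l * E)) ≤ k * p₀ := by
      have := mul_le_mul_of_nonneg_left (neg_le_abs pj) (by positivity : 0 ≤ 2 * a * (l * E))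
      linarith
    have h3 : Lp * (k + E) ≤ -p₀ * (k + E) := by gcongr
    have h4 : Lp * (k + E) - 2 * a * pj * (l * E) ≤ 0 := by
      have : 0 ≤ p₀ * E := by positivity
      linarith
    have h5 := mul_le_mul_of_nonneg_left h4 (by positivity : 0 ≤ z * z)
    have e : z * z * (Lp * (k + E) - 2 * a * pj * (l * E)) =
        z * Lp * (z * (k + E)) + 2 * (a * (pj * -(z * y))) := by rw [hy]; ring
    rw [e, hzQ, mul_one, mul_zero] at h5
    exact h5
  -- The bracket in the rate; the other lower bound on k makes it positive.
  set br := l + bLow - 2 / k * l * E' with hbr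
  have hbr0 : 0 < br := by
    rw [div_lt_iff₀ hlb] at hk₁
    have : 2 / k * l * E' < l + bLow := by
      rw [div_mul_eq_mul_div, div_mul_eq_mul_div, div_lt_iff₀ hk]; linarith
    rw [hbr]; linarith
  have hyk : 2 * y ≤ 2 / k * l * E' := by
    have h1 : z ≤ 1 / k := by
      rw [le_div_iff₀ hk]
      have : 0 ≤ z * E := by positivity
      linarith
    calc 2 * y = 2 * (l * E * z) := by rw [hy]
      _ ≤ 2 * (l * E' * (1 / k)) := by gcongr
      _ = _ := by ring
  -- The remaining terms equal -pzy(a(l - 2y) + aⱼ + bⱼ) with z' = -zy. Dividing the last factor by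
  -- a permits the assumed lower bound, and 2y ≤ (2/k)le^{lD}.
  have hbr1 : aLow * br ≤ a * (l - 2 * y) + (aj + bj) := by
    rw [le_div_iff₀ ha0] at hb
    have h1 : aLow * br ≤ a * br := by gcongr
    have h2 := mul_le_mul_of_nonneg_left hyk ha0.le
    rw [hbr] at h1 ⊢
    linarith
  have hy1 : l * Real.exp (-(l * D)) / (k + E') ≤ y := by
    rw [hy, hzdef, expWeight, ← div_eq_mul_inv]
    gcongr
  have hrate : decayRate D aLow bLow k l ≤ y * (a * (l - 2 * y) + (aj + bj)) := by
    calc decayRate D aLow bLow k l = l * Real.exp (-(l * D)) / (k + E') * (aLow * br) := by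
          rw [decayRate, hbr]; ring
      _ ≤ _ := mul_le_mul hy1 hbr1 (by positivity) hy0.le
  have h1 := mul_le_mul_of_nonneg_left hrate (by positivity : 0 ≤ p * z)
  linarith

lemma decayRate_pos {D aLow bLow : ℝ} (haLow : 0 < aLow) (hk : 0 < k) (hl : 0 < l)
    (hlb : 0 < l + bLow) (hk₁ : 2 * l * Real.exp (l * D) / (l + bLow) < k) :
    0 < decayRate D aLow bLow k l := by
  rw [div_lt_iff₀ hlb] at hk₁
  have h1 : 2 / k * l * Real.exp (l * D) < l + bLow := by
    rw [div_mul_eq_mul_div, div_mul_eq_mul_div, div_lt_iff₀ hk]; linarith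
  unfold decayRate
  have := Real.exp_pos (l * D)
  have := Real.exp_pos (-(l * D))
  exact mul_pos (by positivity) (by linarith)

end expWeight

section modifiedWeight

variable {n : ℕ} {Ω : Set (RSpace n)} {S : ParabolicSystem n} {I : ParabolicInput n} {T : ℝ}
  {w μ : RSpace n → ℝ → ℝ} {p : RSpace n → ℝ} {p₀ aLow aUp bLow cLow k l : ℝ}
  {ψ₁ : RSpace n → ℝ → ℝ} {ψ₂ : ℝ → ℝ} {j : Fin n}

/-- The divergence form operator applied to a product. -/
lemma sum_pderiv_flux_mul (hΩ : IsOpen Ω) {a P q : RSpace n → ℝ}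
    (hP : ContDiffOn ℝ 2 P Ω) (hq : ContDiffOn ℝ 2 q Ω) {x : RSpace n} (hx : x ∈ Ω)
    (ha : DifferentiableAt ℝ a x) :
    ∑ i, pderiv i (fun y => a y * pderiv i (fun x => P x * q x) y) x =
      q x * (∑ i, pderiv i (fun y => a y * pderiv i P y) x)
        + 2 * (a x * ∑ i, pderiv i P x * pderiv i q x)
        + P x * ∑ i, pderiv i (fun y => a y * pderiv i q y) x := by
  have h0 : ∀ {f : RSpace n → ℝ}, ContDiffOn ℝ 2 f Ω → ∀ y ∈ Ω, DifferentiableAt ℝ f y :=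
    fun hf y hy => (hf.contDiffAt (hΩ.mem_nhds hy)).differentiableAt two_ne_zero
  have h1 : ∀ {f : RSpace n → ℝ}, ContDiffOn ℝ 2 f Ω → ∀ i, DifferentiableAt ℝ (pderiv i f) x :=
    fun hf i => ((hf.pderiv_of_isOpen hΩ (l := 1) (by norm_num) i).contDiffAt
        (hΩ.mem_nhds hx)).differentiableAt one_ne_zero
  simp only [Finset.mul_sum]
  rw [← Finset.sum_add_distrib, ← Finset.sum_add_distrib]
  refine Finset.sum_congr rfl fun i _ => ?_
  have h2 : (fun y => a y * pderiv i (fun x => P x * q x) y) =ᶠ[𝓝 x]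
      fun y => P y * (a y * pderiv i q y) + q y * (a y * pderiv i P y) := by
    filter_upwards [hΩ.mem_nhds hx] with y hy
    rw [pderiv_mul (h0 hP y hy) (h0 hq y hy)]
    ring
  rw [pderiv_congr h2, pderiv_add ((h0 hP x hx).fun_mul (ha.fun_mul (h1 hq i)))
    ((h0 hq x hx).fun_mul (ha.fun_mul (h1 hP i))), pderiv_mul (h0 hP x hx) (ha.fun_mul (h1 hq i)),
    pderiv_mul (h0 hq x hx) (ha.fun_mul (h1 hP i))]
  ring

/-- The modified function `p / (k + e^{l x_j})` is a weight with decay rate `decayRate`. -/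
lemma DirichletAssumption.isWeight_mul_expWeight (hdir : DirichletAssumption S Ω p p₀ ψ₁ ψ₂)
    (hn : 0 < n) (hΩ : IsSmoothBoundedDomain Ω) (hS : S.IsSmooth Ω)
    (hgrowth : GrowthAssumption S Ω aLow aUp) (hsign : SignAssumption S Ω μ 0) (hp₀ : 0 < p₀)
    (hb : ∀ x ∈ Ω, ∀ t, 0 < t →
      bLow ≤ (S.b x t j + partialWithin j (fun y => S.a y t) Ω x) / S.a x t)
    (hl : max 0 (-bLow) < l)
    (hk₁ : 2 * l * Real.exp (l * maxBoundaryDist Ω) / (l + bLow) < k)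
    (hk₂ : ∀ x ∈ closure Ω, 2 * aUp * l * Real.exp (l * maxBoundaryDist Ω) / p₀
      * |partialWithin j p (closure Ω) x| < k)
    (hconv : ConvectionSign S Ω p j ∨ ∃ mUp : ℝ, 0 ≤ mUp ∧ ConvectionBound S Ω p j mUp ∧
      2 * l * Real.exp (l * maxBoundaryDist Ω) * mUp < k) :
    IsWeight S Ω T μ w (fun x => p x * expWeight k l (x j))
      (decayRate (maxBoundaryDist Ω) aLow bLow k l) 0 := by
  have hl0 : 0 < l := (le_max_left _ _).trans_lt hl
  have hlb : 0 < l + bLow := by linarith [(le_max_right 0 (-bLow)).trans_lt hl]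
  have hk : 0 < k := lt_trans (by positivity) hk₁
  have hzC : ContDiff ℝ 2 fun x : RSpace n => expWeight k l (x j) :=
    (contDiff_expWeight hk).comp (EuclideanSpace.proj (𝕜 := ℝ) j).contDiff
  have hz := fun x : RSpace n => expWeight_pos (l := l) hk (x j)
  have hp := fun x (hx : x ∈ Ω) => hdir.p_nonneg hn hΩ hS hgrowth hx
  have hpd : ∀ x ∈ Ω, DifferentiableAt ℝ p x := fun x hx =>
    (hdir.p_C2.contDiffAt (hΩ.isOpen.mem_nhds hx)).differentiableAt two_ne_zero
  have hprod : ∀ x ∈ Ω, ∀ v : RSpace n, ∑ i, pderiv i (fun x => p x * expWeight k l (x j)) x * v i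
      = expWeight k l (x j) * (∑ i, pderiv i p x * v i)
        + p x * (expWeightDeriv k l (x j) * v j) := fun x hx v => by
    have e : ∀ i, pderiv i (fun x => p x * expWeight k l (x j)) x * v i =
        expWeight k l (x j) * (pderiv i p x * v i)
        + if i = j then p x * (expWeightDeriv k l (x j) * v i) else 0 := fun i => by
      rw [pderiv_mul (hpd x hx) ((hzC.differentiable two_ne_zero) x),
        pderiv_comp_coord (hasDerivAt_expWeight hk _)]
      split_ifs <;> ring
    simp only [e, Finset.sum_add_distrib, ← Finset.mul_sum, Finset.sum_ite_eq', Finset.mem_univ,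
      if_true]
  refine ⟨hdir.p_C1.mul (hzC.of_le one_le_two).contDiffOn, hdir.p_C2.mul hzC.contDiffOn,
    fun x hx => mul_nonneg (hp x hx) (hz x).le, fun x hx => by rw [hdir.p_boundary x hx, zero_mul],
    (decayRate_pos hgrowth.aLow_pos hk hl0 hlb hk₁).le, fun x hx t ht => ?_,
    fun x hx t ht => hsign.reaction hΩ.isOpen hx ht.1, fun x hx t ht => ?_⟩
  · have ha := hS.differentiableAt_a hΩ.isOpen hx ht.1.le
    have hLp := hdir.elliptic hΩ.isOpen hx ht.1
    have hbx := hb x hx t ht.1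
    have hkx := hk₂ x (subset_closure hx)
    rw [partialWithin_eq_pderiv (hΩ.isOpen.mem_nhds hx)] at hbx
    rw [partialWithin_eq_pderiv (mem_of_superset (hΩ.isOpen.mem_nhds hx) subset_closure)] at hkx
    have hab := hgrowth.a_bounds x (subset_closure hx) t ht.1.le
    have key := elliptic_expWeight_le hk hl0 (hΩ.abs_coord_le (subset_closure hx) j)
      hgrowth.aLow_pos hab.1 hab.2 hp₀ (hp x hx) hLp hbx hlb hk₁ hkx
    rw [sum_pderiv_flux_mul hΩ.isOpen hdir.p_C2 hzC.contDiffOn hx ha,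
      sum_pderiv_flux_coord ha (hasDerivAt_expWeight hk) (hasDerivAt_expWeightDeriv hk (x j))]
    have e1 : ∑ i, S.b x t i * pderiv i (fun x => p x * expWeight k l (x j)) x =
        expWeight k l (x j) * (∑ i, S.b x t i * pderiv i p x)
        + p x * (expWeightDeriv k l (x j) * S.b x t j) := by
      simpa only [mul_comm (S.b x t _)] using hprod x hx (S.b x t)
    have e2 : ∑ i, pderiv i p x * pderiv i (fun x : RSpace n => expWeight k l (x j)) x =
        pderiv j p x * expWeightDeriv k l (x j) := by
      simp [pderiv_comp_coord (hasDerivAt_expWeight hk _)]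
    rw [e1, e2]
    linarith
  · rw [hprod x hx]
    have hgs := hdir.convection hΩ.isOpen hS hx ht.1.le (w x t)
    set d := ∑ i, pderiv i p x * S.m x t i + p x * ∑ i, pderiv i (fun y => S.m y t i) x with hd
    set z := expWeight k l (x j) with hzdef
    have hz0 : 0 < z := hz x
    -- Since div(pzm) = z div(pm) + z'pmⱼ, the modification adds only the term with z', and z' < 0.
    have e : S.g x t (w x t) * w x t * (z * (∑ i, pderiv i p x * S.m x t i)
        + p x * (expWeightDeriv k l (x j) * S.m x t j)
        + p x * z * ∑ i, pderiv i (fun y => S.m y t i) x) =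
        z * (S.g x t (w x t) * w x t * d)
        + expWeightDeriv k l (x j) * (p x * S.m x t j * S.g x t (w x t) * w x t) := by
      rw [hd]; ring
    rw [e, expWeightDeriv_eq, ← hzdef]
    have hE := Real.exp_pos (l * x j)
    rcases hconv with hA | ⟨mUp, hm0, hB, hkm⟩
    · have h1 := hA x hx t ht.1 (w x t)
      have h2 := mul_nonneg hz0.le (neg_nonneg.2 hgs)
      have h3 : 0 ≤ z * (l * Real.exp (l * x j) * z) := by positivity
      have h4 := mul_nonneg h3 (sub_nonneg.2 h1)
      linarith
    -- Writing pmⱼ = r div(pm), both terms combine to z(1 - yr) g w div(pm) with y = le^{lxⱼ}z. The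
    -- condition on k gives y|r| ≤ 1, so the sign is preserved.
    · obtain ⟨hd0, hdm⟩ := hB x hx t ht.1
      rw [hdir.divWithin_smul_eq hΩ.isOpen hS hx le_rfl ht.1.le, ← hd] at hd0 hdm
      set r := p x * S.m x t j / d with hr
      have hrd : p x * S.m x t j = r * d := by rw [hr]; field_simp
      have hzk : z * k ≤ 1 := by
        have h1 : z * (k + Real.exp (l * x j)) = 1 := by
          rw [hzdef, expWeight]; field_simp
        have h2 := mul_pos hz0 hE
        linarith
      have h1 : l * Real.exp (l * x j) * z * |r| ≤ 1 := by
        have hE1 : Real.exp (l * x j) ≤ Real.exp (l * maxBoundaryDist Ω) :=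
          Real.exp_le_exp.2 (mul_le_mul_of_nonneg_left
            (abs_le.1 (hΩ.abs_coord_le (subset_closure hx) j)).2 hl0.le)
        calc l * Real.exp (l * x j) * z * |r| ≤
              l * Real.exp (l * maxBoundaryDist Ω) * z * mUp := by gcongr
          _ = z * (l * Real.exp (l * maxBoundaryDist Ω) * mUp) := by ring
          _ ≤ z * k := by
              refine mul_le_mul_of_nonneg_left ?_ hz0.le
              have : 0 ≤ l * Real.exp (l * maxBoundaryDist Ω) * mUp := by positivity
              linarith
          _ ≤ 1 := hzk
      have h2 : 0 ≤ 1 - l * Real.exp (l * x j) * z * r := by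
        have := mul_le_mul_of_nonneg_left (le_abs_self r)
          (by positivity : 0 ≤ l * Real.exp (l * x j) * z)
        linarith
      have h3 := mul_nonneg (mul_nonneg hz0.le h2) (neg_nonneg.2 hgs)
      rw [hrd]
      linarith

end modifiedWeight

/-! ### Estimates in Orlicz norms -/

lemma luxemburgNorm_congr {Φ : ℝ → ℝ} {T : ℝ} {u v : ℝ → ℝ} (h : ∀ t ∈ Ioo 0 T, u t = v t) :
    luxemburgNorm Φ T u = luxemburgNorm Φ T v := by
  unfold luxemburgNorm
  congr 1
  ext k
  have : ∫⁻ t in Ioo 0 T, ENNReal.ofReal (Φ (|u t| / k)) =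
      ∫⁻ t in Ioo 0 T, ENNReal.ofReal (Φ (|v t| / k)) :=
    setLIntegral_congr_fun measurableSet_Ioo fun t ht => by rw [h t ht]
  simp only [mem_ofPred_eq, this]

section estimates

variable {n : ℕ} {Ω : Set (RSpace n)} {S : ParabolicSystem n} {I : ParabolicInput n} {T : ℝ}
  {w μ : RSpace n → ℝ → ℝ} {p P : RSpace n → ℝ} {p₀ aLow aUp bLow cLow k l lam₁ lam₂ z₁ z₂ : ℝ}
  {ψ₁ : RSpace n → ℝ → ℝ} {ψ₂ : ℝ → ℝ} {j : Fin n} {φ : ℝ → ℝ} {δ₀ δ₁ : ℝ}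

lemma norm_gradientWithin (s : Set (RSpace n)) (x : RSpace n) :
    ‖gradientWithin p s x‖ = ‖fderivWithin ℝ p s x‖ := by
  rw [gradientWithin, LinearIsometryEquiv.norm_map]

/-- On the boundary, the solution is determined by the boundary disturbance. -/
lemma DirichletAssumption.abs_boundaryTerm (hdir : DirichletAssumption S Ω p p₀ ψ₁ ψ₂)
    (ha : ∀ x ∈ closure Ω, ∀ t, 0 ≤ t → 0 ≤ S.a x t) (hw : IsDirichletSolution S I Ω T w)
    {x : RSpace n} (hx : x ∈ frontier Ω) {t : ℝ} (ht : t ∈ Ioo 0 T) :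
    |boundaryTerm S I Ω p ψ₁ ψ₂ x t| = S.a x t * |w x t| * ‖fderivWithin ℝ p (closure Ω) x‖ := by
  obtain ⟨ψLow, hψ0, hψ⟩ := hdir.ψ₁_low
  have h1 : I.d x t / ψ₁ x t = ψ₂ (w x t) := by
    rw [← hw.boundary x hx t ht, hdir.ψ_eq x hx t ht.1.le,
      mul_div_cancel_left₀ _ (hψ0.trans_le (hψ x hx t ht.1.le)).ne']
  rw [boundaryTerm, h1, Function.leftInverse_invFun hdir.ψ₂_mono.injective, norm_gradientWithin,
    abs_mul, abs_mul, abs_of_nonneg (ha x (frontier_subset_closure hx) t ht.1.le),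
    abs_of_nonneg (norm_nonneg _)]

/-- The weighted estimate, with a weight comparable to `p`, in terms of Luxemburg norms. -/
theorem IsWeight.normL1_le (hP : IsWeight S Ω T μ w P lam₁ lam₂) (hlam : 0 < lam₁ + lam₂)
    (hn : 0 < n) (hΩ : IsSmoothBoundedDomain Ω) (hS : S.IsSmooth Ω) (hI : I.IsAdmissible S Ω)
    (hsign : SignAssumption S Ω μ cLow) (ha : ∀ x ∈ closure Ω, ∀ t, 0 ≤ t → 0 ≤ S.a x t)
    (hdir : DirichletAssumption S Ω p p₀ ψ₁ ψ₂) (hw : IsDirichletSolution S I Ω T w) (hT : 0 < T)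
    (hφ : IsTolksdorf φ δ₀ δ₁) (hp : ∀ x ∈ Ω, 0 ≤ p x) (hz₁ : 0 < z₁) (hz₂ : 0 < z₂)
    (hP₁ : ∀ x ∈ Ω, z₁ * p x ≤ P x) (hP₂ : ∀ x ∈ Ω, P x ≤ z₂ * p x)
    (hDP : ∀ x ∈ frontier Ω, ‖fderivWithin ℝ P (closure Ω) x‖ ≤
      z₂ * ‖fderivWithin ℝ p (closure Ω) x‖) :
    normL1 Ω (fun x => p x * w x T) ≤
      z₂ / z₁ * Real.exp (-((lam₁ + lam₂) * T)) * normL1 Ω (fun x => p x * I.w₀ x)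
      + z₂ / z₁ * orliczGain φ δ₀ δ₁ (lam₁ + lam₂) *
          normOrliczL1Boundary (youngFn φ) T Ω (boundaryTerm S I Ω p ψ₁ ψ₂)
      + z₂ / z₁ * orliczGain φ δ₀ δ₁ (lam₁ + lam₂) *
          normOrliczL1 (youngFn φ) T Ω (fun x t => p x * I.f x t) := by
  have hmain := hP.integral_le hn hΩ hS hI hsign ha hw hT
  set lam := lam₁ + lam₂ with hlamdef
  set σ : Measure (RSpace n) := Measure.euclideanHausdorffMeasure (n - 1) with hσ
  have hsub : closure Ω ×ˢ Icc 0 T ⊆ closure Ω ×ˢ Ici 0 := prod_mono le_rfl Icc_subset_Ici_self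
  have hfcl := hI.f.continuousOn.mono hsub
  have hacl := hS.a.continuousOn.mono hsub
  have hpcl : ContinuousOn (fun z : RSpace n × ℝ => p z.1) (closure Ω ×ˢ Icc 0 T) :=
    hdir.p_C1.continuousOn.comp continuousOn_fst fun z hz => hz.1
  have hPcl : ContinuousOn (fun z : RSpace n × ℝ => P z.1) (closure Ω ×ˢ Icc 0 T) :=
    hP.contDiffOn_closure.continuousOn.comp continuousOn_fst fun z hz => hz.1
  have hDcl : ∀ {f : RSpace n → ℝ}, ContDiffOn ℝ 1 f (closure Ω) →
      ContinuousOn (fun z : RSpace n × ℝ => ‖fderivWithin ℝ f (closure Ω) z.1‖)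
      (closure Ω ×ˢ Icc 0 T) := fun hf =>
    (IsBoundaryDefining.continuousOn_fderivWithin hΩ hf).norm.comp
      continuousOn_fst fun z hz => hz.1
  have h0T : (0 : ℝ) ∈ Icc 0 T := left_mem_Icc.2 hT.le
  have hTT : T ∈ Icc 0 T := right_mem_Icc.2 hT.le
  have hnorm : ∀ v : RSpace n → ℝ, normL1 Ω (fun x => p x * v x) = ∫ x in Ω, p x * |v x| :=
    fun v => setIntegral_congr_fun hΩ.isOpen.measurableSet fun x hx => by
      rw [abs_mul, abs_of_nonneg (hp x hx)]
  have hup : ∀ {v : RSpace n → ℝ → ℝ}, ContinuousOn (fun z : RSpace n × ℝ => v z.1 z.2)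
      (closure Ω ×ˢ Icc 0 T) → ∀ t ∈ Icc 0 T, ∫ x in Ω, P x * |v x t| ≤
      z₂ * ∫ x in Ω, p x * |v x t| := fun {v} hv t ht => by
    rw [← integral_const_mul]
    refine setIntegral_mono_on (hΩ.integrableOn_slice (F := fun x t => P x * |v x t|)
      (hPcl.mul hv.abs) ht) ((hΩ.integrableOn_slice (F := fun x t => p x * |v x t|)
      (hpcl.mul hv.abs) ht).const_mul z₂) hΩ.isOpen.measurableSet fun x hx => ?_
    have := mul_le_mul_of_nonneg_right (hP₂ x hx) (abs_nonneg (v x t))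
    linarith
  have hlow : z₁ * ∫ x in Ω, p x * |w x T| ≤ ∫ x in Ω, P x * |w x T| := by
    rw [← integral_const_mul]
    refine setIntegral_mono_on ((hΩ.integrableOn_slice (F := fun x t => p x * |w x t|)
      (hpcl.mul hw.cont.abs) hTT).const_mul z₁) (hΩ.integrableOn_slice
      (F := fun x t => P x * |w x t|) (hPcl.mul hw.cont.abs) hTT) hΩ.isOpen.measurableSet
      fun x hx => ?_
    have := mul_le_mul_of_nonneg_right (hP₁ x hx) (abs_nonneg (w x T))
    linarith
  have hexp : ∀ {r : ℝ → ℝ}, ContinuousOn r (Icc 0 T) →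
      IntervalIntegrable (fun t => Real.exp (lam * t) * r t) volume 0 T := fun hr =>
    ContinuousOn.intervalIntegrable (by
      rw [uIcc_of_le hT.le]
      exact (by fun_prop : ContinuousOn (fun t : ℝ => Real.exp (lam * t)) (Icc 0 T)).mul hr)
  -- Factoring out e^{λT} leaves the kernel e^{-λ(T-t)} of the Hölder inequality.
  have horl : ∀ {r : ℝ → ℝ}, ContinuousOn r (Icc 0 T) → (∀ t ∈ Icc 0 T, 0 ≤ r t) →
      ∫ t in 0..T, Real.exp (lam * t) * r t ≤
        Real.exp (lam * T) * (orliczGain φ δ₀ δ₁ lam * luxemburgNorm (youngFn φ) T r) :=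
    fun {r} hr hr0 => by
      obtain ⟨M, hM⟩ := isCompact_Icc.exists_bound_of_continuousOn hr
      have h1 := hφ.setIntegral_exp_mul_le hlam hT (hr.mono Ioo_subset_Icc_self)
        (fun t ht => hr0 t (Ioo_subset_Icc_self ht))
        (fun t ht => (le_abs_self _).trans (hM t (Ioo_subset_Icc_self ht)))
      have h2 := mul_le_mul_of_nonneg_left h1 (Real.exp_pos (lam * T)).le
      refine le_trans (le_of_eq ?_) h2
      rw [intervalIntegral.integral_of_le hT.le, integral_Ioc_eq_integral_Ioo,
        ← integral_const_mul]
      refine integral_congr_ae (Eventually.of_forall fun t => ?_)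
      simp only
      rw [← mul_assoc, ← Real.exp_add]
      congr 2
      ring
  set U : ℝ → ℝ := fun t => ∫ x in Ω, p x * |I.f x t| with hU
  set V : ℝ → ℝ := fun t => ∫ x in frontier Ω,
    S.a x t * |w x t| * ‖fderivWithin ℝ p (closure Ω) x‖ ∂σ with hV
  have hUc : ContinuousOn U (Icc 0 T) :=
    hΩ.continuousOn_integral (F := fun x t => p x * |I.f x t|) (hpcl.mul hfcl.abs)
  have hPUc : ContinuousOn (fun t => ∫ x in Ω, P x * |I.f x t|) (Icc 0 T) :=
    hΩ.continuousOn_integral (F := fun x t => P x * |I.f x t|) (hPcl.mul hfcl.abs)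
  have hVcl := (hacl.mul hw.cont.abs).mul (hDcl hdir.p_C1)
  have hPVcl := (hacl.mul hw.cont.abs).mul (hDcl hP.contDiffOn_closure)
  have hVc : ContinuousOn V (Icc 0 T) := IsSmoothBoundedDomain.continuousOn_integral_frontier hn hΩ
    (F := fun x t => S.a x t * |w x t| * ‖fderivWithin ℝ p (closure Ω) x‖) hVcl
  have hPVc : ContinuousOn (fun t => ∫ x in frontier Ω,
      S.a x t * |w x t| * ‖fderivWithin ℝ P (closure Ω) x‖ ∂σ) (Icc 0 T) :=
    IsSmoothBoundedDomain.continuousOn_integral_frontier hn hΩ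
      (F := fun x t => S.a x t * |w x t| * ‖fderivWithin ℝ P (closure Ω) x‖) hPVcl
  have hU0 : ∀ t ∈ Icc 0 T, 0 ≤ U t := fun t _ => setIntegral_nonneg hΩ.isOpen.measurableSet
    fun x hx => mul_nonneg (hp x hx) (abs_nonneg _)
  have hV0 : ∀ t ∈ Icc 0 T, 0 ≤ V t := fun t ht => setIntegral_nonneg
    isClosed_frontier.measurableSet fun x hx => mul_nonneg (mul_nonneg
      (ha x (frontier_subset_closure hx) t ht.1) (abs_nonneg _)) (norm_nonneg _)
  have hfU : normOrliczL1 (youngFn φ) T Ω (fun x t => p x * I.f x t) =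
      luxemburgNorm (youngFn φ) T U := luxemburgNorm_congr fun t _ => hnorm _
  have hfV : normOrliczL1Boundary (youngFn φ) T Ω (boundaryTerm S I Ω p ψ₁ ψ₂) =
      luxemburgNorm (youngFn φ) T V := luxemburgNorm_congr fun t ht =>
    setIntegral_congr_fun isClosed_frontier.measurableSet fun x hx =>
      hdir.abs_boundaryTerm ha hw hx ht
  have h1 : ∫ t in 0..T, Real.exp (lam * t) * ∫ x in Ω, P x * |I.f x t| ≤
      z₂ * ∫ t in 0..T, Real.exp (lam * t) * U t := by
    rw [← intervalIntegral.integral_const_mul]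
    refine intervalIntegral.integral_mono_on hT.le (hexp hPUc) ((hexp hUc).const_mul z₂)
      fun t ht => ?_
    rw [mul_left_comm]
    exact mul_le_mul_of_nonneg_left (hup hfcl t ht) (Real.exp_pos _).le
  have h2 : ∫ t in 0..T, Real.exp (lam * t) * ∫ x in frontier Ω,
      S.a x t * |w x t| * ‖fderivWithin ℝ P (closure Ω) x‖ ∂σ ≤
      z₂ * ∫ t in 0..T, Real.exp (lam * t) * V t := by
    rw [← intervalIntegral.integral_const_mul]
    refine intervalIntegral.integral_mono_on hT.le (hexp hPVc) ((hexp hVc).const_mul z₂)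
      fun t ht => ?_
    rw [mul_left_comm]
    refine mul_le_mul_of_nonneg_left ?_ (Real.exp_pos _).le
    rw [hV, ← integral_const_mul]
    have hsl : ∀ {F : RSpace n × ℝ → ℝ}, ContinuousOn F (closure Ω ×ˢ Icc 0 T) →
        IntegrableOn (fun x => F (x, t)) (frontier Ω) σ := fun hF =>
      IsBoundaryDefining.integrableOn_frontier hn hΩ (hF.comp (by fun_prop :
        ContinuousOn (fun x : RSpace n => (x, t)) (frontier Ω))
        fun x hx => ⟨frontier_subset_closure hx, ht⟩)
    refine setIntegral_mono_on (hsl hPVcl) ((hsl hVcl).const_mul z₂)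
      isClosed_frontier.measurableSet fun x hx => ?_
    have := mul_le_mul_of_nonneg_left (hDP x hx) (mul_nonneg
      (ha x (frontier_subset_closure hx) t ht.1) (abs_nonneg (w x t)))
    linarith
  have h3 := hup hw.cont 0 h0T
  have hw0 : ∫ x in Ω, p x * |w x 0| = ∫ x in Ω, p x * |I.w₀ x| :=
    setIntegral_congr_fun hΩ.isOpen.measurableSet fun x hx => by rw [hw.initial x hx]
  rw [hw0] at h3
  rw [hfU, hfV, hnorm, hnorm]
  set A := ∫ x in Ω, p x * |w x T|
  set A₀ := ∫ x in Ω, p x * |I.w₀ x|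
  have h4 : Real.exp (lam * T) * (z₁ * A) ≤ z₂ * A₀
      + z₂ * (Real.exp (lam * T) * (orliczGain φ δ₀ δ₁ lam * luxemburgNorm (youngFn φ) T U))
      + z₂ * (Real.exp (lam * T) * (orliczGain φ δ₀ δ₁ lam * luxemburgNorm (youngFn φ) T V)) := by
    have h5 := mul_le_mul_of_nonneg_left hlow (Real.exp_pos (lam * T)).le
    have h6 := mul_le_mul_of_nonneg_left (horl hUc hU0) hz₂.le
    have h7 := mul_le_mul_of_nonneg_left (horl hVc hV0) hz₂.le
    linarith
  have h5 := mul_le_mul_of_nonneg_left h4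
    (by positivity : 0 ≤ Real.exp (-(lam * T)) * z₁⁻¹)
  have e1 : Real.exp (-(lam * T)) * Real.exp (lam * T) = 1 := by
    rw [← Real.exp_add, neg_add_cancel, Real.exp_zero]
  have e2 : z₁⁻¹ * z₁ = 1 := inv_mul_cancel₀ hz₁.ne'
  calc A = (Real.exp (-(lam * T)) * Real.exp (lam * T)) * (z₁⁻¹ * z₁) * A := by
        rw [e1, e2]; ring
    _ = Real.exp (-(lam * T)) * z₁⁻¹ * (Real.exp (lam * T) * (z₁ * A)) := by ring
    _ ≤ _ := h5
    _ = z₂ / z₁ * Real.exp (-(lam * T)) * A₀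
        + (Real.exp (-(lam * T)) * Real.exp (lam * T)) * (z₂ / z₁ * orliczGain φ δ₀ δ₁ lam *
          luxemburgNorm (youngFn φ) T V)
        + (Real.exp (-(lam * T)) * Real.exp (lam * T)) * (z₂ / z₁ * orliczGain φ δ₀ δ₁ lam *
          luxemburgNorm (youngFn φ) T U) := by ring
    _ = _ := by rw [e1, one_mul, one_mul]

end estimates

/-! ### Input-to-state stability -/

lemma isClassK_const_mul {c : ℝ} (hc : 0 < c) : IsClassK fun s => c * s where
  cont := by fun_prop
  strictMono := fun _ _ _ _ h => mul_lt_mul_of_pos_left h hc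
  zero := mul_zero c

lemma isClassKL_exp {K c : ℝ} (hK : 0 < K) (hc : 0 < c) :
    IsClassKL fun r t => K * Real.exp (-(c * t)) * r where
  cont := by fun_prop
  classK t _ := isClassK_const_mul (mul_pos hK (Real.exp_pos _))
  strictAnti r hr := fun s _ t _ hst => by
    have : Real.exp (-(c * t)) < Real.exp (-(c * s)) := Real.exp_lt_exp.2 (by
      have := mul_lt_mul_of_pos_left hst hc
      linarith)
    have := mul_lt_mul_of_pos_left (mul_lt_mul_of_pos_left this hK) hr
    linarith
  tendsto r _ := by
    have h1 : Tendsto (fun t : ℝ => Real.exp (-(c * t))) atTop (𝓝 0) :=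
      Real.tendsto_exp_neg_atTop_nhds_zero.comp (tendsto_id.const_mul_atTop hc)
    simpa using (h1.const_mul K).mul_const r

section ISS

variable {n : ℕ} {Ω : Set (RSpace n)} {S : ParabolicSystem n} {p : RSpace n → ℝ}
  {p₀ aLow aUp c K k l bLow : ℝ} {ψ₁ : RSpace n → ℝ → ℝ} {ψ₂ : ℝ → ℝ} {φ : ℝ → ℝ} {δ₀ δ₁ : ℝ}

/-- An exponential estimate yields input-to-state stability, if `ψ₂⁻¹` is linearly bounded. -/
theorem isOrliczISS_of_estimate (hn : 0 < n) (hΩ : IsSmoothBoundedDomain Ω)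
    (hgrowth : GrowthAssumption S Ω aLow aUp) (hdir : DirichletAssumption S Ω p p₀ ψ₁ ψ₂)
    (hφ : IsTolksdorf φ δ₀ δ₁) (hK : 0 < K) (hc : 0 < c)
    (hest : ∀ I : ParabolicInput n, I.IsAdmissible S Ω → ∀ T : ℝ, 0 < T →
      ∀ w : RSpace n → ℝ → ℝ, IsDirichletSolution S I Ω T w →
      normL1 Ω (fun x => p x * w x T) ≤
        K * Real.exp (-(c * T)) * normL1 Ω (fun x => p x * I.w₀ x)
        + K * orliczGain φ δ₀ δ₁ c *
          normOrliczL1Boundary (youngFn φ) T Ω (boundaryTerm S I Ω p ψ₁ ψ₂)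
        + K * orliczGain φ δ₀ δ₁ c * normOrliczL1 (youngFn φ) T Ω (fun x t => p x * I.f x t))
    (hψ : ∃ C : ℝ, 0 < C ∧ ∀ s : ℝ, |Function.invFun ψ₂ s| ≤ C * |s|) :
    IsOrliczISS S Ω p (youngFn φ) := by
  obtain ⟨C, hC, hCψ⟩ := hψ
  obtain ⟨ψLow, hψ0, hψLow⟩ := hdir.ψ₁_low
  obtain ⟨N, hN⟩ := hΩ.isCompact_closure.exists_bound_of_continuousOn
    (IsBoundaryDefining.continuousOn_fderivWithin hΩ hdir.p_C1)
  obtain ⟨N', hN'⟩ := hΩ.isCompact_closure.exists_bound_of_continuousOn hdir.p_C1.continuousOn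
  obtain ⟨x₀, hx₀⟩ := hΩ.isConnected.nonempty
  have hx₀c := subset_closure hx₀
  have hN0 : 0 ≤ N := (norm_nonneg _).trans (hN x₀ hx₀c)
  have hN'0 : 0 ≤ N' := (norm_nonneg _).trans (hN' x₀ hx₀c)
  have haUp : 0 < aUp := hgrowth.aLow_pos.trans_le
    ((hgrowth.a_bounds x₀ hx₀c 0 le_rfl).1.trans (hgrowth.a_bounds x₀ hx₀c 0 le_rfl).2)
  have hgain := hφ.orliczGain_pos hc
  -- `N + 1` is used because `N` may be 0, while class 𝒦 requires a strictly positive factor; the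
  -- same applies to `N' + 1`.
  set Kb := aUp * (C * (1 / ψLow)) * (N + 1) with hKb
  have hKb0 : 0 < Kb := by positivity
  refine ⟨fun r t => K * Real.exp (-(c * t)) * r, fun s => K * orliczGain φ δ₀ δ₁ c * Kb * s,
    fun s => K * orliczGain φ δ₀ δ₁ c * (N' + 1) * s, isClassKL_exp hK hc,
    isClassK_const_mul (by positivity), isClassK_const_mul (by positivity),
    fun I hI T hT w hw => (hest I hI T hT w hw).trans ?_⟩
  set σ : Measure (RSpace n) := Measure.euclideanHausdorffMeasure (n - 1) with hσ
  have hsub : closure Ω ×ˢ Icc 0 T ⊆ closure Ω ×ˢ Ici 0 := prod_mono le_rfl Icc_subset_Ici_self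
  have hfcl := hI.f.continuousOn.mono hsub
  have hdcl := hI.d.continuousOn.mono hsub
  have hbdry : normOrliczL1Boundary (youngFn φ) T Ω (boundaryTerm S I Ω p ψ₁ ψ₂) ≤
      Kb * normOrliczL1Boundary (youngFn φ) T Ω I.d := by
    have hcont : ContinuousOn (fun t => normL1Boundary Ω (fun x => I.d x t)) (Icc 0 T) :=
      IsSmoothBoundedDomain.continuousOn_integral_frontier hn hΩ (F := fun x t => |I.d x t|)
        hdcl.abs
    obtain ⟨M, hM⟩ := isCompact_Icc.exists_bound_of_continuousOn hcont
    refine hφ.luxemburgNorm_le_mul hKb0 (fun t ht => hM t (Ioo_subset_Icc_self ht)) fun t ht => ?_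
    have h0 : ∀ u : RSpace n → ℝ, 0 ≤ normL1Boundary Ω u := fun u =>
      integral_nonneg fun x => abs_nonneg _
    rw [abs_of_nonneg (h0 _), abs_of_nonneg (h0 _), normL1Boundary, normL1Boundary,
      ← integral_const_mul]
    refine integral_mono_of_nonneg (Eventually.of_forall fun x => abs_nonneg _) ?_ ?_
    · refine Integrable.const_mul ?_ Kb
      exact IsBoundaryDefining.integrableOn_frontier hn hΩ (hdcl.abs.comp (by fun_prop :
        ContinuousOn (fun x : RSpace n => (x, t)) (frontier Ω))
        fun x hx => ⟨frontier_subset_closure hx, Ioo_subset_Icc_self ht⟩)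
    · refine (ae_restrict_iff' isClosed_frontier.measurableSet).2
        (Eventually.of_forall fun x hx => ?_)
      have hxc := frontier_subset_closure hx
      have hψx := hψLow x hx t ht.1.le
      have hax := hgrowth.a_bounds x hxc t ht.1.le
      have h1 : |Function.invFun ψ₂ (I.d x t / ψ₁ x t)| ≤ C * (1 / ψLow) * |I.d x t| := by
        refine (hCψ _).trans ?_
        rw [abs_div, abs_of_pos (hψ0.trans_le hψx), mul_assoc]
        refine mul_le_mul_of_nonneg_left ?_ hC.le
        rw [one_div_mul_eq_div]
        gcongr
      simp only [boundaryTerm]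
      rw [abs_mul, abs_mul, abs_of_nonneg (hgrowth.aLow_pos.le.trans hax.1), abs_norm,
        norm_gradientWithin]
      calc S.a x t * |Function.invFun ψ₂ (I.d x t / ψ₁ x t)| * ‖fderivWithin ℝ p (closure Ω) x‖
          ≤ aUp * (C * (1 / ψLow) * |I.d x t|) * (N + 1) := by
            have := hax.2
            have := hN x hxc
            gcongr
            linarith
        _ = Kb * |I.d x t| := by rw [hKb]; ring
  have hdom : normOrliczL1 (youngFn φ) T Ω (fun x t => p x * I.f x t) ≤
      (N' + 1) * normOrliczL1 (youngFn φ) T Ω I.f := by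
    have hcont : ContinuousOn (fun t => normL1 Ω (fun x => I.f x t)) (Icc 0 T) :=
      hΩ.continuousOn_integral (F := fun x t => |I.f x t|) hfcl.abs
    obtain ⟨M, hM⟩ := isCompact_Icc.exists_bound_of_continuousOn hcont
    refine hφ.luxemburgNorm_le_mul (by positivity)
      (fun t ht => hM t (Ioo_subset_Icc_self ht)) fun t ht => ?_
    have h0 : ∀ u : RSpace n → ℝ, 0 ≤ normL1 Ω u := fun u => integral_nonneg fun x => abs_nonneg _
    rw [abs_of_nonneg (h0 _), abs_of_nonneg (h0 _), normL1, normL1, ← integral_const_mul]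
    refine integral_mono_of_nonneg (Eventually.of_forall fun x => abs_nonneg _) ?_ ?_
    · exact (hΩ.integrableOn_slice (F := fun x t => |I.f x t|) hfcl.abs
        (Ioo_subset_Icc_self ht)).const_mul _
    · refine (ae_restrict_iff' hΩ.isOpen.measurableSet).2 (Eventually.of_forall fun x hx => ?_)
      simp only
      rw [abs_mul]
      have h2 : |p x| ≤ N' := hN' x (subset_closure hx)
      exact mul_le_mul_of_nonneg_right (by linarith) (abs_nonneg _)
  have hG : 0 ≤ K * orliczGain φ δ₀ δ₁ c := by positivity
  have h1 := mul_le_mul_of_nonneg_left hbdry hG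
  have h2 := mul_le_mul_of_nonneg_left hdom hG
  simp only
  linarith

end ISS

/-! ### The two decay estimates and the choice of parameters -/

section decay

variable {n : ℕ} {Ω : Set (RSpace n)} {S : ParabolicSystem n} {I : ParabolicInput n} {T : ℝ}
  {w μ : RSpace n → ℝ → ℝ} {p : RSpace n → ℝ} {p₀ aLow aUp bLow cLow k l : ℝ}
  {ψ₁ : RSpace n → ℝ → ℝ} {ψ₂ : ℝ → ℝ} {j : Fin n} {φ : ℝ → ℝ} {δ₀ δ₁ : ℝ}

lemma GrowthAssumption.a_nonneg (hgrowth : GrowthAssumption S Ω aLow aUp) :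
    ∀ x ∈ closure Ω, ∀ t, 0 ≤ t → 0 ≤ S.a x t := fun x hx t ht =>
  hgrowth.aLow_pos.le.trans (hgrowth.a_bounds x hx t ht).1

/-- The estimate for a positive reaction coefficient. -/
theorem normL1_le_of_pos (hn : 0 < n) (hΩ : IsSmoothBoundedDomain Ω) (hS : S.IsSmooth Ω)
    (hgrowth : GrowthAssumption S Ω aLow aUp) (hsign : SignAssumption S Ω μ cLow)
    (hdir : DirichletAssumption S Ω p p₀ ψ₁ ψ₂) (hφ : IsTolksdorf φ δ₀ δ₁) (hc : 0 < cLow)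
    (hI : I.IsAdmissible S Ω) (hT : 0 < T) (hw : IsDirichletSolution S I Ω T w) :
    normL1 Ω (fun x => p x * w x T) ≤
      Real.exp (-(cLow * T)) * normL1 Ω (fun x => p x * I.w₀ x)
      + orliczGain φ δ₀ δ₁ cLow *
        normOrliczL1Boundary (youngFn φ) T Ω (boundaryTerm S I Ω p ψ₁ ψ₂)
      + orliczGain φ δ₀ δ₁ cLow * normOrliczL1 (youngFn φ) T Ω (fun x t => p x * I.f x t) := by
  have h := (hdir.isWeight (w := w) (T := T) hn hΩ hS hgrowth hsign).normL1_le
    (by rwa [zero_add]) hn hΩ hS hI hsign hgrowth.a_nonneg hdir hw hT hφ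
    (fun x hx => hdir.p_nonneg hn hΩ hS hgrowth hx) one_pos one_pos
    (fun x _ => (one_mul _).le) (fun x _ => (one_mul _).ge) (fun x _ => (one_mul _).ge)
  simpa only [zero_add, div_one, one_mul] using h

/-- The estimate for a vanishing reaction coefficient. -/
theorem normL1_le_of_expWeight (hn : 0 < n) (hΩ : IsSmoothBoundedDomain Ω) (hS : S.IsSmooth Ω)
    (hgrowth : GrowthAssumption S Ω aLow aUp) (hsign : SignAssumption S Ω μ 0)
    (hdir : DirichletAssumption S Ω p p₀ ψ₁ ψ₂) (hφ : IsTolksdorf φ δ₀ δ₁) (hk : 0 < k)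
    (hl : 0 < l) (hW : IsWeight S Ω T μ w (fun x => p x * expWeight k l (x j))
      (decayRate (maxBoundaryDist Ω) aLow bLow k l) 0)
    (hrate : 0 < decayRate (maxBoundaryDist Ω) aLow bLow k l)
    (hI : I.IsAdmissible S Ω) (hT : 0 < T) (hw : IsDirichletSolution S I Ω T w) :
    normL1 Ω (fun x => p x * w x T) ≤
      overshootConst (maxBoundaryDist Ω) k l
        * Real.exp (-(decayRate (maxBoundaryDist Ω) aLow bLow k l * T))
        * normL1 Ω (fun x => p x * I.w₀ x)
      + overshootConst (maxBoundaryDist Ω) k l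
        * orliczGain φ δ₀ δ₁ (decayRate (maxBoundaryDist Ω) aLow bLow k l)
        * normOrliczL1Boundary (youngFn φ) T Ω (boundaryTerm S I Ω p ψ₁ ψ₂)
      + overshootConst (maxBoundaryDist Ω) k l
        * orliczGain φ δ₀ δ₁ (decayRate (maxBoundaryDist Ω) aLow bLow k l)
        * normOrliczL1 (youngFn φ) T Ω (fun x t => p x * I.f x t) := by
  set D := maxBoundaryDist Ω with hD
  have hE := Real.exp_pos (l * D)
  have hE' := Real.exp_pos (-(l * D))
  have hp := fun x (hx : x ∈ Ω) => hdir.p_nonneg hn hΩ hS hgrowth hx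
  have hz₁ : ∀ x ∈ closure Ω, (k + Real.exp (l * D))⁻¹ ≤ expWeight k l (x j) := fun x hx => by
    have h1 := (abs_le.1 (hΩ.abs_coord_le hx j)).2
    have := Real.exp_pos (l * x j)
    unfold expWeight
    gcongr
  have hz₂ : ∀ x ∈ closure Ω, expWeight k l (x j) ≤ (k + Real.exp (-(l * D)))⁻¹ := fun x hx => by
    have h1 := (abs_le.1 (hΩ.abs_coord_le hx j)).1
    unfold expWeight
    rw [← mul_neg]
    gcongr
  have h := hW.normL1_le (by rwa [add_zero]) hn hΩ hS hI hsign hgrowth.a_nonneg hdir hw hT hφ hp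
    (z₁ := (k + Real.exp (l * D))⁻¹) (z₂ := (k + Real.exp (-(l * D)))⁻¹) (by positivity)
    (by positivity)
    (fun x hx => by
      rw [mul_comm]; exact mul_le_mul_of_nonneg_left (hz₁ x (subset_closure hx)) (hp x hx))
    (fun x hx => by
      rw [mul_comm (k + _)⁻¹]
      exact mul_le_mul_of_nonneg_left (hz₂ x (subset_closure hx)) (hp x hx))
    -- On the boundary p = 0, so the gradient of the product reduces to the factor times ∇p, and no
    -- derivative of the factor enters.
    (fun x hx => by
      have hxc := frontier_subset_closure hx
      have hpd := (hdir.p_C1.differentiableOn one_ne_zero x hxc).hasFDerivWithinAt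
      have hzC : ContDiff ℝ 1 fun x : RSpace n => expWeight k l (x j) :=
        (contDiff_expWeight hk).comp (EuclideanSpace.proj (𝕜 := ℝ) j).contDiff
      have hzd := (hzC.differentiable one_ne_zero) x
      rw [(hpd.fun_mul hzd.hasFDerivAt.hasFDerivWithinAt).fderivWithin
        (hΩ.uniqueDiffOn_closure x hxc), hdir.p_boundary x hx, zero_smul, zero_add, norm_smul,
        Real.norm_of_nonneg (expWeight_pos hk _).le]
      exact mul_le_mul_of_nonneg_right (hz₂ x hxc) (norm_nonneg _))
  have e : (k + Real.exp (-(l * D)))⁻¹ / (k + Real.exp (l * D))⁻¹ = overshootConst D k l := by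
    rw [overshootConst]; field_simp
  simpa only [add_zero, e] using h

lemma overshootConst_pos (D : ℝ) (hk : 0 < k) (l : ℝ) : 0 < overshootConst D k l := by
  have hE := Real.exp_pos (l * D)
  have hE' := Real.exp_pos (-(l * D))
  unfold overshootConst; positivity

/-- Admissible parameters for the exponential modification of the weight exist. -/
lemma DirichletAssumption.exists_parameters (hdir : DirichletAssumption S Ω p p₀ ψ₁ ψ₂)
    (hΩ : IsSmoothBoundedDomain Ω)
    (hconv : ConvectionSign S Ω p j ∨ ∃ mUp : ℝ, 0 ≤ mUp ∧ ConvectionBound S Ω p j mUp)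
    (aUp bLow : ℝ) : ∃ l k : ℝ, max 0 (-bLow) < l ∧
      2 * l * Real.exp (l * maxBoundaryDist Ω) / (l + bLow) < k ∧
      (∀ x ∈ closure Ω, 2 * aUp * l * Real.exp (l * maxBoundaryDist Ω) / p₀
        * |partialWithin j p (closure Ω) x| < k) ∧
      (ConvectionSign S Ω p j ∨ ∃ mUp : ℝ, 0 ≤ mUp ∧ ConvectionBound S Ω p j mUp ∧
        2 * l * Real.exp (l * maxBoundaryDist Ω) * mUp < k) := by
  -- Once l is fixed, every remaining condition is a lower bound on k by a finite number.
  set l := max 0 (-bLow) + 1 with hl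
  set E := Real.exp (l * maxBoundaryDist Ω)
  have hcont : ContinuousOn (fun x => 2 * aUp * l * E / p₀ * |partialWithin j p (closure Ω) x|)
      (closure Ω) := by
    refine ContinuousOn.const_mul (ContinuousOn.abs ?_) _
    exact (IsBoundaryDefining.continuousOn_fderivWithin hΩ hdir.p_C1).clm_apply continuousOn_const
  obtain ⟨N, hN⟩ := hΩ.isCompact_closure.exists_bound_of_continuousOn hcont
  have hmax : ∃ m : ℝ, ConvectionSign S Ω p j ∨ ∃ mUp : ℝ, 0 ≤ mUp ∧ ConvectionBound S Ω p j mUp ∧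
      2 * l * E * mUp ≤ m := by
    rcases hconv with h | ⟨mUp, h0, hB⟩
    · exact ⟨0, Or.inl h⟩
    · exact ⟨_, Or.inr ⟨mUp, h0, hB, le_rfl⟩⟩
  obtain ⟨m, hm⟩ := hmax
  refine ⟨l, max (2 * l * E / (l + bLow)) (max N m) + 1, by linarith, ?_, fun x hx => ?_, ?_⟩
  · exact (le_max_left _ _).trans_lt (lt_add_one _)
  · exact ((le_abs_self _).trans (hN x hx)).trans_lt
      (((le_max_left _ _).trans (le_max_right _ _)).trans_lt (lt_add_one _))
  · refine hm.imp_right fun ⟨mUp, h0, hB, hle⟩ => ⟨mUp, h0, hB, hle.trans_lt ?_⟩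
    exact ((le_max_right _ _).trans (le_max_right _ _)).trans_lt (lt_add_one _)

end decay

/-! ### The main theorem -/

theorem mainTheorem4 {n : ℕ} (hn : 0 < n) (Ω : Set (RSpace n)) (hΩ : IsSmoothBoundedDomain Ω)
    (S : ParabolicSystem n) (hS : S.IsSmooth Ω)
    (aLow aUp : ℝ) (hgrowth : GrowthAssumption S Ω aLow aUp)
    (μ : RSpace n → ℝ → ℝ) (cLow : ℝ) (hsign : SignAssumption S Ω μ cLow)
    (p : RSpace n → ℝ) (p₀ : ℝ) (ψ₁ : RSpace n → ℝ → ℝ) (ψ₂ : ℝ → ℝ)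
    (hdir : DirichletAssumption S Ω p p₀ ψ₁ ψ₂)
    (φ : ℝ → ℝ) (δ₀ δ₁ : ℝ) (hφ : IsTolksdorf φ δ₀ δ₁) :
    -- part (i)
    (0 < cLow →
      (∀ I : ParabolicInput n, I.IsAdmissible S Ω → ∀ T : ℝ, 0 < T → ∀ w : RSpace n → ℝ → ℝ,
        IsDirichletSolution S I Ω T w →
        normL1 Ω (fun x => p x * w x T)
          ≤ Real.exp (-(cLow * T)) * normL1 Ω (fun x => p x * I.w₀ x)
            + orliczGain φ δ₀ δ₁ cLow *
                normOrliczL1Boundary (youngFn φ) T Ω (boundaryTerm S I Ω p ψ₁ ψ₂)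
            + orliczGain φ δ₀ δ₁ cLow *
                normOrliczL1 (youngFn φ) T Ω (fun x t => p x * I.f x t)) ∧
      ((∃ C : ℝ, 0 < C ∧ ∀ s : ℝ, |Function.invFun ψ₂ s| ≤ C * |s|) →
        IsOrliczISS S Ω p (youngFn φ))) ∧
    -- part (ii)
    (cLow = 0 → 0 < p₀ → ∀ (j : Fin n) (bLow : ℝ),
      (∀ x ∈ Ω, ∀ t, 0 < t →
        bLow ≤ (S.b x t j + partialWithin j (fun y => S.a y t) Ω x) / S.a x t) →
      (∀ l k : ℝ, max 0 (-bLow) < l →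
        2 * l * Real.exp (l * maxBoundaryDist Ω) / (l + bLow) < k →
        (∀ x ∈ closure Ω, 2 * aUp * l * Real.exp (l * maxBoundaryDist Ω) / p₀
          * |partialWithin j p (closure Ω) x| < k) →
        (ConvectionSign S Ω p j ∨
          ∃ mUp : ℝ, 0 ≤ mUp ∧ ConvectionBound S Ω p j mUp ∧
            2 * l * Real.exp (l * maxBoundaryDist Ω) * mUp < k) →
        0 < decayRate (maxBoundaryDist Ω) aLow bLow k l ∧
        ∀ I : ParabolicInput n, I.IsAdmissible S Ω → ∀ T : ℝ, 0 < T → ∀ w : RSpace n → ℝ → ℝ,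
          IsDirichletSolution S I Ω T w →
          normL1 Ω (fun x => p x * w x T)
            ≤ overshootConst (maxBoundaryDist Ω) k l
                * Real.exp (-(decayRate (maxBoundaryDist Ω) aLow bLow k l * T))
                * normL1 Ω (fun x => p x * I.w₀ x)
              + overshootConst (maxBoundaryDist Ω) k l
                * orliczGain φ δ₀ δ₁ (decayRate (maxBoundaryDist Ω) aLow bLow k l)
                * normOrliczL1Boundary (youngFn φ) T Ω (boundaryTerm S I Ω p ψ₁ ψ₂)
              + overshootConst (maxBoundaryDist Ω) k l
                * orliczGain φ δ₀ δ₁ (decayRate (maxBoundaryDist Ω) aLow bLow k l)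
                * normOrliczL1 (youngFn φ) T Ω (fun x t => p x * I.f x t)) ∧
      ((ConvectionSign S Ω p j ∨ ∃ mUp : ℝ, 0 ≤ mUp ∧ ConvectionBound S Ω p j mUp) →
        (∃ C : ℝ, 0 < C ∧ ∀ s : ℝ, |Function.invFun ψ₂ s| ≤ C * |s|) →
        IsOrliczISS S Ω p (youngFn φ))) := by
  refine ⟨fun hc => ⟨fun I hI T hT w hw =>
    normL1_le_of_pos hn hΩ hS hgrowth hsign hdir hφ hc hI hT hw, fun hψ => ?_⟩,
    fun hc0 hp₀ j bLow hb => ?_⟩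
  · refine isOrliczISS_of_estimate hn hΩ hgrowth hdir hφ one_pos hc (fun I hI T hT w hw => ?_) hψ
    simpa only [one_mul] using normL1_le_of_pos hn hΩ hS hgrowth hsign hdir hφ hc hI hT hw
  · subst hc0
    have hmain : ∀ l k : ℝ, max 0 (-bLow) < l →
        2 * l * Real.exp (l * maxBoundaryDist Ω) / (l + bLow) < k →
        (∀ x ∈ closure Ω, 2 * aUp * l * Real.exp (l * maxBoundaryDist Ω) / p₀
          * |partialWithin j p (closure Ω) x| < k) →
        (ConvectionSign S Ω p j ∨
          ∃ mUp : ℝ, 0 ≤ mUp ∧ ConvectionBound S Ω p j mUp ∧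
            2 * l * Real.exp (l * maxBoundaryDist Ω) * mUp < k) →
        0 < l ∧ 0 < k ∧ 0 < decayRate (maxBoundaryDist Ω) aLow bLow k l ∧
        ∀ T w, IsWeight S Ω T μ w (fun x => p x * expWeight k l (x j))
          (decayRate (maxBoundaryDist Ω) aLow bLow k l) 0 := fun l k hl hk₁ hk₂ hconv => by
      have hl0 : 0 < l := (le_max_left _ _).trans_lt hl
      have hlb : 0 < l + bLow := by linarith [(le_max_right 0 (-bLow)).trans_lt hl]
      have hk : 0 < k := lt_trans (by positivity) hk₁
      exact ⟨hl0, hk, decayRate_pos hgrowth.aLow_pos hk hl0 hlb hk₁, fun T w =>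
        hdir.isWeight_mul_expWeight hn hΩ hS hgrowth hsign hp₀ hb hl hk₁ hk₂ hconv⟩
    refine ⟨fun l k hl hk₁ hk₂ hconv => ?_, fun hconv hψ => ?_⟩
    · obtain ⟨hl0, hk, hrate, hW⟩ := hmain l k hl hk₁ hk₂ hconv
      exact ⟨hrate, fun I hI T hT w hw => normL1_le_of_expWeight hn hΩ hS hgrowth hsign hdir hφ hk
        hl0 (hW T w) hrate hI hT hw⟩
    -- Stability itself mentions no parameters, so any admissible pair l, k will do.
    · obtain ⟨l, k, hl, hk₁, hk₂, hconv'⟩ := hdir.exists_parameters hΩ hconv aUp bLow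
      obtain ⟨hl0, hk, hrate, hW⟩ := hmain l k hl hk₁ hk₂ hconv'
      exact isOrliczISS_of_estimate hn hΩ hgrowth hdir hφ (overshootConst_pos _ hk l) hrate
        (fun I hI T hT w hw => normL1_le_of_expWeight hn hΩ hS hgrowth hsign hdir hφ hk hl0
          (hW T w) hrate hI hT hw) hψ
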